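/- Let $q\ge 2$ and let $u$ be a unitary on $\mathbb C^q\otimes\mathbb C^q$ with entries $u_{ij,kl}$ ($ij$ output, $kl$ input). Call $u$ dual unitary if in addition $D(u)=I$, where $D(u)_{ik,i'k'}=\sum_{j,l}u_{ij,kl}\,\overline{u_{i'j,k'l}}$. Consider the infinite chain of $q$-level systems at the sites $x\in\mathbb Z$ and the brickwork circuit with identical gates $u$: in layers $1,3,5,\dots$ the gate acts on the pairs $(x,x+1)$ with $x$ even, in layers $2,4,6,\dots$ on the pairs with $x$ odd. For a pure initial state $\psi_0$ let $S(Q)_t$ be the von Neumann entropy of $Q=\{x<0\}$ after $t$ layers. The entanglement velocity is $$v_E=\sup_{\psi_0}\ \lim_{t\to\infty}\frac{S(Q)_t}{t\ln q},$$ where $\psi_0$ runs over the short-range entangled pure states (matrix product states of uniformly bounded bond dimension with exponentially decaying correlations) for which the limit exists. Let $\|\cdot\|_1$ be the trace norm. (a) Case $q=2$: there is a constant $K$ such that, for every $0<\eta<1$ and every unitary gate $u$ with $v_E=1-\eta$, there is a dual unitary $u_\times$ with $\|u-u_\times\|_1\le K\eta^{1/4}$. (b) Case $q>2$: for every such $q$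 there is a function $f_q$ with $f_q(\eta)\to0$ as $\eta\to0^+$ such that, for every $0<\eta<1$ and every unitary gate $u$ with $v_E=1-\eta$, there is a dual unitary $u_\times$ with $\|u-u_\times\|_1\le f_q(\eta)$. (c) For $q=2$ there is a constant $K'$ such that, for every $\delta\ge0$ and every unitary gate $u$ with $\|I-D(u)\|_1\le\delta$, there is a dual unitary $u_\times$ with $\|u-u_\times\|_1\le K'\sqrt\delta$. -/

import Mathlib

open Filter Topology

noncomputable section

namespace DualUnitarity

/-- The trace norm (Schatten 1-norm): the sum of the singular values. -/
def traceNorm {m : Type*} [Fintype m] [DecidableEq m] (M : Matrix m m ℂ) : ℝ :=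
  ∑ i, Real.sqrt ((Matrix.isHermitian_conjTranspose_mul_self M).eigenvalues i)

/-- The von Neumann entropy `-tr (ρ ln ρ)` of a Hermitian matrix `ρ`. -/
def vonNeumannEntropy {m : Type*} [Fintype m] [DecidableEq m] (ρ : Matrix m m ℂ)
    (hρ : ρ.IsHermitian) : ℝ :=
  ∑ i, Real.negMulLog (hρ.eigenvalues i)

/-- The entanglement entropy of a bipartite pure state, given by its matrix of amplitudes `M a b`:
the entropy of the reduced density matrix `M Mᴴ` of the first party. -/
def entanglementEntropy {a b : Type*} [Fintype a] [DecidableEq a] [Fintype b]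
    (M : Matrix a b ℂ) : ℝ :=
  vonNeumannEntropy (M * M.conjTranspose) (Matrix.isHermitian_mul_conjTranspose_self M)

/-! ### Two-site gates -/

/-- A two-site operator; `u (i, j) (k, l)` is the entry `u_{ij,kl}`, where `i, j` are the two
output legs and `k, l` the two input legs. -/
abbrev Gate (q : ℕ) : Type := Matrix (Fin q × Fin q) (Fin q × Fin q) ℂ

/-- `u` is a unitary two-site gate. -/
def IsUnitaryGate {q : ℕ} (u : Gate q) : Prop :=
  u ∈ Matrix.unitaryGroup (Fin q × Fin q) ℂ

/-- The gate viewed sideways: rows are the two left legs `i, k`, columns the right legs `j, l`. -/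
def sideways {q : ℕ} (u : Gate q) : Matrix (Fin q × Fin q) (Fin q × Fin q) ℂ :=
  Matrix.of fun ik jl => u (ik.1, jl.1) (ik.2, jl.2)

/-- The contraction `∑_{j,l} u_{ij,kl} u*_{i'j,k'l}`, with rows `(i, k)` and columns `(i', k')`. -/
def dualContraction {q : ℕ} (u : Gate q) : Matrix (Fin q × Fin q) (Fin q × Fin q) ℂ :=
  sideways u * (sideways u).conjTranspose

/-- A dual unitary: `u` is unitary, and `∑_{j,l} u_{ij,kl} u*_{i'j,k'l} = δ_{ii'} δ_{kk'}`. -/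
def IsDualUnitary {q : ℕ} (u : Gate q) : Prop :=
  IsUnitaryGate u ∧ dualContraction u = 1

/-! ### Pure states of the infinite chain

The sites are the integers, and the cut separates `Q = {x < 0}` from `{x ≥ 0}`.  A pure state of
finite bond dimensions is written in its mixed canonical form around the cut: a normalized matrix
on the bond at the cut, and on each side a sequence of isometries from each bond to the
next site and the next bond further away from the cut. -/

/-- One side of the chain: `bond k` is the dimension of the bond at distance `k` from the cut, and
`tensor k` is an isometry from that bond to the site at distance `k` tensor the next bond. -/
structure HalfChain (q : ℕ) where
  bond : ℕ → ℕ
  tensor : (k : ℕ) → Matrix (Fin q × Fin (bond (k + 1))) (Fin (bond k)) ℂ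
  isometry : ∀ k, (tensor k).conjTranspose * tensor k = 1

namespace HalfChain

variable {q : ℕ}

/-- The tensor of site `k` at a given value `i` of its physical index. -/
def site (H : HalfChain q) (k : ℕ) (i : Fin q) :
    Matrix (Fin (H.bond (k + 1))) (Fin (H.bond k)) ℂ :=
  Matrix.of fun b a => H.tensor k (i, b) a

/-- The product of the first `n` tensors, at the values `s` of the physical indices: a map from the
bond at the cut to the bond at distance `n`. -/
def amplitude (H : HalfChain q) :
    (n : ℕ) → (Fin n → Fin q) → Matrix (Fin (H.bond n)) (Fin (H.bond 0)) ℂ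
  | 0, _ => 1
  | n + 1, s => H.site n (s (Fin.last n)) * H.amplitude n (fun k => s k.castSucc)

/-- The transfer channel from bond `m` to bond `m + n`, tracing out the sites in between. -/
def transfer (H : HalfChain q) (m : ℕ) :
    (n : ℕ) → Matrix (Fin (H.bond m)) (Fin (H.bond m)) ℂ →
      Matrix (Fin (H.bond (m + n))) (Fin (H.bond (m + n))) ℂ
  | 0, X => X
  | n + 1, X =>
      ∑ i : Fin q, H.site (m + n) i * H.transfer m n X * (H.site (m + n) i).conjTranspose

/-- Bounded bond dimension, and exponential decay of correlations: the transfer channels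
forget their input exponentially fast in the distance. -/
def IsShortRange (H : HalfChain q) : Prop :=
  (∃ D : ℕ, ∀ k, H.bond k ≤ D) ∧
  ∃ K c : ℝ, 0 ≤ c ∧ c < 1 ∧
    ∀ (m n : ℕ) (X : Matrix (Fin (H.bond m)) (Fin (H.bond m)) ℂ), X.trace = 0 →
      traceNorm (H.transfer m n X) ≤ K * c ^ n * traceNorm X

end HalfChain

/-- A normalized pure state of the infinite chain with finite bond dimensions. -/
structure ChainState (q : ℕ) where
  left : HalfChain q
  right : HalfChain q
  center : Matrix (Fin (left.bond 0)) (Fin (right.bond 0)) ℂ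
  normalized : ∑ a, ∑ b, ‖center a b‖ ^ 2 = 1

/-- Short-range entangled states: matrix product states of bounded bond dimension
with exponentially decaying correlations. -/
def ChainState.IsShortRange {q : ℕ} (ψ : ChainState q) : Prop :=
  ψ.left.IsShortRange ∧ ψ.right.IsShortRange

/-- Amplitudes of a pure state on the window of the `2n` sites `-n, …, n - 1`, together with a left
and a right environment; position `j : Fin (n + n)` of the window is the lattice site `j - n`. -/
abbrev WindowState (q n dL dR : ℕ) : Type := Fin dL → (Fin (n + n) → Fin q) → Fin dR → ℂ

/-- The state seen on the window `-n, …, n - 1`.  The part of the chain outside of the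
window enters only through the two outer bonds, up to isometries of the outside. -/
def ChainState.window {q : ℕ} (ψ : ChainState q) (n : ℕ) :
    WindowState q n (ψ.left.bond n) (ψ.right.bond n) :=
  fun a c b =>
    (ψ.left.amplitude n (fun k => c (Fin.castAdd n k.rev)) * ψ.center *
      (ψ.right.amplitude n (fun k => c (Fin.natAdd n k))).transpose) a b

/-! ### The brickwork circuit -/

/-- Application of the gate `u` to the two neighbouring positions `i, i + 1` of the window (nothing
happens if they are not both in the window). -/
def applyGate {q n dL dR : ℕ} (u : Gate q) (i : ℕ) (Ψ : WindowState q n dL dR) :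
    WindowState q n dL dR :=
  if h : i + 1 < n + n then
    fun a c b =>
      ∑ k : Fin q, ∑ l : Fin q,
        u (c ⟨i, by omega⟩, c ⟨i + 1, h⟩) (k, l) *
          Ψ a (Function.update (Function.update c ⟨i, by omega⟩ k) ⟨i + 1, h⟩ l) b
  else Ψ

/-- The `s`-th layer of the brickwork, `s = 1, 2, …`: the gate `u` acts on the lattice
sites `x, x + 1` for every even `x` if `s` is odd, and for every odd `x` if `s` is even.  (The gates
of a layer act on disjoint pairs of sites, so their order is immaterial.) -/
def applyLayer {q n dL dR : ℕ} (u : Gate q) (s : ℕ) (Ψ : WindowState q n dL dR) :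
    WindowState q n dL dR :=
  (List.range (n + n)).foldl (fun Φ i => if Odd (i + n + s) then applyGate u i Φ else Φ) Ψ

/-- The first `t` layers of the brickwork circuit. -/
def evolve {q n dL dR : ℕ} (u : Gate q) (Ψ : WindowState q n dL dR) :
    ℕ → WindowState q n dL dR
  | 0 => Ψ
  | t + 1 => applyLayer u (t + 1) (evolve u Ψ t)

/-- The amplitudes as a matrix: rows are the left environment and the sites `< 0`, columns the
sites `≥ 0` and the right environment. -/
def cutMatrix {q n dL dR : ℕ} (Ψ : WindowState q n dL dR) :
    Matrix (Fin dL × (Fin n → Fin q)) (Fin dR × (Fin n → Fin q)) ℂ :=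
  Matrix.of fun x y => Ψ x.1 (Fin.append x.2 y.2) y.1

/-- `S(Q)_t`: the entropy of `Q = {x < 0}` after `t` layers, from the initial state `ψ`.  The window
`-t, …, t - 1` contains the past light cone of the cut; all other gates can be applied after those
of the light cone, each on one side of the cut only, and do not change the entropy. -/
def entropyAt {q : ℕ} (u : Gate q) (ψ : ChainState q) (t : ℕ) : ℝ :=
  entanglementEntropy (cutMatrix (evolve u (ψ.window t) t))

/-- `r` is the asymptotic growth rate `lim S(Q)_t / (t ln q)` from the initial state `ψ`. -/
def IsGrowthRate {q : ℕ} (u : Gate q) (ψ : ChainState q) (r : ℝ) : Prop :=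
  Tendsto (fun t : ℕ => entropyAt u ψ t / (t * Real.log q)) atTop (𝓝 r)

/-- `v` is the entanglement velocity of the brickwork circuit with identical gates `u`: the maximal
asymptotic growth rate (supremum) over short-range entangled initial states. -/
def IsEntanglementVelocity {q : ℕ} (u : Gate q) (v : ℝ) : Prop :=
  IsLUB {r : ℝ | ∃ ψ : ChainState q, ψ.IsShortRange ∧ IsGrowthRate u ψ r} v

end DualUnitarity

end

open DualUnitarity

/-!
Entropy along the circuit.  Only the gate across the cut changes the entropy of `{x < 0}`, and it
does so in every second layer.  Let `A B C D` be the four parts of the chain, with `B` and `C` the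
two sites that this gate acts on.  Its entropy gain falls short of `2 ln q` by the sum of two
relative entropies, each with respect to a state in which one site is maximally mixed and
uncorrelated.  A relative entropy bounds the squared Hilbert–Schmidt distance of the square roots of
the two states, by `log x ≤ x - 1` for the overlaps of their eigenvectors
(`hsNorm_psdSqrt_sub_sq_le`).  If the gain is almost `2 ln q`, then traceless operators on `B` are
almost uncorrelated with `A` after the gate.  Operators on `A` are moved to the purifying system
`BCD` by the polar decomposition, and there `B` and `C` were almost maximally mixed before the gate;
so the correlation is, up to the error, an entry of `D(u) - 1`
(`norm_dualContraction_sub_one_sq_le`).  Hence each such gain is at most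
`2 ln q - |(D(u) - 1)_{xy}|² / (36 q⁴)`, for every state, and a gate of velocity `1 - η` satisfies
`|(D(u) - 1)_{xy}|² ≤ 72 q⁴ ln q · η` (`norm_dualContraction_sub_one_sq_le_of_velocity`).

From approximate to exact dual unitarity.  For general `q` the unitary gates form a compact set, and
the dual unitaries are the zeros of the continuous function `D(u) - 1` on it; so a gate with small
`D(u) - 1` is close to a dual unitary, without a rate (`exists_modulus`).

For `q = 2` the rate comes from the Cartan decomposition (`exists_canonical_form`): up to local
unitaries, a gate is diagonal in the Bell basis.  To see this, pass to the magic basis, in which the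
determinant form on `ℂ² ⊗ ℂ²` is the standard symmetric form.  There the gate is a product of a real
orthogonal, a diagonal and a real orthogonal matrix; and a unitary that preserves the determinant
form maps product vectors to product vectors, so it is local up to a swap.  Local unitaries conjugate
`D(u)` by a unitary, so only the Bell-diagonal gate matters.  For this gate `D(u) - 1` consists of
the numbers `C² + C'² - 1`, `2 C C' c` and `2 S S' c`, where `(C, S)` and `(C', S')` are points of
the unit circle and `c` is the cosine of the relative phase.  If these are at most `ε²`, then either
`|c| ≤ ε`, and the phase can be moved to make `c` vanish, or the products `C C'` and `S S'` are of
order `ε`, and both points can be moved to coordinate axes (`exists_exact_parameters`).  This is the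
bound of order `√δ`; together with `δ` of order `√η` it gives `η ^ (1 / 4)`.
-/

namespace DualUnitarity

open Matrix

/-! ### Hilbert–Schmidt norm, trace norm and contractions -/

section HilbertSchmidt

variable {l m n k : Type*} [Fintype l] [Fintype m] [Fintype n] [Fintype k]

/-- The Hilbert–Schmidt (Frobenius) norm of a matrix.  It is a plain function rather than one of
Mathlib's local norm instances, so that it can be used next to the operator norm. -/
noncomputable def hsNorm (M : Matrix m n ℂ) : ℝ := Real.sqrt (∑ i, ∑ j, ‖M i j‖ ^ 2)

theorem hsNorm_nonneg (M : Matrix m n ℂ) : 0 ≤ hsNorm M := Real.sqrt_nonneg _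

theorem hsNorm_sq (M : Matrix m n ℂ) : hsNorm M ^ 2 = ∑ i, ∑ j, ‖M i j‖ ^ 2 :=
  Real.sq_sqrt (by positivity)

theorem norm_entry_le_hsNorm (M : Matrix m n ℂ) (i : m) (j : n) : ‖M i j‖ ≤ hsNorm M := by
  refine Real.le_sqrt_of_sq_le ?_
  calc ‖M i j‖ ^ 2 ≤ ∑ j, ‖M i j‖ ^ 2 :=
        Finset.single_le_sum (f := fun j => ‖M i j‖ ^ 2) (fun _ _ => by positivity)
          (Finset.mem_univ j)
    _ ≤ _ := Finset.single_le_sum (f := fun i => ∑ j, ‖M i j‖ ^ 2) (fun _ _ => by positivity)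
          (Finset.mem_univ i)

theorem hsNorm_le_of_entry_le (M : Matrix m n ℂ) {c : ℝ} (hc : 0 ≤ c) (h : ∀ i j, ‖M i j‖ ≤ c) :
    hsNorm M ≤ Real.sqrt (Fintype.card m * Fintype.card n) * c := by
  rw [← Real.sqrt_sq hc, ← Real.sqrt_mul (by positivity)]
  refine Real.sqrt_le_sqrt ?_
  calc ∑ i, ∑ j, ‖M i j‖ ^ 2 ≤ ∑ _i : m, ∑ _j : n, c ^ 2 := by
        gcongr with i _ j _; exact h i j
    _ = _ := by simp [mul_assoc]

theorem hsNorm_conjTranspose (M : Matrix m n ℂ) : hsNorm Mᴴ = hsNorm M := by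
  unfold hsNorm
  rw [Finset.sum_comm]
  simp

theorem hsNorm_sub_comm (M N : Matrix m n ℂ) : hsNorm (M - N) = hsNorm (N - M) := by
  unfold hsNorm
  simp [norm_sub_rev]

theorem trace_conjTranspose_mul_self_eq_hsNorm_sq (M : Matrix m n ℂ) :
    (Mᴴ * M).trace = ((hsNorm M ^ 2 : ℝ) : ℂ) := by
  rw [hsNorm_sq, Finset.sum_comm]
  simp [Matrix.trace, Matrix.mul_apply, Complex.conj_mul']

theorem norm_trace_mul_le (A : Matrix m n ℂ) (B : Matrix n m ℂ) :
    ‖(A * B).trace‖ ≤ hsNorm A * hsNorm B := by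
  have h1 : ‖(A * B).trace‖ ≤ ∑ p : m × n, ‖A p.1 p.2‖ * ‖B p.2 p.1‖ := by
    rw [Fintype.sum_prod_type]
    simp only [Matrix.trace, Matrix.diag, Matrix.mul_apply]
    refine (norm_sum_le _ _).trans (Finset.sum_le_sum fun i _ => (norm_sum_le _ _).trans ?_)
    simp
  refine h1.trans ((Real.sum_mul_le_sqrt_mul_sqrt _ _ _).trans (le_of_eq ?_))
  unfold hsNorm
  rw [Fintype.sum_prod_type, Fintype.sum_prod_type, Finset.sum_comm (f := fun i j => ‖B i j‖ ^ 2)]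

/-- A matrix that does not increase the Euclidean norm of vectors. -/
def IsContraction (Z : Matrix m n ℂ) : Prop :=
  ∀ v : n → ℂ, ∑ i, ‖(Z *ᵥ v) i‖ ^ 2 ≤ ∑ j, ‖v j‖ ^ 2

theorem IsContraction.mul {A : Matrix l m ℂ} {B : Matrix m n ℂ} (hA : IsContraction A)
    (hB : IsContraction B) : IsContraction (A * B) := fun v => by
  rw [← Matrix.mulVec_mulVec]
  exact (hA _).trans (hB v)

theorem IsContraction.hsNorm_mul_le {Z : Matrix l m ℂ} (hZ : IsContraction Z)
    (A : Matrix m n ℂ) : hsNorm (Z * A) ≤ hsNorm A := by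
  refine Real.sqrt_le_sqrt ?_
  rw [Finset.sum_comm, Finset.sum_comm (f := fun i j => ‖A i j‖ ^ 2)]
  refine Finset.sum_le_sum fun j _ => ?_
  exact hZ (fun i => A i j)

open scoped Matrix.Norms.L2Operator in
theorem isContraction_iff_l2_opNorm_le [DecidableEq n] {Z : Matrix m n ℂ} :
    IsContraction Z ↔ ‖Z‖ ≤ 1 := by
  constructor
  · intro h
    rw [Matrix.l2_opNorm_def]
    refine ContinuousLinearMap.opNorm_le_bound _ zero_le_one fun v => ?_
    rw [one_mul, EuclideanSpace.norm_eq, EuclideanSpace.norm_eq]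
    exact Real.sqrt_le_sqrt (h v.ofLp)
  · intro h v
    have := (Matrix.l2_opNorm_mulVec Z (WithLp.toLp 2 v)).trans
      (mul_le_of_le_one_left (norm_nonneg _) h)
    rw [EuclideanSpace.norm_eq, EuclideanSpace.norm_eq] at this
    exact (Real.sqrt_le_sqrt_iff (by positivity)).1 this

theorem IsContraction.conjTranspose {Z : Matrix m n ℂ} (hZ : IsContraction Z) :
    IsContraction Zᴴ := by
  classical
  rw [isContraction_iff_l2_opNorm_le] at hZ ⊢
  rwa [Matrix.l2_opNorm_conjTranspose]

theorem IsContraction.map_star {Z : Matrix m n ℂ} (hZ : IsContraction Z) :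
    IsContraction (Z.map star) := fun v => by
  have h := hZ (star v)
  have e : Z.map star *ᵥ v = star (Z *ᵥ star v) := by
    ext i; simp [Matrix.mulVec, dotProduct]
  rw [e]
  simpa using h

theorem IsContraction.transpose {Z : Matrix m n ℂ} (hZ : IsContraction Z) :
    IsContraction Zᵀ := by
  have := hZ.conjTranspose.map_star
  rwa [show Zᴴ.map star = Zᵀ by ext; simp] at this

theorem isContraction_of_conjTranspose_mul_self_eq_one [DecidableEq n] {Z : Matrix m n ℂ}
    (h : Zᴴ * Z = 1) : IsContraction Z := fun v => by
  have e : ((∑ i, ‖(Z *ᵥ v) i‖ ^ 2 : ℝ) : ℂ) = ((∑ j, ‖v j‖ ^ 2 : ℝ) : ℂ) := by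
    have h1 : ((∑ i, ‖(Z *ᵥ v) i‖ ^ 2 : ℝ) : ℂ) = star (Z *ᵥ v) ⬝ᵥ (Z *ᵥ v) := by
      simp [dotProduct, Complex.conj_mul']
    have h2 : ((∑ j, ‖v j‖ ^ 2 : ℝ) : ℂ) = star v ⬝ᵥ v := by
      simp [dotProduct, Complex.conj_mul']
    rw [h1, h2, Matrix.star_mulVec, ← Matrix.dotProduct_mulVec, Matrix.mulVec_mulVec, h,
      Matrix.one_mulVec]
  exact le_of_eq (by exact_mod_cast e)

theorem isContraction_one [DecidableEq n] : IsContraction (1 : Matrix n n ℂ) :=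
  isContraction_of_conjTranspose_mul_self_eq_one (by simp)

theorem isContraction_diagonal [DecidableEq n] {d : n → ℂ} (hd : ∀ i, ‖d i‖ ≤ 1) :
    IsContraction (Matrix.diagonal d) := fun v => by
  refine Finset.sum_le_sum fun i _ => ?_
  rw [Matrix.mulVec_diagonal, norm_mul]
  gcongr
  exact mul_le_of_le_one_left (norm_nonneg _) (hd i)

theorem isContraction_single [DecidableEq m] [DecidableEq n] (i : m) (j : n) :
    IsContraction (Matrix.single i j (1 : ℂ)) := fun v => by
  rw [Finset.sum_eq_single i]
  · rw [Matrix.single_mulVec]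
    simp only [Function.update_self, one_mul]
    exact Finset.single_le_sum (f := fun j => ‖v j‖ ^ 2) (fun _ _ => by positivity)
      (Finset.mem_univ j)
  · intro b _ hb
    rw [Matrix.single_mulVec]
    simp [hb]
  · simp

theorem IsContraction.submatrix {m' n' : Type*} [Fintype m'] [Fintype n'] {Z : Matrix m n ℂ}
    (hZ : IsContraction Z)
    {f : m' → m} {g : n' → n} (hf : Function.Injective f) (hg : Function.Injective g) :
    IsContraction (Z.submatrix f g) := fun v => by
  classical
  -- extend `v` by zero outside of the range of `g`
  set w : n → ℂ := Function.extend g v 0 with hw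
  have e1 : ∑ j, ‖w j‖ ^ 2 = ∑ j, ‖v j‖ ^ 2 := by
    symm
    refine Finset.sum_of_injOn g hg.injOn (by simp) ?_ ?_
    · intro j _ hj
      rw [hw, Function.extend_apply' _ _ _ (by simpa using hj)]
      simp
    · intro j _
      rw [hw, hg.extend_apply]
  have e2 : ∀ i, (Z.submatrix f g *ᵥ v) i = (Z *ᵥ w) (f i) := by
    intro i
    refine Finset.sum_of_injOn g hg.injOn (by simp) ?_ ?_
    · intro j _ hj
      rw [hw, Function.extend_apply' _ _ _ (by simpa using hj)]
      simp
    · intro j _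
      rw [hw, hg.extend_apply]
      rfl
  rw [← e1]
  refine le_trans ?_ (hZ w)
  simp only [e2]
  rw [← Finset.sum_image (f := fun i => ‖(Z *ᵥ w) i‖ ^ 2) (s := Finset.univ) (g := f) hf.injOn]
  exact Finset.sum_le_sum_of_subset_of_nonneg (Finset.subset_univ _) fun _ _ _ => by positivity

open scoped Kronecker in
theorem IsContraction.one_kronecker [DecidableEq k] {Z : Matrix m n ℂ} (hZ : IsContraction Z) :
    IsContraction ((1 : Matrix k k ℂ) ⊗ₖ Z) := fun v => by
  rw [Fintype.sum_prod_type, Fintype.sum_prod_type]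
  refine Finset.sum_le_sum fun a _ => ?_
  refine le_trans (le_of_eq ?_) (hZ fun j => v (a, j))
  refine Finset.sum_congr rfl fun i _ => ?_
  congr 2
  simp [Matrix.mulVec, dotProduct, Fintype.sum_prod_type, Matrix.one_apply]

open scoped Kronecker in
theorem IsContraction.kronecker_one [DecidableEq k] {Z : Matrix m n ℂ} (hZ : IsContraction Z) :
    IsContraction (Z ⊗ₖ (1 : Matrix k k ℂ)) := fun v => by
  rw [Fintype.sum_prod_type_right, Fintype.sum_prod_type_right]
  refine Finset.sum_le_sum fun a _ => ?_
  refine le_trans (le_of_eq ?_) (hZ fun j => v (j, a))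
  refine Finset.sum_congr rfl fun i _ => ?_
  congr 2
  simp [Matrix.mulVec, dotProduct, Fintype.sum_prod_type, Matrix.one_apply]

/-- For contractions `Z` and `W` the value of `tr (Z √ρ W √ρ)`, which for `Z = 1` is the expectation
of `W` in `ρ`, is a Lipschitz function of `√ρ`. -/
theorem norm_trace_sub_trace_le {A B : Matrix n n ℂ} (hA : hsNorm A = 1) (hB : hsNorm B = 1)
    {Z W : Matrix n n ℂ} (hZ : IsContraction Z) (hW : IsContraction W) :
    ‖(Z * A * (W * A)).trace - (Z * B * (W * B)).trace‖ ≤ 2 * hsNorm (A - B) := by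
  have e : (Z * A * (W * A)).trace - (Z * B * (W * B)).trace
      = (Z * (A - B) * (W * A)).trace + (Z * B * (W * (A - B))).trace := by
    rw [← Matrix.trace_sub, ← Matrix.trace_add]
    congr 1
    noncomm_ring
  rw [e]
  have h1 := norm_trace_mul_le (Z * (A - B)) (W * A)
  have h2 := norm_trace_mul_le (Z * B) (W * (A - B))
  have h3 := hZ.hsNorm_mul_le (A - B)
  have h4 := hW.hsNorm_mul_le (A - B)
  have h5 := hZ.hsNorm_mul_le B
  have h6 := hW.hsNorm_mul_le A
  rw [hB] at h5
  rw [hA] at h6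
  have := hsNorm_nonneg (Z * (A - B))
  have := hsNorm_nonneg (W * (A - B))
  have := hsNorm_nonneg (Z * B)
  have := hsNorm_nonneg (W * A)
  refine (norm_add_le _ _).trans ?_
  nlinarith

end HilbertSchmidt

section TraceNorm

variable {m : Type*} [Fintype m] [DecidableEq m]

theorem sum_eigenvalues_conjTranspose_mul_self (M : Matrix m m ℂ) :
    ∑ i, (Matrix.isHermitian_conjTranspose_mul_self M).eigenvalues i = hsNorm M ^ 2 := by
  have h := (Matrix.isHermitian_conjTranspose_mul_self M).trace_eq_sum_eigenvalues
  rw [trace_conjTranspose_mul_self_eq_hsNorm_sq] at h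
  have h' := congrArg Complex.re h
  rw [Complex.ofReal_re, Complex.re_sum] at h'
  exact h'.symm

theorem hsNorm_le_traceNorm (M : Matrix m m ℂ) : hsNorm M ≤ traceNorm M := by
  refine (sq_le_sq₀ (hsNorm_nonneg M) ?_).1 ?_
  · exact (Finset.sum_nonneg fun i _ => Real.sqrt_nonneg _)
  unfold traceNorm
  rw [← sum_eigenvalues_conjTranspose_mul_self]
  refine le_trans (le_of_eq (Finset.sum_congr rfl fun i _ => ?_))
    (Finset.sum_sq_le_sq_sum_of_nonneg fun i _ => Real.sqrt_nonneg _)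
  rw [Real.sq_sqrt (Matrix.eigenvalues_conjTranspose_mul_self_nonneg M i)]

theorem traceNorm_le (M : Matrix m m ℂ) :
    traceNorm M ≤ Real.sqrt (Fintype.card m) * hsNorm M := by
  rw [← Real.sqrt_sq (hsNorm_nonneg M), ← Real.sqrt_mul (by positivity)]
  refine Real.le_sqrt_of_sq_le ?_
  rw [← sum_eigenvalues_conjTranspose_mul_self]
  refine (sq_sum_le_card_mul_sum_sq).trans (le_of_eq ?_)
  rw [Finset.card_univ]
  congr 1
  refine Finset.sum_congr rfl fun i _ => ?_
  rw [Real.sq_sqrt (Matrix.eigenvalues_conjTranspose_mul_self_nonneg M i)]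

end TraceNorm

/-! ### Entropies -/

section Entropy

theorem vonNeumannEntropy_eq_sum_roots {m : Type*} [Fintype m] [DecidableEq m]
    (ρ : Matrix m m ℂ) (hρ : ρ.IsHermitian) :
    vonNeumannEntropy ρ hρ = (ρ.charpoly.roots.map fun z => Real.negMulLog z.re).sum := by
  rw [hρ.roots_charpoly_eq_eigenvalues, Multiset.map_map]
  simp [vonNeumannEntropy]

theorem vonNeumannEntropy_reindex {m n : Type*} [Fintype m] [DecidableEq m] [Fintype n]
    [DecidableEq n] (e : m ≃ n) {ρ : Matrix m m ℂ} {σ : Matrix n n ℂ} (hρ : ρ.IsHermitian)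
    (hσ : σ.IsHermitian) (h : σ = Matrix.reindex e e ρ) :
    vonNeumannEntropy σ hσ = vonNeumannEntropy ρ hρ := by
  rw [vonNeumannEntropy_eq_sum_roots, vonNeumannEntropy_eq_sum_roots, h, Matrix.charpoly_reindex]

/-- The two products of a pair of matrices have the same eigenvalues up to zeros, which do not
contribute to the entropy. -/
theorem vonNeumannEntropy_mul_comm {m n : Type*} [Fintype m] [DecidableEq m] [Fintype n]
    [DecidableEq n] (A : Matrix m n ℂ) (B : Matrix n m ℂ) (h : (A * B).IsHermitian)
    (h' : (B * A).IsHermitian) :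
    vonNeumannEntropy (A * B) h = vonNeumannEntropy (B * A) h' := by
  rw [vonNeumannEntropy_eq_sum_roots, vonNeumannEntropy_eq_sum_roots]
  have e := congrArg (fun p => (p.roots.map fun z : ℂ => Real.negMulLog z.re).sum)
    (Matrix.charpoly_mul_comm' A B)
  beta_reduce at e
  rw [Polynomial.roots_mul, Polynomial.roots_mul] at e
  · simpa [Multiset.map_nsmul, Multiset.sum_nsmul] using e
  · exact mul_ne_zero (pow_ne_zero _ Polynomial.X_ne_zero) (Matrix.charpoly_monic _).ne_zero
  · exact mul_ne_zero (pow_ne_zero _ Polynomial.X_ne_zero) (Matrix.charpoly_monic _).ne_zero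

theorem entanglementEntropy_eq {a b : Type*} [Fintype a] [DecidableEq a] [Fintype b]
    [DecidableEq b] (M : Matrix a b ℂ) :
    entanglementEntropy M
      = vonNeumannEntropy (Mᴴ * M) (Matrix.isHermitian_conjTranspose_mul_self M) :=
  vonNeumannEntropy_mul_comm _ _ _ _

theorem entanglementEntropy_congr_left {a b b' : Type*} [Fintype a] [DecidableEq a] [Fintype b]
    [Fintype b'] {M : Matrix a b ℂ} {N : Matrix a b' ℂ} (h : M * Mᴴ = N * Nᴴ) :
    entanglementEntropy M = entanglementEntropy N := by
  unfold entanglementEntropy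
  congr 1

theorem entanglementEntropy_congr_right {a a' b : Type*} [Fintype a] [DecidableEq a] [Fintype a']
    [DecidableEq a'] [Fintype b] {M : Matrix a b ℂ} {N : Matrix a' b ℂ}
    (h : Mᴴ * M = Nᴴ * N) : entanglementEntropy M = entanglementEntropy N := by
  classical
  rw [entanglementEntropy_eq, entanglementEntropy_eq]
  congr 1

theorem entanglementEntropy_reindex {a b a' b' : Type*} [Fintype a] [DecidableEq a] [Fintype b]
    [Fintype a'] [DecidableEq a'] [Fintype b'] (e : a ≃ a') (f : b ≃ b') (M : Matrix a b ℂ) :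
    entanglementEntropy (Matrix.reindex e f M) = entanglementEntropy M := by
  refine vonNeumannEntropy_reindex e _ _ ?_
  simp

end Entropy

/-! ### Square roots, polar decomposition and relative entropy -/

section Sqrt

open scoped ComplexOrder

variable {m n : Type*} [Fintype m] [Fintype n] [DecidableEq n]

/-- A function of a Hermitian matrix, by its action on the eigenvalues. -/
noncomputable def hermFun {ρ : Matrix n n ℂ} (hρ : ρ.IsHermitian) (f : ℝ → ℝ) : Matrix n n ℂ :=
  (hρ.eigenvectorUnitary : Matrix n n ℂ) *
    Matrix.diagonal (fun i => ((f (hρ.eigenvalues i) : ℝ) : ℂ)) *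
    (hρ.eigenvectorUnitary : Matrix n n ℂ)ᴴ

theorem eigenvectorUnitary_conjTranspose_mul {ρ : Matrix n n ℂ} (hρ : ρ.IsHermitian) :
    (hρ.eigenvectorUnitary : Matrix n n ℂ)ᴴ * (hρ.eigenvectorUnitary : Matrix n n ℂ) = 1 :=
  Unitary.coe_star_mul_self _

theorem eigenvectorUnitary_mul_conjTranspose {ρ : Matrix n n ℂ} (hρ : ρ.IsHermitian) :
    (hρ.eigenvectorUnitary : Matrix n n ℂ) * (hρ.eigenvectorUnitary : Matrix n n ℂ)ᴴ = 1 :=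
  Unitary.coe_mul_star_self _

theorem hermFun_id {ρ : Matrix n n ℂ} (hρ : ρ.IsHermitian) : hermFun hρ (fun x => x) = ρ := by
  conv_rhs => rw [hρ.spectral_theorem]
  rfl

theorem hermFun_mul {ρ : Matrix n n ℂ} (hρ : ρ.IsHermitian) (f g : ℝ → ℝ) :
    hermFun hρ f * hermFun hρ g = hermFun hρ (fun x => f x * g x) := by
  unfold hermFun
  set U : Matrix n n ℂ := (hρ.eigenvectorUnitary : Matrix n n ℂ) with hU
  have h : Uᴴ * U = 1 := eigenvectorUnitary_conjTranspose_mul hρ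
  rw [show ∀ A B : Matrix n n ℂ, U * A * Uᴴ * (U * B * Uᴴ) = U * A * (Uᴴ * U) * B * Uᴴ by
    intros; simp only [Matrix.mul_assoc], h, Matrix.mul_one, Matrix.mul_assoc U,
    Matrix.diagonal_mul_diagonal]
  simp

theorem hermFun_congr {ρ : Matrix n n ℂ} (hρ : ρ.IsHermitian) {f g : ℝ → ℝ}
    (h : ∀ i, f (hρ.eigenvalues i) = g (hρ.eigenvalues i)) : hermFun hρ f = hermFun hρ g := by
  unfold hermFun
  simp [h]

theorem hermFun_conjTranspose {ρ : Matrix n n ℂ} (hρ : ρ.IsHermitian) (f : ℝ → ℝ) :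
    (hermFun hρ f)ᴴ = hermFun hρ f := by
  unfold hermFun
  simp only [Matrix.conjTranspose_mul, Matrix.conjTranspose_conjTranspose,
    Matrix.diagonal_conjTranspose, Matrix.mul_assoc]
  congr 3
  ext i
  simp

theorem hermFun_isContraction {ρ : Matrix n n ℂ} (hρ : ρ.IsHermitian) {f : ℝ → ℝ}
    (hf : ∀ x, |f x| ≤ 1) : IsContraction (hermFun hρ f) := by
  have hU := isContraction_of_conjTranspose_mul_self_eq_one
    (eigenvectorUnitary_conjTranspose_mul hρ)
  refine (hU.mul (isContraction_diagonal fun i => ?_)).mul hU.conjTranspose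
  rw [Complex.norm_real]
  exact hf _

/-- The square root of a positive semidefinite matrix. -/
noncomputable def psdSqrt {ρ : Matrix n n ℂ} (hρ : ρ.PosSemidef) : Matrix n n ℂ :=
  hermFun hρ.isHermitian Real.sqrt

theorem psdSqrt_conjTranspose {ρ : Matrix n n ℂ} (hρ : ρ.PosSemidef) :
    (psdSqrt hρ)ᴴ = psdSqrt hρ := hermFun_conjTranspose _ _

theorem psdSqrt_mul_self {ρ : Matrix n n ℂ} (hρ : ρ.PosSemidef) :
    psdSqrt hρ * psdSqrt hρ = ρ := by
  unfold psdSqrt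
  rw [hermFun_mul, hermFun_congr (g := fun x => x), hermFun_id]
  exact fun i => Real.mul_self_sqrt (hρ.eigenvalues_nonneg i)

theorem hsNorm_psdSqrt {ρ : Matrix n n ℂ} (hρ : ρ.PosSemidef) (h : ρ.trace = 1) :
    hsNorm (psdSqrt hρ) = 1 := by
  have e := trace_conjTranspose_mul_self_eq_hsNorm_sq (psdSqrt hρ)
  rw [psdSqrt_conjTranspose, psdSqrt_mul_self, h] at e
  have e' : hsNorm (psdSqrt hρ) ^ 2 = 1 := by exact_mod_cast e.symm
  exact (pow_eq_one_iff_of_nonneg (hsNorm_nonneg _) two_ne_zero).1 e'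

/-- Polar decomposition: a matrix `N` is carried to `√(Nᴴ N)` by a partial isometry. -/
theorem exists_isContraction_conjTranspose_mul_eq_psdSqrt [DecidableEq m] (N : Matrix m n ℂ) :
    ∃ V : Matrix m n ℂ, IsContraction V ∧
      Vᴴ * N = psdSqrt (Matrix.posSemidef_conjTranspose_mul_self N) := by
  set hρ := Matrix.posSemidef_conjTranspose_mul_self N with hρ_def
  -- the pseudo-inverse of the square root: on the kernel, `(√0)⁻¹ = 0`
  set G := hermFun hρ.isHermitian (fun x => (Real.sqrt x)⁻¹) with hG
  have hGs : Gᴴ = G := hermFun_conjTranspose _ _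
  have hR : G * (Nᴴ * N) = psdSqrt hρ := by
    conv_lhs => rw [← hermFun_id hρ.isHermitian, hG]
    rw [hermFun_mul]
    refine hermFun_congr _ fun i => ?_
    set x := hρ.isHermitian.eigenvalues i
    have hx : 0 ≤ x := hρ.eigenvalues_nonneg i
    rcases hx.eq_or_lt with h | h
    · simp [← h]
    · have := Real.sqrt_pos.2 h
      field_simp
      rw [Real.sq_sqrt hx]
  refine ⟨N * G, ?_, ?_⟩
  · have e : (N * G)ᴴ * (N * G)
        = hermFun hρ.isHermitian (fun x => Real.sqrt x * (Real.sqrt x)⁻¹) := by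
      rw [Matrix.conjTranspose_mul, hGs, Matrix.mul_assoc, ← Matrix.mul_assoc Nᴴ,
        ← Matrix.mul_assoc G, hR, hG, psdSqrt, hermFun_mul]
    have hc : IsContraction ((N * G)ᴴ * (N * G)) := by
      rw [e]
      refine hermFun_isContraction _ fun x => ?_
      by_cases h : Real.sqrt x = 0
      · simp [h]
      · simp [mul_inv_cancel₀ h]
    open scoped Matrix.Norms.L2Operator in
    rw [isContraction_iff_l2_opNorm_le] at hc ⊢
    rw [Matrix.l2_opNorm_conjTranspose_mul_self] at hc
    nlinarith [norm_nonneg (N * G)]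
  · rw [Matrix.conjTranspose_mul, hGs, Matrix.mul_assoc, hR]

end Sqrt

section RelativeEntropy

open scoped ComplexOrder

open scoped Kronecker

theorem trace_diagonal_mul_conj {m n : Type*} [Fintype m] [DecidableEq m] [Fintype n]
    [DecidableEq n] (x : m → ℝ) (y : n → ℝ) (Z : Matrix m n ℂ) :
    (Matrix.diagonal (fun i => (x i : ℂ)) * Z * Matrix.diagonal (fun j => (y j : ℂ)) * Zᴴ).trace
      = ((∑ i, ∑ j, x i * y j * ‖Z i j‖ ^ 2 : ℝ) : ℂ) := by
  simp only [Matrix.trace, Matrix.diag, Matrix.mul_apply (N := Zᴴ), Matrix.mul_diagonal,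
    Matrix.diagonal_mul, Matrix.conjTranspose_apply]
  push_cast
  refine Finset.sum_congr rfl fun i _ => Finset.sum_congr rfl fun j _ => ?_
  rw [← Complex.mul_conj', Complex.star_def]
  ring

theorem sum_norm_sq_row_of_mul_conjTranspose_eq_one {m n : Type*} [Fintype n] [DecidableEq m]
    {Z : Matrix m n ℂ} (h : Z * Zᴴ = 1) (i : m) : ∑ j, ‖Z i j‖ ^ 2 = 1 := by
  have e := congrFun (congrFun h i) i
  rw [Matrix.one_apply_eq, Matrix.mul_apply] at e
  have e' : ((∑ j, ‖Z i j‖ ^ 2 : ℝ) : ℂ) = 1 := by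
    rw [← e]
    push_cast
    exact Finset.sum_congr rfl fun j _ => (Complex.mul_conj' _).symm
  exact_mod_cast e'

/-- The elementary inequality `log x ≤ x - 1` behind the comparison of the relative entropy with
the overlap of square roots. -/
theorem mul_log_ge {p s o q : ℝ} (hp : 0 ≤ p) (hs : 0 ≤ s) (ho : 0 ≤ o) (hq : 0 < q)
    (h : p * o ≠ 0 → s ≠ 0) :
    2 * (p * o) - 2 * (Real.sqrt q)⁻¹ * (Real.sqrt p * Real.sqrt s * o)
      ≤ p * o * (Real.log p - Real.log s + Real.log q) := by
  by_cases hpo : p * o = 0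
  · rcases mul_eq_zero.1 hpo with h0 | h0
    · simp [h0]
    · simp [h0]
  · have hs' : 0 < s := lt_of_le_of_ne hs (Ne.symm (h hpo))
    have hp' : 0 < p := lt_of_le_of_ne hp fun e => hpo (by simp [← e])
    have h1 := Real.log_le_sub_one_of_pos
      (show 0 < Real.sqrt s / (Real.sqrt q * Real.sqrt p) by positivity)
    rw [Real.log_div (by positivity) (by positivity), Real.log_mul (by positivity) (by positivity),
      Real.log_sqrt hs, Real.log_sqrt hp, Real.log_sqrt hq.le] at h1
    have h2 : p * (Real.sqrt s / (Real.sqrt q * Real.sqrt p))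
        = (Real.sqrt q)⁻¹ * (Real.sqrt p * Real.sqrt s) := by
      have : 0 < Real.sqrt p := Real.sqrt_pos.2 hp'
      have : 0 < Real.sqrt q := Real.sqrt_pos.2 hq
      field_simp
      rw [Real.sq_sqrt hp]
    have h3 := mul_le_mul_of_nonneg_left h1 (show 0 ≤ 2 * (p * o) by positivity)
    have h4 : 2 * (p * o) * (Real.sqrt s / (Real.sqrt q * Real.sqrt p) - 1)
        = 2 * (Real.sqrt q)⁻¹ * (Real.sqrt p * Real.sqrt s * o) - 2 * (p * o) := by
      linear_combination 2 * o * h2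
    rw [h4] at h3
    linarith

/-- The deficit `S(ρ_A) + ln q - S(ρ)` of a state `ρ` of a system `A` and a `q`-level system is the
relative entropy of `ρ` and `ρ_A ⊗ 1/q`, which bounds the distance of their square roots. -/
theorem hsNorm_psdSqrt_sub_sq_le {α : Type*} [Fintype α] [DecidableEq α] {q : ℕ} (hq : 0 < q)
    {ρ : Matrix (α × Fin q) (α × Fin q) ℂ} (hρ : ρ.PosSemidef) (htr : ρ.trace = 1)
    {σ : Matrix α α ℂ} (hσ : σ.PosSemidef) (hpt : ∀ a a', σ a a' = ∑ b, ρ (a, b) (a', b)) :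
    hsNorm (psdSqrt hρ - ((Real.sqrt q)⁻¹ : ℂ) • (psdSqrt hσ ⊗ₖ (1 : Matrix (Fin q) (Fin q) ℂ))) ^ 2
      ≤ vonNeumannEntropy σ hσ.isHermitian + Real.log q
        - vonNeumannEntropy ρ hρ.isHermitian := by
  set p := hρ.isHermitian.eigenvalues with hp_def
  set s := hσ.isHermitian.eigenvalues with hs_def
  have hp : ∀ i, 0 ≤ p i := hρ.eigenvalues_nonneg
  have hs : ∀ i, 0 ≤ s i := hσ.eigenvalues_nonneg
  set U : Matrix (α × Fin q) (α × Fin q) ℂ := (hρ.isHermitian.eigenvectorUnitary).1 with hU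
  set W : Matrix α α ℂ := (hσ.isHermitian.eigenvectorUnitary).1 with hW
  have hU1 : Uᴴ * U = 1 := eigenvectorUnitary_conjTranspose_mul _
  have hU2 : U * Uᴴ = 1 := eigenvectorUnitary_mul_conjTranspose _
  have hW1 : Wᴴ * W = 1 := eigenvectorUnitary_conjTranspose_mul _
  have hW2 : W * Wᴴ = 1 := eigenvectorUnitary_mul_conjTranspose _
  set WW : Matrix (α × Fin q) (α × Fin q) ℂ := W ⊗ₖ (1 : Matrix (Fin q) (Fin q) ℂ) with hWW
  have hWW2 : WW * WWᴴ = 1 := by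
    rw [hWW, Matrix.conjTranspose_kronecker, ← Matrix.mul_kronecker_mul, hW2]
    simp
  set Z := Uᴴ * WW with hZ
  have hZ2 : Z * Zᴴ = 1 := by
    rw [hZ, Matrix.conjTranspose_mul, Matrix.conjTranspose_conjTranspose, Matrix.mul_assoc,
      ← Matrix.mul_assoc WW, hWW2, Matrix.one_mul, hU1]
  have hrow := sum_norm_sq_row_of_mul_conjTranspose_eq_one hZ2
  have hρU : ρ = U * Matrix.diagonal (fun i => (p i : ℂ)) * Uᴴ :=
    (hermFun_id hρ.isHermitian).symm
  have hσW : σ = W * Matrix.diagonal (fun i => (s i : ℂ)) * Wᴴ :=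
    (hermFun_id hσ.isHermitian).symm
  -- the weights `p i * ‖Z i (a, b)‖ ^ 2` are a joint distribution with marginals `p` and `s`
  have hcol : ∀ a, ∑ b, ∑ i, p i * ‖Z i (a, b)‖ ^ 2 = s a := by
    intro a
    have e1 : WWᴴ * ρ * WW = Zᴴ * Matrix.diagonal (fun i => (p i : ℂ)) * Z := by
      rw [hρU, hZ, Matrix.conjTranspose_mul, Matrix.conjTranspose_conjTranspose]
      simp only [Matrix.mul_assoc]
    have e2 : Wᴴ * σ * W = Matrix.diagonal (fun i => (s i : ℂ)) := by
      rw [hσW, show Wᴴ * (W * Matrix.diagonal (fun i => (s i : ℂ)) * Wᴴ) * W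
        = (Wᴴ * W) * Matrix.diagonal (fun i => (s i : ℂ)) * (Wᴴ * W) by
          simp only [Matrix.mul_assoc], hW1]
      simp
    have e3 : ∑ b, (WWᴴ * ρ * WW) (a, b) (a, b) = (Wᴴ * σ * W) a a := by
      rw [hWW, Matrix.conjTranspose_kronecker]
      simp only [Matrix.mul_apply, Fintype.sum_prod_type, Matrix.kroneckerMap_apply,
        Matrix.conjTranspose_one, Matrix.one_apply, mul_ite, mul_one, mul_zero, ite_mul, zero_mul,
        Finset.sum_ite_eq, Finset.sum_ite_eq', Finset.mem_univ, if_true, hpt, Finset.mul_sum]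
      rw [Finset.sum_comm]
      refine Finset.sum_congr rfl fun x _ => ?_
      simp only [Finset.sum_mul]
      rw [Finset.sum_comm]
    have e4 : ((∑ b, ∑ i, p i * ‖Z i (a, b)‖ ^ 2 : ℝ) : ℂ) = s a := by
      have : ((s a : ℝ) : ℂ) = (Wᴴ * σ * W) a a := by rw [e2]; simp
      rw [this, ← e3, e1]
      push_cast
      refine Finset.sum_congr rfl fun b _ => ?_
      rw [Matrix.mul_apply]
      refine Finset.sum_congr rfl fun i _ => ?_
      rw [Matrix.mul_diagonal, Matrix.conjTranspose_apply, ← Complex.mul_conj', Complex.star_def]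
      ring
    exact_mod_cast e4
  have hsupp : ∀ i a b, p i * ‖Z i (a, b)‖ ^ 2 ≠ 0 → s a ≠ 0 := by
    intro i a b h0 hsa
    have := hcol a
    rw [hsa, Finset.sum_eq_zero_iff_of_nonneg
      (fun b _ => Finset.sum_nonneg fun i _ => mul_nonneg (hp i) (by positivity))] at this
    have := this b (Finset.mem_univ b)
    rw [Finset.sum_eq_zero_iff_of_nonneg
      (fun i _ => mul_nonneg (hp i) (by positivity))] at this
    exact h0 (this i (Finset.mem_univ i))
  have hpsum : ∑ i, p i = 1 := by
    have h := hρ.isHermitian.trace_eq_sum_eigenvalues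
    rw [htr] at h
    have h' := congrArg Complex.re h
    rw [Complex.re_sum] at h'
    simpa using h'.symm
  have hσtr : σ.trace = 1 := by
    rw [← htr]
    simp [Matrix.trace, hpt, Fintype.sum_prod_type]
  -- the left hand side
  have hT : ((Real.sqrt q)⁻¹ : ℂ) * ((Real.sqrt q)⁻¹ : ℂ) * q = 1 := by
    have : Real.sqrt q * Real.sqrt q = q := Real.mul_self_sqrt (by positivity)
    have h2 : (Real.sqrt q : ℂ) * Real.sqrt q = q := by exact_mod_cast this
    have h3 : (Real.sqrt q : ℂ) ≠ 0 := by
      exact_mod_cast (Real.sqrt_pos.2 (by exact_mod_cast hq)).ne'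
    rw [← h2]
    field_simp
  have hcross : (psdSqrt hρ * (psdSqrt hσ ⊗ₖ (1 : Matrix (Fin q) (Fin q) ℂ))).trace
      = ((∑ i, ∑ j : α × Fin q, Real.sqrt (p i) * Real.sqrt (s j.1) * ‖Z i j‖ ^ 2 : ℝ) : ℂ) := by
    rw [← trace_diagonal_mul_conj (fun i => Real.sqrt (p i))
      (fun j : α × Fin q => Real.sqrt (s j.1)) Z]
    have e1 : psdSqrt hσ ⊗ₖ (1 : Matrix (Fin q) (Fin q) ℂ)
        = WW * Matrix.diagonal (fun j : α × Fin q => ((Real.sqrt (s j.1) : ℝ) : ℂ)) * WWᴴ := by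
      have : Matrix.diagonal (fun j : α × Fin q => ((Real.sqrt (s j.1) : ℝ) : ℂ))
          = Matrix.diagonal (fun a => ((Real.sqrt (s a) : ℝ) : ℂ))
            ⊗ₖ (1 : Matrix (Fin q) (Fin q) ℂ) := by
        rw [← Matrix.diagonal_one, Matrix.diagonal_kronecker_diagonal]
        simp
      rw [this, hWW, Matrix.conjTranspose_kronecker, ← Matrix.mul_kronecker_mul,
        ← Matrix.mul_kronecker_mul]
      simp [psdSqrt, hermFun, hW, hs_def]
    have e2 : psdSqrt hρ = U * Matrix.diagonal (fun i => ((Real.sqrt (p i) : ℝ) : ℂ)) * Uᴴ := rfl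
    rw [e1, e2, hZ, Matrix.conjTranspose_mul, Matrix.conjTranspose_conjTranspose,
      Matrix.mul_assoc, Matrix.mul_assoc U, Matrix.trace_mul_comm U]
    simp only [Matrix.mul_assoc]
  have hdist : hsNorm (psdSqrt hρ - ((Real.sqrt q)⁻¹ : ℂ) •
      (psdSqrt hσ ⊗ₖ (1 : Matrix (Fin q) (Fin q) ℂ))) ^ 2
      = 2 - 2 * (Real.sqrt q)⁻¹ *
        ∑ i, ∑ j : α × Fin q, Real.sqrt (p i) * Real.sqrt (s j.1) * ‖Z i j‖ ^ 2 := by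
    have hc := trace_conjTranspose_mul_self_eq_hsNorm_sq (psdSqrt hρ - ((Real.sqrt q)⁻¹ : ℂ) •
      (psdSqrt hσ ⊗ₖ (1 : Matrix (Fin q) (Fin q) ℂ)))
    have hc2 : star ((Real.sqrt q : ℂ)⁻¹) = (Real.sqrt q : ℂ)⁻¹ := by
      rw [star_inv₀]; simp
    rw [Matrix.conjTranspose_sub, Matrix.conjTranspose_smul, Matrix.conjTranspose_kronecker,
      psdSqrt_conjTranspose, psdSqrt_conjTranspose, Matrix.conjTranspose_one, hc2, Matrix.sub_mul,
      Matrix.mul_sub, Matrix.mul_sub, psdSqrt_mul_self, Matrix.trace_sub, Matrix.trace_sub,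
      Matrix.trace_sub, Matrix.smul_mul, Matrix.smul_mul, Matrix.mul_smul, Matrix.mul_smul,
      Matrix.trace_smul, Matrix.trace_smul, Matrix.trace_smul, Matrix.trace_smul,
      Matrix.trace_mul_comm _ (psdSqrt hρ), hcross, ← Matrix.mul_kronecker_mul, psdSqrt_mul_self,
      Matrix.trace_kronecker, htr, hσtr] at hc
    simp only [smul_eq_mul, Matrix.trace_one, Fintype.card_fin, one_mul] at hc
    have hc' : (((hsNorm (psdSqrt hρ - ((Real.sqrt q)⁻¹ : ℂ) •
      (psdSqrt hσ ⊗ₖ (1 : Matrix (Fin q) (Fin q) ℂ))) ^ 2 : ℝ)) : ℂ)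
      = ((2 - 2 * (Real.sqrt q)⁻¹ *
        ∑ i, ∑ j : α × Fin q, Real.sqrt (p i) * Real.sqrt (s j.1) * ‖Z i j‖ ^ 2 : ℝ) : ℂ) := by
      rw [← hc]
      push_cast
      linear_combination hT
    exact_mod_cast hc'
  rw [hdist]
  -- the right hand side
  have hSσ : vonNeumannEntropy σ hσ.isHermitian
      = - ∑ i, ∑ j : α × Fin q, p i * ‖Z i j‖ ^ 2 * Real.log (s j.1) := by
    unfold vonNeumannEntropy Real.negMulLog
    rw [Finset.sum_comm, Fintype.sum_prod_type, ← Finset.sum_neg_distrib]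
    refine Finset.sum_congr rfl fun a _ => ?_
    simp only [← Finset.sum_mul]
    rw [hcol a]
    ring
  have hSρ : vonNeumannEntropy ρ hρ.isHermitian = - ∑ i, p i * Real.log (p i) := by
    unfold vonNeumannEntropy Real.negMulLog
    rw [← Finset.sum_neg_distrib]
    exact Finset.sum_congr rfl fun i _ => neg_mul _ _
  have hsum : ∑ i, ∑ j : α × Fin q, (2 * (p i * ‖Z i j‖ ^ 2) - 2 * (Real.sqrt q)⁻¹ *
        (Real.sqrt (p i) * Real.sqrt (s j.1) * ‖Z i j‖ ^ 2))
      ≤ ∑ i, ∑ j : α × Fin q, p i * ‖Z i j‖ ^ 2 *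
        (Real.log (p i) - Real.log (s j.1) + Real.log q) := by
    gcongr with i _ j _
    exact mul_log_ge (hp i) (hs j.1) (by positivity) (by exact_mod_cast hq) (hsupp i j.1 j.2)
  simp only [Finset.sum_sub_distrib, ← Finset.mul_sum, mul_add, mul_sub,
    Finset.sum_add_distrib, ← Finset.sum_mul, hrow, hpsum, mul_one, one_mul] at hsum
  rw [hSσ, hSρ]
  linarith

end RelativeEntropy

/-! ### Entropy gain of a gate across a cut -/

section Gain

open scoped ComplexOrder Kronecker

theorem norm_inv_sqrt_mul_self {q : ℕ} (hq : 0 < q) :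
    ((Real.sqrt q : ℂ)⁻¹) * ((Real.sqrt q : ℂ)⁻¹) = (q : ℂ)⁻¹ := by
  have : Real.sqrt q * Real.sqrt q = q := Real.mul_self_sqrt (by positivity)
  have h2 : (Real.sqrt q : ℂ) * Real.sqrt q = q := by exact_mod_cast this
  rw [← mul_inv, h2]

theorem hsNorm_smul_psdSqrt_kronecker_one {α : Type*} [Fintype α] [DecidableEq α] {q : ℕ}
    (hq : 0 < q) {σ : Matrix α α ℂ} (hσ : σ.PosSemidef) (h : σ.trace = 1) :
    hsNorm (((Real.sqrt q : ℂ)⁻¹) • (psdSqrt hσ ⊗ₖ (1 : Matrix (Fin q) (Fin q) ℂ))) = 1 := by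
  have hc2 : star ((Real.sqrt q : ℂ)⁻¹) = (Real.sqrt q : ℂ)⁻¹ := by
    rw [star_inv₀]; simp
  have e := trace_conjTranspose_mul_self_eq_hsNorm_sq
    (((Real.sqrt q : ℂ)⁻¹) • (psdSqrt hσ ⊗ₖ (1 : Matrix (Fin q) (Fin q) ℂ)))
  rw [Matrix.conjTranspose_smul, Matrix.conjTranspose_kronecker, psdSqrt_conjTranspose, hc2,
    Matrix.conjTranspose_one, Matrix.smul_mul, Matrix.mul_smul, smul_smul,
    norm_inv_sqrt_mul_self hq, ← Matrix.mul_kronecker_mul, psdSqrt_mul_self, Matrix.trace_smul,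
    Matrix.trace_kronecker, h, Matrix.one_mul, Matrix.trace_one, Fintype.card_fin, one_mul,
    smul_eq_mul, inv_mul_cancel₀ (by exact_mod_cast hq.ne')] at e
  have e' : hsNorm (((Real.sqrt q : ℂ)⁻¹) •
      (psdSqrt hσ ⊗ₖ (1 : Matrix (Fin q) (Fin q) ℂ))) ^ 2 = 1 := by exact_mod_cast e.symm
  exact (pow_eq_one_iff_of_nonneg (hsNorm_nonneg _) two_ne_zero).1 e'

theorem norm_trace_kronecker_mul_sub_le {α : Type*} [Fintype α] [DecidableEq α] {q : ℕ}
    (hq : 0 < q) {ρ : Matrix (α × Fin q) (α × Fin q) ℂ} (hρ : ρ.PosSemidef) (htr : ρ.trace = 1)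
    {σ : Matrix α α ℂ} (hσ : σ.PosSemidef) (htr' : σ.trace = 1) {X : Matrix α α ℂ}
    {Y : Matrix (Fin q) (Fin q) ℂ} (hX : IsContraction X) (hY : IsContraction Y) :
    ‖((X ⊗ₖ Y) * ρ).trace - (q : ℂ)⁻¹ * ((X * σ).trace * Y.trace)‖
      ≤ 2 * hsNorm (psdSqrt hρ -
        ((Real.sqrt q : ℂ)⁻¹) • (psdSqrt hσ ⊗ₖ (1 : Matrix (Fin q) (Fin q) ℂ))) := by
  have hXY : IsContraction (X ⊗ₖ Y) := by
    have := (hX.kronecker_one (k := Fin q)).mul (hY.one_kronecker (k := α))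
    rwa [← Matrix.mul_kronecker_mul, Matrix.mul_one, Matrix.one_mul] at this
  refine le_trans (le_of_eq ?_) (norm_trace_sub_trace_le (hsNorm_psdSqrt hρ htr)
    (hsNorm_smul_psdSqrt_kronecker_one hq hσ htr') hXY isContraction_one)
  congr 2
  · rw [Matrix.one_mul, Matrix.mul_assoc, psdSqrt_mul_self]
  · rw [Matrix.one_mul, Matrix.mul_smul, Matrix.mul_smul, Matrix.smul_mul, smul_smul,
      norm_inv_sqrt_mul_self hq, Matrix.mul_assoc, ← Matrix.mul_kronecker_mul, psdSqrt_mul_self,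
      ← Matrix.mul_kronecker_mul, Matrix.trace_smul, Matrix.trace_kronecker, Matrix.mul_one,
      Matrix.mul_one, smul_eq_mul]

/-- The amplitudes after application of the gate `u` to the pair of sites next to the cut. -/
def gateAcross {α β : Type*} {q : ℕ} (u : Gate q) (M : Matrix (α × Fin q) (β × Fin q) ℂ) :
    Matrix (α × Fin q) (β × Fin q) ℂ :=
  Matrix.of fun x y => ∑ k : Fin q, ∑ l : Fin q, u (x.2, y.2) (k, l) * M (x.1, k) (y.1, l)

theorem mulVec_dotProduct_star_mulVec {n : Type*} [Fintype n] [DecidableEq n] {u : Matrix n n ℂ}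
    (hu : u ∈ Matrix.unitaryGroup n ℂ) (v w : n → ℂ) :
    (u *ᵥ v) ⬝ᵥ star (u *ᵥ w) = v ⬝ᵥ star w := by
  have h : uᴴ * u = 1 := Matrix.mem_unitaryGroup_iff'.1 hu
  rw [dotProduct_comm, Matrix.star_mulVec, ← Matrix.dotProduct_mulVec, Matrix.mulVec_mulVec, h,
    Matrix.one_mulVec, dotProduct_comm]

theorem gateAcross_apply {α β : Type*} {q : ℕ} (u : Gate q)
    (M : Matrix (α × Fin q) (β × Fin q) ℂ) (a : α) (b : β) (p : Fin q × Fin q) :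
    gateAcross u M (a, p.1) (b, p.2) = (u *ᵥ fun r => M (a, r.1) (b, r.2)) p := by
  simp [gateAcross, Matrix.mulVec, dotProduct, Fintype.sum_prod_type]

theorem sum_gateAcross_mul_star {α β : Type*} {q : ℕ} {u : Gate q} (hu : IsUnitaryGate u)
    (M : Matrix (α × Fin q) (β × Fin q) ℂ) (a a' : α) (b b' : β) :
    ∑ i, ∑ j, gateAcross u M (a, i) (b, j) * star (gateAcross u M (a', i) (b', j))
      = ∑ i, ∑ j, M (a, i) (b, j) * star (M (a', i) (b', j)) := by
  have h := mulVec_dotProduct_star_mulVec hu (fun r => M (a, r.1) (b, r.2))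
    (fun r => M (a', r.1) (b', r.2))
  simp only [dotProduct, ← gateAcross_apply, Pi.star_apply, Fintype.sum_prod_type] at h
  exact h

variable {α β : Type*} [Fintype α] [Fintype β] {q : ℕ}

theorem sum_norm_sq_gateAcross {u : Gate q} (hu : IsUnitaryGate u)
    (M : Matrix (α × Fin q) (β × Fin q) ℂ) :
    ∑ x, ∑ y, ‖gateAcross u M x y‖ ^ 2 = ∑ x, ∑ y, ‖M x y‖ ^ 2 := by
  have e : ∀ K : Matrix (α × Fin q) (β × Fin q) ℂ, ((∑ x, ∑ y, ‖K x y‖ ^ 2 : ℝ) : ℂ)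
      = ∑ a, ∑ b, ∑ i, ∑ j, K (a, i) (b, j) * star (K (a, i) (b, j)) := by
    intro K
    push_cast
    rw [Fintype.sum_prod_type]
    refine Finset.sum_congr rfl fun a _ => ?_
    simp only [Fintype.sum_prod_type]
    rw [Finset.sum_comm]
    refine Finset.sum_congr rfl fun b _ => Finset.sum_congr rfl fun i _ =>
      Finset.sum_congr rfl fun j _ => (Complex.mul_conj' _).symm
  have h := e (gateAcross u M)
  simp only [sum_gateAcross_mul_star hu] at h
  rw [← e M] at h
  exact_mod_cast h

theorem trace_self_mul_conjTranspose_eq_one {m n : Type*} [Fintype m] [Fintype n]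
    {M : Matrix m n ℂ} (hM : ∑ x, ∑ y, ‖M x y‖ ^ 2 = 1) : (M * Mᴴ).trace = 1 := by
  rw [Matrix.trace_mul_comm, trace_conjTranspose_mul_self_eq_hsNorm_sq, hsNorm_sq, hM]
  simp

/-- The Heisenberg picture of `Y` acting on the left output leg of the gate, on conjugated
amplitudes. -/
def pullback (u : Gate q) (Y : Matrix (Fin q) (Fin q) ℂ) : Gate q :=
  uᵀ * (Yᵀ ⊗ₖ (1 : Matrix (Fin q) (Fin q) ℂ)) * u.map star

theorem pullback_isContraction {u : Gate q} (hu : IsUnitaryGate u)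
    {Y : Matrix (Fin q) (Fin q) ℂ} (hY : IsContraction Y) : IsContraction (pullback u Y) := by
  have h : IsContraction u := isContraction_of_conjTranspose_mul_self_eq_one
    (Matrix.mem_unitaryGroup_iff'.1 hu)
  exact (h.transpose.mul hY.transpose.kronecker_one).mul h.map_star

/-- The expectation of `X` on the sites beyond the pair and `Y` on the left output leg, after the
gate, in terms of the pullback of `Y` acting before the gate.  The matrix `N` holds the same
amplitudes as `M`, cut one site further to the left. -/
theorem trace_kronecker_mul_gateAcross [DecidableEq β] (u : Gate q)
    (M : Matrix (α × Fin q) (β × Fin q) ℂ) (X : Matrix α α ℂ) (Y : Matrix (Fin q) (Fin q) ℂ)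
    (N : Matrix α ((β × Fin q) × Fin q) ℂ) (hN : N = Matrix.of fun a y => M (a, y.2) y.1) :
    ((X ⊗ₖ Y) * (gateAcross u M * (gateAcross u M)ᴴ)).trace
      = (X * (N * ((1 : Matrix β β ℂ) ⊗ₖ pullback u Y).submatrix
          (fun y : (β × Fin q) × Fin q => (y.1.1, (y.2, y.1.2)))
          (fun y : (β × Fin q) × Fin q => (y.1.1, (y.2, y.1.2))) * Nᴴ)).trace := by
  have key : ∀ v w : Fin q × Fin q → ℂ,
      ∑ i, ∑ i', Y i i' * ∑ j, (u *ᵥ v) (i', j) * star ((u *ᵥ w) (i, j))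
        = v ⬝ᵥ (pullback u Y *ᵥ star w) := by
    intro v w
    have e : u.map star *ᵥ star w = star (u *ᵥ w) := by
      ext i; simp [Matrix.mulVec, dotProduct]
    rw [pullback, ← Matrix.mulVec_mulVec, ← Matrix.mulVec_mulVec, e, Matrix.dotProduct_mulVec,
      Matrix.vecMul_transpose]
    simp only [dotProduct, Matrix.mulVec, Fintype.sum_prod_type, Matrix.kroneckerMap_apply,
      Matrix.transpose_apply, Matrix.one_apply, mul_ite, mul_one, mul_zero, ite_mul, zero_mul,
      Finset.sum_ite_eq, Finset.mem_univ, if_true, Pi.star_apply, Finset.mul_sum]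
    rw [Finset.sum_comm]
    refine Finset.sum_congr rfl fun i' _ => ?_
    rw [Finset.sum_comm]
    refine Finset.sum_congr rfl fun j _ => Finset.sum_congr rfl fun i _ => ?_
    ring_nf
  have h1 : ((X ⊗ₖ Y) * (gateAcross u M * (gateAcross u M)ᴴ)).trace
      = ∑ a, ∑ a', X a a' * ∑ b, ∑ i, ∑ i', Y i i' * ∑ j,
        (u *ᵥ fun r => M (a', r.1) (b, r.2)) (i', j)
          * star ((u *ᵥ fun r => M (a, r.1) (b, r.2)) (i, j)) := by
    simp only [← gateAcross_apply]
    simp only [Matrix.trace, Matrix.diag, Matrix.mul_apply, Fintype.sum_prod_type,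
      Matrix.kroneckerMap_apply, Matrix.conjTranspose_apply, Finset.mul_sum]
    refine Finset.sum_congr rfl fun a _ => ?_
    rw [Finset.sum_comm]
    refine Finset.sum_congr rfl fun a' _ => ?_
    refine Eq.trans ?_ Finset.sum_comm
    refine Finset.sum_congr rfl fun i _ => ?_
    refine Eq.trans ?_ Finset.sum_comm
    refine Finset.sum_congr rfl fun i' _ => Finset.sum_congr rfl fun b _ =>
      Finset.sum_congr rfl fun j _ => ?_
    ring
  have h2 : ∀ T : Gate q, (X * (N * ((1 : Matrix β β ℂ) ⊗ₖ T).submatrix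
          (fun y : (β × Fin q) × Fin q => (y.1.1, (y.2, y.1.2)))
          (fun y : (β × Fin q) × Fin q => (y.1.1, (y.2, y.1.2))) * Nᴴ)).trace
      = ∑ a, ∑ a', X a a' * ∑ b, (fun r : Fin q × Fin q => M (a', r.1) (b, r.2)) ⬝ᵥ
          (T *ᵥ star fun r : Fin q × Fin q => M (a, r.1) (b, r.2)) := by
    intro T
    subst hN
    simp only [Matrix.dotProduct_mulVec]
    simp only [Matrix.trace, Matrix.diag, Matrix.mul_apply, Fintype.sum_prod_type,
      Matrix.kroneckerMap_apply, Matrix.conjTranspose_apply, Matrix.submatrix_apply,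
      Matrix.one_apply, ite_mul, mul_ite, one_mul, zero_mul, mul_zero, Matrix.of_apply,
      dotProduct, Matrix.vecMul, Pi.star_apply]
    refine Finset.sum_congr rfl fun a _ => Finset.sum_congr rfl fun a' _ => ?_
    congr 1
    refine Finset.sum_congr rfl fun b _ => ?_
    simp only [Finset.sum_comm (γ := β), Finset.sum_ite_eq', Finset.mem_univ, if_true]
    rw [Finset.sum_comm]
    refine Finset.sum_congr rfl fun k _ => Finset.sum_congr rfl fun l _ => ?_
    rw [Finset.sum_comm]
  rw [h1, h2]
  simp only [key]

/-- A matrix unit on the left input leg of `T` selects a block of `T`, which acts on the right input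
leg alone.  The matrix `L` holds the same amplitudes as `M`, cut one site further to the right. -/
theorem trace_conjTranspose_mul_kronecker_single [DecidableEq β] [DecidableEq α]
    (M : Matrix (α × Fin q) (β × Fin q) ℂ) (T : Gate q) (k₀ k₁ : Fin q)
    (L : Matrix ((α × Fin q) × Fin q) β ℂ) (hL : ∀ x b, L x b = M x.1 (b, x.2)) :
    (((Mᴴ * M) ⊗ₖ Matrix.single k₁ k₀ (1 : ℂ)) * ((1 : Matrix β β ℂ) ⊗ₖ T).submatrix
          (fun y : (β × Fin q) × Fin q => (y.1.1, (y.2, y.1.2)))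
          (fun y : (β × Fin q) × Fin q => (y.1.1, (y.2, y.1.2)))).trace
      = (((1 : Matrix (α × Fin q) (α × Fin q) ℂ) ⊗ₖ
          (T.submatrix (fun l => (k₀, l)) (fun l => (k₁, l)))ᵀ) * (L * Lᴴ)).trace := by
  have h1 : ∀ l l', ∑ x : α × Fin q, (∑ b, M x (b, l) * star (M x (b, l')))
      = ∑ b, (Mᴴ * M) (b, l') (b, l) := by
    intro l l'
    rw [Finset.sum_comm]
    refine Finset.sum_congr rfl fun b _ => ?_
    rw [Matrix.mul_apply]
    refine Finset.sum_congr rfl fun x _ => ?_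
    rw [Matrix.conjTranspose_apply, mul_comm]
  have h2 : (((Mᴴ * M) ⊗ₖ Matrix.single k₁ k₀ (1 : ℂ)) * ((1 : Matrix β β ℂ) ⊗ₖ T).submatrix
          (fun y : (β × Fin q) × Fin q => (y.1.1, (y.2, y.1.2)))
          (fun y : (β × Fin q) × Fin q => (y.1.1, (y.2, y.1.2)))).trace
      = ∑ l, ∑ l', (∑ b, (Mᴴ * M) (b, l) (b, l')) * T (k₀, l') (k₁, l) := by
    simp only [Matrix.trace, Matrix.diag, Matrix.mul_apply (M := _ ⊗ₖ _), Fintype.sum_prod_type,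
      Matrix.kroneckerMap_apply, Matrix.submatrix_apply, Matrix.single_apply, Matrix.one_apply,
      ite_and, mul_ite, ite_mul, mul_one, mul_zero, zero_mul, one_mul, Finset.sum_ite_irrel,
      Finset.sum_const_zero, Finset.sum_ite_eq, Finset.sum_ite_eq', Finset.mem_univ, if_true]
    rw [Finset.sum_comm]
    refine Finset.sum_congr rfl fun l _ => ?_
    rw [Finset.sum_comm]
    simp only [Finset.sum_mul]
  have h3 : (((1 : Matrix (α × Fin q) (α × Fin q) ℂ) ⊗ₖ
          (T.submatrix (fun l => (k₀, l)) (fun l => (k₁, l)))ᵀ) * (L * Lᴴ)).trace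
      = ∑ l, ∑ l', (∑ x : α × Fin q, (∑ b, M x (b, l') * star (M x (b, l)))) * T (k₀, l') (k₁, l) := by
    simp only [Matrix.trace, Matrix.diag, Matrix.mul_apply, Fintype.sum_prod_type (α₁ := α × Fin q),
      Matrix.kroneckerMap_apply, Matrix.submatrix_apply, Matrix.transpose_apply, Matrix.one_apply,
      ite_mul, one_mul, zero_mul, Finset.sum_ite_irrel, Matrix.conjTranspose_apply, hL,
      Finset.sum_const_zero, Finset.sum_ite_eq, Finset.mem_univ, if_true]
    rw [Finset.sum_comm]
    refine Finset.sum_congr rfl fun l _ => ?_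
    rw [Finset.sum_comm]
    refine Finset.sum_congr rfl fun l' _ => ?_
    rw [← Finset.mul_sum, mul_comm]
  rw [h2, h3]
  simp only [h1]

/-- The partial trace of a pullback over the right input leg is a linear function of `D(u)`. -/
theorem sum_pullback (u : Gate q) (Y : Matrix (Fin q) (Fin q) ℂ) (k₀ k₁ : Fin q) :
    ∑ l, pullback u Y (k₀, l) (k₁, l) = ∑ i, ∑ i', Y i' i * dualContraction u (i, k₀) (i', k₁) := by
  simp only [pullback, dualContraction, sideways, Matrix.mul_apply, Fintype.sum_prod_type,
    Matrix.kroneckerMap_apply, Matrix.transpose_apply, Matrix.one_apply, mul_ite, mul_one,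
    mul_zero, Finset.sum_ite_eq', Finset.mem_univ, if_true,
    Matrix.map_apply, Matrix.of_apply, Matrix.conjTranspose_apply, Finset.sum_mul, Finset.mul_sum]
  -- both sides are sums over `l`, `i'`, `j`, `i`, in different orders
  calc _ = ∑ l, ∑ i', ∑ i, ∑ j, u (i, j) (k₀, l) * Y i' i * star (u (i', j) (k₁, l)) :=
        Finset.sum_congr rfl fun l _ => Finset.sum_congr rfl fun i' _ => Finset.sum_comm
    _ = ∑ l, ∑ i, ∑ i', ∑ j, u (i, j) (k₀, l) * Y i' i * star (u (i', j) (k₁, l)) :=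
        Finset.sum_congr rfl fun l _ => Finset.sum_comm
    _ = ∑ i, ∑ l, ∑ i', ∑ j, u (i, j) (k₀, l) * Y i' i * star (u (i', j) (k₁, l)) :=
        Finset.sum_comm
    _ = ∑ i, ∑ i', ∑ l, ∑ j, u (i, j) (k₀, l) * Y i' i * star (u (i', j) (k₁, l)) :=
        Finset.sum_congr rfl fun i _ => Finset.sum_comm
    _ = _ := Finset.sum_congr rfl fun i _ => Finset.sum_congr rfl fun i' _ => by
        rw [Finset.sum_comm]
        refine Finset.sum_congr rfl fun j _ => Finset.sum_congr rfl fun l _ => ?_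
        ring

/-- The partial trace of `D(u)` over the left output leg is determined by unitarity. -/
theorem sum_dualContraction {u : Gate q} (hu : IsUnitaryGate u) (k₀ k₁ : Fin q) :
    ∑ i, dualContraction u (i, k₀) (i, k₁) = if k₀ = k₁ then (q : ℂ) else 0 := by
  have h : u * uᴴ = 1 := Matrix.mem_unitaryGroup_iff.1 hu
  have h' : uᴴ * u = 1 := Matrix.mem_unitaryGroup_iff'.1 hu
  have e : ∀ l, ∑ i, ∑ j, u (i, j) (k₀, l) * star (u (i, j) (k₁, l))
      = if k₀ = k₁ then (1 : ℂ) else 0 := by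
    intro l
    have := congrFun (congrFun h' (k₁, l)) (k₀, l)
    rw [Matrix.mul_apply, Fintype.sum_prod_type, Matrix.one_apply] at this
    simp only [Matrix.conjTranspose_apply, Prod.mk.injEq, and_true, eq_comm (a := k₁)] at this
    rw [← this]
    exact Finset.sum_congr rfl fun i _ => Finset.sum_congr rfl fun j _ => mul_comm _ _
  calc ∑ i, dualContraction u (i, k₀) (i, k₁)
      = ∑ l, ∑ i, ∑ j, u (i, j) (k₀, l) * star (u (i, j) (k₁, l)) := by
        simp only [dualContraction, sideways, Matrix.mul_apply, Fintype.sum_prod_type,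
          Matrix.of_apply, Matrix.conjTranspose_apply]
        rw [Finset.sum_comm (s := (Finset.univ : Finset (Fin q)))
          (f := fun l i => ∑ j, u (i, j) (k₀, l) * star (u (i, j) (k₁, l)))]
        exact Finset.sum_congr rfl fun i _ => Finset.sum_comm
    _ = _ := by simp only [e]; simp

/-- Every entry of `D(u) - 1` is a partial trace of the pullback of a traceless operator on the left
output leg: the matrix unit of the entry, less its trace part. -/
theorem exists_traceless_contraction (hq : 0 < q) {u : Gate q} (hu : IsUnitaryGate u)
    (i₀ i₁ k₀ k₁ : Fin q) :
    ∃ Y : Matrix (Fin q) (Fin q) ℂ, IsContraction Y ∧ Y.trace = 0 ∧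
      ∑ l, pullback u Y (k₀, l) (k₁, l) = (dualContraction u - 1) (i₀, k₀) (i₁, k₁) := by
  have hq' : (q : ℂ) ≠ 0 := by exact_mod_cast hq.ne'
  by_cases h : i₀ = i₁
  · subst h
    refine ⟨Matrix.diagonal fun i => (if i = i₀ then 1 else 0) - (q : ℂ)⁻¹, ?_, ?_, ?_⟩
    · refine isContraction_diagonal fun i => ?_
      have h1 : (1 : ℝ) ≤ q := by exact_mod_cast hq
      have h2 : (q : ℝ)⁻¹ ≤ 1 := inv_le_one_of_one_le₀ h1
      have h3 : 0 ≤ (q : ℝ)⁻¹ := by positivity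
      split_ifs
      · rw [show (1 : ℂ) - (q : ℂ)⁻¹ = ((1 - (q : ℝ)⁻¹ : ℝ) : ℂ) by push_cast; rfl,
          Complex.norm_real, Real.norm_eq_abs, abs_le]
        constructor <;> linarith
      · rw [zero_sub, norm_neg, norm_inv, Complex.norm_natCast]
        exact h2
    · simp [Matrix.trace_diagonal, Finset.sum_sub_distrib, hq']
    · rw [sum_pullback]
      simp only [Matrix.diagonal_apply, ite_mul, zero_mul, Finset.sum_ite_eq', Finset.mem_univ,
        if_true, sub_mul, one_mul, Finset.sum_sub_distrib, ← Finset.mul_sum,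
        sum_dualContraction hu, Matrix.sub_apply, Matrix.one_apply, Prod.mk.injEq, true_and]
      split_ifs <;> simp [hq']
  · refine ⟨Matrix.single i₁ i₀ 1, isContraction_single _ _, ?_, ?_⟩
    · simp [Matrix.trace_single_eq_of_ne _ _ _ (Ne.symm h)]
    · rw [sum_pullback]
      simp [Matrix.single_apply, ite_and, h]

/-- The two comparisons `w ≈ z / q` and `z ≈ d / q` amplify the bound on `w` to one on `d`. -/
theorem norm_sq_le_of_chain (hq : 0 < q) {w z d : ℂ} {ε₁ ε₂ ε₃ G : ℝ} (b1 : ‖w‖ ≤ 2 * ε₁)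
    (b2 : ‖w - (q : ℂ)⁻¹ * z‖ ≤ 2 * ε₂) (b3 : ‖z - (q : ℂ)⁻¹ * d‖ ≤ 2 * ε₃)
    (g1 : ε₁ ^ 2 + ε₂ ^ 2 ≤ G) (g3 : ε₃ ^ 2 ≤ G) : ‖d‖ ^ 2 ≤ 36 * (q : ℝ) ^ 4 * G := by
  have hG0 : 0 ≤ G := (sq_nonneg _).trans g3
  have f1 : ε₁ ≤ Real.sqrt G := Real.le_sqrt_of_sq_le (by nlinarith)
  have f2 : ε₂ ≤ Real.sqrt G := Real.le_sqrt_of_sq_le (by nlinarith)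
  have f3 : ε₃ ≤ Real.sqrt G := Real.le_sqrt_of_sq_le g3
  have hG := Real.sqrt_nonneg G
  have hq1 : (1 : ℝ) ≤ q := by exact_mod_cast hq
  have hqinv : ∀ v : ℂ, ‖v‖ = q * ‖(q : ℂ)⁻¹ * v‖ := by
    intro v
    rw [norm_mul, norm_inv, Complex.norm_natCast]
    field_simp
  have n1 : ‖(q : ℂ)⁻¹ * z‖ ≤ 4 * Real.sqrt G := by
    have := norm_sub_norm_le ((q : ℂ)⁻¹ * z) w
    rw [norm_sub_rev] at this
    linarith
  have n2 : ‖(q : ℂ)⁻¹ * d‖ ≤ 4 * q * Real.sqrt G + 2 * Real.sqrt G := by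
    have h1 := norm_sub_norm_le ((q : ℂ)⁻¹ * d) z
    rw [norm_sub_rev] at h1
    have h2 : ‖z‖ ≤ q * (4 * Real.sqrt G) := by rw [hqinv z]; gcongr
    linarith
  have n3 : ‖d‖ ≤ 6 * q ^ 2 * Real.sqrt G := by
    rw [hqinv d]
    have h1 : (q : ℝ) * ‖(q : ℂ)⁻¹ * d‖ ≤ q * (4 * q * Real.sqrt G + 2 * Real.sqrt G) := by gcongr
    have h2 : (q : ℝ) * Real.sqrt G ≤ q * (q * Real.sqrt G) := by
      gcongr
      exact le_mul_of_one_le_left hG hq1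
    linarith
  calc ‖d‖ ^ 2 ≤ (6 * q ^ 2 * Real.sqrt G) ^ 2 := by gcongr
    _ = 36 * q ^ 4 * Real.sqrt G ^ 2 := by ring
    _ = _ := by rw [Real.sq_sqrt hG0]

variable [DecidableEq α] [DecidableEq β]

/-- The entropy gain of a gate `u` acting across a cut is at most `2 ln q`, and close to `2 ln q`
only if `u` is close to satisfying the dual unitarity relation.  With the letters `A B C D` for
the four parts of the system, `B` and `C` being the two sites next to the cut, the gap is the sum
of `S(A) + ln q - S(AB)'` and `S(CD) + ln q - S(BCD)`, the primed entropy being taken after the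
gate.  Both are relative entropies with respect to states in which `B` is maximally mixed and
uncorrelated.  In the same way the gap bounds `S(AB) + ln q - S(ABC)`.  A traceless operator `Y` on
`B` is uncorrelated with `A` after the gate; pulled back through the gate, and with `A` replaced by
its purification, this says that the partial trace of `pullback u Y` is small. -/
theorem norm_dualContraction_sub_one_sq_le (hq : 0 < q) {u : Gate q} (hu : IsUnitaryGate u)
    {M : Matrix (α × Fin q) (β × Fin q) ℂ} (hM : ∑ x, ∑ y, ‖M x y‖ ^ 2 = 1)
    (x y : Fin q × Fin q) :
    ‖(dualContraction u - 1) x y‖ ^ 2 ≤ 36 * (q : ℝ) ^ 4 *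
      (2 * Real.log q + entanglementEntropy M - entanglementEntropy (gateAcross u M)) := by
  obtain ⟨i₀, k₀⟩ := x
  obtain ⟨i₁, k₁⟩ := y
  set M' := gateAcross u M with hM'
  have hM'1 : ∑ x, ∑ y, ‖M' x y‖ ^ 2 = 1 := by rw [hM', sum_norm_sq_gateAcross hu, hM]
  set N : Matrix α ((β × Fin q) × Fin q) ℂ := Matrix.of fun a y => M (a, y.2) y.1 with hN
  set L : Matrix ((α × Fin q) × Fin q) β ℂ := Matrix.of fun x b => M x.1 (b, x.2) with hL
  have hN1 : ∑ x, ∑ y, ‖N x y‖ ^ 2 = 1 := by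
    rw [← hM]
    simp only [hN, Matrix.of_apply, Fintype.sum_prod_type]
    refine Finset.sum_congr rfl fun a _ => ?_
    refine Eq.trans ?_ Finset.sum_comm
    exact Finset.sum_congr rfl fun b _ => Finset.sum_comm
  have hL1 : ∑ x, ∑ y, ‖L x y‖ ^ 2 = 1 := by
    rw [← hM]
    simp only [hL, Matrix.of_apply, Fintype.sum_prod_type]
    refine Finset.sum_congr rfl fun a _ => Finset.sum_congr rfl fun k _ => Finset.sum_comm
  have pM := Matrix.posSemidef_self_mul_conjTranspose M
  have pM2 := Matrix.posSemidef_conjTranspose_mul_self M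
  have pM' := Matrix.posSemidef_self_mul_conjTranspose M'
  have pM'2 := Matrix.posSemidef_conjTranspose_mul_self M'
  have pN := Matrix.posSemidef_self_mul_conjTranspose N
  have pN2 := Matrix.posSemidef_conjTranspose_mul_self N
  have pL := Matrix.posSemidef_self_mul_conjTranspose L
  have pL2 := Matrix.posSemidef_conjTranspose_mul_self L
  have tM := trace_self_mul_conjTranspose_eq_one hM
  have tM' := trace_self_mul_conjTranspose_eq_one hM'1
  have tN := trace_self_mul_conjTranspose_eq_one hN1
  have tL := trace_self_mul_conjTranspose_eq_one hL1
  have tM2 : (Mᴴ * M).trace = 1 := by rw [Matrix.trace_mul_comm, tM]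
  have tM'2 : (M'ᴴ * M').trace = 1 := by rw [Matrix.trace_mul_comm, tM']
  have tN2 : (Nᴴ * N).trace = 1 := by rw [Matrix.trace_mul_comm, tN]
  have tL2 : (Lᴴ * L).trace = 1 := by rw [Matrix.trace_mul_comm, tL]
  have e1 := hsNorm_psdSqrt_sub_sq_le hq pM' tM' pN (by
    intro a a'
    simp only [Matrix.mul_apply, Matrix.conjTranspose_apply, Fintype.sum_prod_type]
    symm
    rw [Finset.sum_comm]
    refine Finset.sum_congr rfl fun b _ => ?_
    rw [hM', sum_gateAcross_mul_star hu]
    exact Finset.sum_comm)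
  have e2 := hsNorm_psdSqrt_sub_sq_le hq pN2 tN2 pM2 (by
    intro y y'
    simp only [Matrix.mul_apply, Matrix.conjTranspose_apply, Fintype.sum_prod_type]
    rw [Finset.sum_comm]
    rfl)
  have e3 := hsNorm_psdSqrt_sub_sq_le hq pL tL pM (by
    intro x x'
    simp only [Matrix.mul_apply, Matrix.conjTranspose_apply, Fintype.sum_prod_type]
    rw [Finset.sum_comm]
    rfl)
  have e4 := hsNorm_psdSqrt_sub_sq_le hq pM'2 tM'2 pL2 (by
    intro b b'
    simp only [Matrix.mul_apply, Matrix.conjTranspose_apply, Fintype.sum_prod_type]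
    symm
    rw [Finset.sum_comm]
    refine Finset.sum_congr rfl fun a _ => ?_
    rw [Finset.sum_comm]
    simp only [mul_comm (star _)]
    rw [hM', sum_gateAcross_mul_star hu]
    rfl)
  have sN := vonNeumannEntropy_mul_comm N Nᴴ pN.isHermitian pN2.isHermitian
  have sL := vonNeumannEntropy_mul_comm L Lᴴ pL.isHermitian pL2.isHermitian
  have sM := entanglementEntropy_eq M
  have sM' := entanglementEntropy_eq M'
  have sM0 : entanglementEntropy M = vonNeumannEntropy (M * Mᴴ) pM.isHermitian := rfl
  have sM'0 : entanglementEntropy M' = vonNeumannEntropy (M' * M'ᴴ) pM'.isHermitian := rfl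
  obtain ⟨Y, hY, hY0, hYD⟩ := exists_traceless_contraction hq hu i₀ i₁ k₀ k₁
  obtain ⟨V, hV, hVN⟩ := exists_isContraction_conjTranspose_mul_eq_psdSqrt N
  set P : Matrix ((β × Fin q) × Fin q) ((β × Fin q) × Fin q) ℂ :=
    (1 : Matrix (β × Fin q) (β × Fin q) ℂ) ⊗ₖ Matrix.single k₁ k₀ (1 : ℂ) with hP
  have hPc : IsContraction P := (isContraction_single k₁ k₀).one_kronecker
  set T := pullback u Y with hT
  have hTc : IsContraction T := pullback_isContraction hu hY
  set TT := ((1 : Matrix β β ℂ) ⊗ₖ T).submatrix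
          (fun y : (β × Fin q) × Fin q => (y.1.1, (y.2, y.1.2)))
          (fun y : (β × Fin q) × Fin q => (y.1.1, (y.2, y.1.2))) with hTT
  have hinj : Function.Injective (fun y : (β × Fin q) × Fin q => (y.1.1, (y.2, y.1.2))) := by
    rintro ⟨⟨a, b⟩, c⟩ ⟨⟨a', b'⟩, c'⟩ h
    simp only [Prod.mk.injEq] at h ⊢
    tauto
  have hTTc : IsContraction TT := (hTc.one_kronecker (k := β)).submatrix hinj hinj
  -- after the gate, `A` and `B` are nearly uncorrelated
  have b1 := norm_trace_kronecker_mul_sub_le hq pM' tM' pN tN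
    ((hV.mul hPc).mul hV.conjTranspose) hY
  have c0 := trace_kronecker_mul_gateAcross u M (V * P * Vᴴ) Y N hN
  rw [← hM', ← hT, ← hTT] at c0
  rw [hY0, mul_zero, mul_zero, sub_zero, c0] at b1
  set R := psdSqrt pN2 with hR
  have hVN2 : Nᴴ * V = R := by
    have := congrArg Matrix.conjTranspose hVN
    rwa [Matrix.conjTranspose_mul, Matrix.conjTranspose_conjTranspose, psdSqrt_conjTranspose]
      at this
  have c1 : (V * P * Vᴴ * (N * TT * Nᴴ)).trace = (P * R * (TT * R)).trace := by
    rw [show V * P * Vᴴ * (N * TT * Nᴴ) = V * (P * (Vᴴ * N) * TT * Nᴴ) by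
      simp only [Matrix.mul_assoc], Matrix.trace_mul_comm, hVN, Matrix.mul_assoc _ Nᴴ, hVN2]
    simp only [Matrix.mul_assoc]
  rw [c1] at b1
  -- before the gate, `B` and `CD` are nearly uncorrelated
  have b2 := norm_trace_sub_trace_le (hsNorm_psdSqrt pN2 tN2)
    (hsNorm_smul_psdSqrt_kronecker_one hq pM2 tM2) hPc hTTc
  set R₀ := ((Real.sqrt q : ℂ)⁻¹) • (psdSqrt pM2 ⊗ₖ (1 : Matrix (Fin q) (Fin q) ℂ)) with hR₀
  have c2 : (P * R₀ * (TT * R₀)).trace = (q : ℂ)⁻¹ *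
      (((1 : Matrix (α × Fin q) (α × Fin q) ℂ) ⊗ₖ
          (T.submatrix (fun l => (k₀, l)) (fun l => (k₁, l)))ᵀ) * (L * Lᴴ)).trace := by
    rw [← trace_conjTranspose_mul_kronecker_single M T k₀ k₁ L (fun _ _ => rfl), ← hTT,
      ← Matrix.mul_assoc, Matrix.trace_mul_comm, ← Matrix.mul_assoc, hR₀, hP, Matrix.mul_smul,
      Matrix.smul_mul, Matrix.smul_mul, Matrix.mul_smul, Matrix.smul_mul, smul_smul,
      norm_inv_sqrt_mul_self hq,
      ← Matrix.mul_kronecker_mul, ← Matrix.mul_kronecker_mul, Matrix.mul_one,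
      Matrix.one_mul, Matrix.one_mul, psdSqrt_mul_self, Matrix.trace_smul, smul_eq_mul]
  -- before the gate, `C` is nearly maximally mixed
  have hz : IsContraction (T.submatrix (fun l => (k₀, l)) (fun l => (k₁, l)))ᵀ :=
    (hTc.submatrix (Prod.mk_right_injective k₀) (Prod.mk_right_injective k₁)).transpose
  have b3 := norm_trace_kronecker_mul_sub_le hq pL tL pM tM
    (isContraction_one (n := α × Fin q)) hz
  have c3 : ((T.submatrix (fun l => (k₀, l)) (fun l => (k₁, l)))ᵀ).trace
      = (dualContraction u - 1) (i₀, k₀) (i₁, k₁) := by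
    rw [← hYD]; rfl
  rw [Matrix.one_mul, tM, one_mul, c3] at b3
  rw [c2] at b2
  set G := 2 * Real.log q + entanglementEntropy M - entanglementEntropy M' with hG
  set d := (dualContraction u - 1) (i₀, k₀) (i₁, k₁) with hd
  set z := (((1 : Matrix (α × Fin q) (α × Fin q) ℂ) ⊗ₖ
          (T.submatrix (fun l => (k₀, l)) (fun l => (k₁, l)))ᵀ) * (L * Lᴴ)).trace with hz
  set w := (P * R * (TT * R)).trace with hw
  set ε₁ := hsNorm (psdSqrt pM' - ((Real.sqrt q : ℂ)⁻¹) •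
    (psdSqrt pN ⊗ₖ (1 : Matrix (Fin q) (Fin q) ℂ))) with hε₁
  set ε₂ := hsNorm (R - R₀) with hε₂
  set ε₃ := hsNorm (psdSqrt pL - ((Real.sqrt q : ℂ)⁻¹) •
    (psdSqrt pM ⊗ₖ (1 : Matrix (Fin q) (Fin q) ℂ))) with hε₃
  have hε₂' : ε₂ ^ 2 ≤ vonNeumannEntropy (Mᴴ * M) pM2.isHermitian + Real.log q
    - vonNeumannEntropy (Nᴴ * N) pN2.isHermitian := e2
  refine norm_sq_le_of_chain hq b1 b2 b3 ?_ ?_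
  · linarith
  · have := sq_nonneg (hsNorm (psdSqrt pM'2 - ((Real.sqrt q : ℂ)⁻¹) •
      (psdSqrt pL2 ⊗ₖ (1 : Matrix (Fin q) (Fin q) ℂ))))
    linarith

end Gain

/-! ### Entropy along the brickwork circuit -/

section Circuit

/-- Fibering the sum over configurations over the value at one site. -/
theorem card_mul_sum_eq_sum_update {ι : Type*} [Fintype ι] [DecidableEq ι] {q : ℕ}
    (f : (ι → Fin q) → ℂ) (i : ι) :
    (q : ℂ) * ∑ c, f c = ∑ c, ∑ k, f (Function.update c i k) := by
  have h : ∑ p : (ι → Fin q) × Fin q, f p.1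
      = ∑ p : (ι → Fin q) × Fin q, f (Function.update p.1 i p.2) :=
    Fintype.sum_bijective (fun p : (ι → Fin q) × Fin q => (Function.update p.1 i p.2, p.1 i))
      (Function.Involutive.bijective fun p => by simp) _ _ (fun p => by simp)
  rw [Fintype.sum_prod_type, Fintype.sum_prod_type] at h
  rw [← h, Finset.mul_sum]
  simp

/-- Application of a gate to two sites of a configuration. -/
noncomputable def siteGate {ι : Type*} [DecidableEq ι] {q : ℕ} (u : Gate q) (i j : ι)
    (f : (ι → Fin q) → ℂ) (c : ι → Fin q) : ℂ :=
  ∑ k : Fin q, ∑ l : Fin q,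
    u (c i, c j) (k, l) * f (Function.update (Function.update c i k) j l)

theorem sum_star_siteGate_mul {ι : Type*} [Fintype ι] [DecidableEq ι] {q : ℕ} (hq : 0 < q)
    {u : Gate q} (hu : IsUnitaryGate u) {i j : ι} (hij : i ≠ j) (f g : (ι → Fin q) → ℂ) :
    ∑ c, star (siteGate u i j f c) * siteGate u i j g c = ∑ c, star (f c) * g c := by
  have hq' : (q : ℂ) ≠ 0 := by exact_mod_cast hq.ne'
  have hfib : ∀ F : (ι → Fin q) → ℂ, (q : ℂ) * ((q : ℂ) * ∑ c, F c)
      = ∑ c, ∑ p : Fin q × Fin q, F (Function.update (Function.update c i p.1) j p.2) := by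
    intro F
    rw [card_mul_sum_eq_sum_update _ j,
      card_mul_sum_eq_sum_update (fun c => ∑ l, F (Function.update c j l)) i]
    simp only [Fintype.sum_prod_type]
  have hval : ∀ (F : (ι → Fin q) → ℂ) (c : ι → Fin q) (p : Fin q × Fin q),
      siteGate u i j F (Function.update (Function.update c i p.1) j p.2)
        = (u *ᵥ fun r => F (Function.update (Function.update c i r.1) j r.2)) p := by
    intro F c p
    simp only [siteGate, Matrix.mulVec, dotProduct, Fintype.sum_prod_type,
      Function.update_self, Function.update_of_ne hij]
    refine Finset.sum_congr rfl fun k _ => Finset.sum_congr rfl fun l _ => ?_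
    congr 2
    ext x
    by_cases hj : x = j
    · simp [hj]
    · by_cases hi : x = i
      · simp [hi, hij]
      · simp [hi, hj]
  refine mul_left_cancel₀ hq' (mul_left_cancel₀ hq' ?_)
  rw [hfib, hfib]
  refine Finset.sum_congr rfl fun c _ => ?_
  have h := mulVec_dotProduct_star_mulVec hu
    (fun r => g (Function.update (Function.update c i r.1) j r.2))
    (fun r => f (Function.update (Function.update c i r.1) j r.2))
  simp only [dotProduct, ← hval, Pi.star_apply] at h
  simp only [mul_comm (star _)]
  exact h

variable {q n dL dR : ℕ}

/-- The squared norm of a state on a window. -/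
noncomputable def normSq (Ψ : WindowState q n dL dR) : ℝ := ∑ x, ∑ y, ‖cutMatrix Ψ x y‖ ^ 2

theorem normSq_eq_of_conjTranspose_mul_self {m m' n : Type*} [Fintype m] [Fintype m'] [Fintype n]
    {M : Matrix m n ℂ} {N : Matrix m' n ℂ} (h : Mᴴ * M = Nᴴ * N) :
    ∑ x, ∑ y, ‖M x y‖ ^ 2 = ∑ x, ∑ y, ‖N x y‖ ^ 2 := by
  have := congrArg Matrix.trace h
  rw [trace_conjTranspose_mul_self_eq_hsNorm_sq, trace_conjTranspose_mul_self_eq_hsNorm_sq,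
    hsNorm_sq, hsNorm_sq] at this
  exact_mod_cast this

theorem normSq_eq_of_self_mul_conjTranspose {m n n' : Type*} [Fintype m] [Fintype n] [Fintype n']
    {M : Matrix m n ℂ} {N : Matrix m n' ℂ} (h : M * Mᴴ = N * Nᴴ) :
    ∑ x, ∑ y, ‖M x y‖ ^ 2 = ∑ x, ∑ y, ‖N x y‖ ^ 2 := by
  have := congrArg Matrix.trace h
  rw [Matrix.trace_mul_comm, Matrix.trace_mul_comm N, trace_conjTranspose_mul_self_eq_hsNorm_sq,
    trace_conjTranspose_mul_self_eq_hsNorm_sq, hsNorm_sq, hsNorm_sq] at this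
  exact_mod_cast this

theorem update_append_left {α : Type*} {m n : ℕ} (x : Fin m → α) (y : Fin n → α) (i : Fin m)
    (k : α) : Function.update (Fin.append x y) (Fin.castAdd n i) k
      = Fin.append (Function.update x i k) y := by
  ext j
  refine Fin.addCases (fun j => ?_) (fun j => ?_) j
  · by_cases h : j = i
    · subst h; simp
    · rw [Function.update_of_ne (by simpa using h)]
      simp [Function.update_of_ne h]
  · rw [Function.update_of_ne (by
      intro h
      have := congrArg Fin.val h
      simp at this
      omega)]
    simp

theorem update_append_right {α : Type*} {m n : ℕ} (x : Fin m → α) (y : Fin n → α) (i : Fin n)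
    (k : α) : Function.update (Fin.append x y) (Fin.natAdd m i) k
      = Fin.append x (Function.update y i k) := by
  ext j
  refine Fin.addCases (fun j => ?_) (fun j => ?_) j
  · rw [Function.update_of_ne (by
      intro h
      have := congrArg Fin.val h
      simp at this
      omega)]
    simp
  · by_cases h : j = i
    · subst h; simp
    · rw [Function.update_of_ne (by simpa using h)]
      simp [Function.update_of_ne h]

theorem cutMatrix_applyGate_left (u : Gate q) (Ψ : WindowState q n dL dR) {i : ℕ}
    (hi : i + 1 < n) (x : Fin dL × (Fin n → Fin q)) (y : Fin dR × (Fin n → Fin q)) :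
    cutMatrix (applyGate u i Ψ) x y
      = siteGate u (⟨i, by omega⟩ : Fin n) ⟨i + 1, hi⟩ (fun c => cutMatrix Ψ (x.1, c) y) x.2 := by
  have e1 : (⟨i, by omega⟩ : Fin (n + n)) = Fin.castAdd n ⟨i, by omega⟩ := rfl
  have e2 : (⟨i + 1, by omega⟩ : Fin (n + n)) = Fin.castAdd n ⟨i + 1, hi⟩ := rfl
  simp only [cutMatrix, applyGate, dif_pos (show i + 1 < n + n by omega), Matrix.of_apply,
    siteGate, e1, e2, Fin.append_left, update_append_left]

theorem cutMatrix_applyGate_right (u : Gate q) (Ψ : WindowState q n dL dR) {i : ℕ}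
    (hi : n ≤ i) (hi' : i + 1 < n + n) (x : Fin dL × (Fin n → Fin q))
    (y : Fin dR × (Fin n → Fin q)) :
    cutMatrix (applyGate u i Ψ) x y
      = siteGate u (⟨i - n, by omega⟩ : Fin n) ⟨i - n + 1, by omega⟩
          (fun c => cutMatrix Ψ x (y.1, c)) y.2 := by
  have e1 : (⟨i, by omega⟩ : Fin (n + n)) = Fin.natAdd n ⟨i - n, by omega⟩ := by
    ext; simp; omega
  have e2 : (⟨i + 1, by omega⟩ : Fin (n + n)) = Fin.natAdd n ⟨i - n + 1, by omega⟩ := by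
    ext; simp; omega
  simp only [cutMatrix, applyGate, dif_pos hi', Matrix.of_apply,
    siteGate, e1, e2, Fin.append_right, update_append_right]

/-- A gate on one side of the cut changes neither the norm nor the entropy. -/
theorem applyGate_of_ne (hq : 0 < q) {u : Gate q} (hu : IsUnitaryGate u)
    (Ψ : WindowState q n dL dR) {i : ℕ} (hi : i + 1 ≠ n) :
    normSq (applyGate u i Ψ) = normSq Ψ ∧
      entanglementEntropy (cutMatrix (applyGate u i Ψ)) = entanglementEntropy (cutMatrix Ψ) := by
  by_cases hi' : i + 1 < n + n
  · rcases lt_or_gt_of_ne hi with h | h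
    · have e : (cutMatrix (applyGate u i Ψ))ᴴ * cutMatrix (applyGate u i Ψ)
          = (cutMatrix Ψ)ᴴ * cutMatrix Ψ := by
        ext y y'
        simp only [Matrix.mul_apply, Fintype.sum_prod_type, Matrix.conjTranspose_apply,
          cutMatrix_applyGate_left u Ψ h]
        refine Finset.sum_congr rfl fun a _ => ?_
        exact sum_star_siteGate_mul hq hu (by simp) _ _
      exact ⟨normSq_eq_of_conjTranspose_mul_self e, entanglementEntropy_congr_right e⟩
    · have e : cutMatrix (applyGate u i Ψ) * (cutMatrix (applyGate u i Ψ))ᴴ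
          = cutMatrix Ψ * (cutMatrix Ψ)ᴴ := by
        ext x x'
        simp only [Matrix.mul_apply, Fintype.sum_prod_type, Matrix.conjTranspose_apply,
          cutMatrix_applyGate_right u Ψ (show n ≤ i by omega) hi', mul_comm _ (star _)]
        refine Finset.sum_congr rfl fun a _ => ?_
        exact sum_star_siteGate_mul hq hu (by simp) _ _
      exact ⟨normSq_eq_of_self_mul_conjTranspose e, entanglementEntropy_congr_left e⟩
  · rw [applyGate, dif_neg hi']
    exact ⟨rfl, rfl⟩

/-- Splitting the last site off the left half of the window. -/
def splitLast (d m q : ℕ) : Fin d × (Fin (m + 1) → Fin q) ≃ (Fin d × (Fin m → Fin q)) × Fin q where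
  toFun x := ((x.1, Fin.init x.2), x.2 (Fin.last m))
  invFun x := (x.1.1, Fin.snoc (α := fun _ => Fin q) x.1.2 x.2)
  left_inv x := by simp
  right_inv x := by simp

/-- Splitting the first site off the right half of the window. -/
def splitFirst (d m q : ℕ) :
    Fin d × (Fin (m + 1) → Fin q) ≃ (Fin d × (Fin m → Fin q)) × Fin q where
  toFun x := ((x.1, Fin.tail x.2), x.2 0)
  invFun x := (x.1.1, Fin.cons (α := fun _ => Fin q) x.2 x.1.2)
  left_inv x := by simp
  right_inv x := by simp

theorem reindex_cutMatrix_applyGate {m : ℕ} (u : Gate q) (Ψ : WindowState q (m + 1) dL dR) :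
    Matrix.reindex (splitLast dL m q) (splitFirst dR m q) (cutMatrix (applyGate u m Ψ))
      = gateAcross u (Matrix.reindex (splitLast dL m q) (splitFirst dR m q) (cutMatrix Ψ)) := by
  ext ⟨⟨a, c⟩, k⟩ ⟨⟨b, d⟩, l⟩
  have e1 : (⟨m, by omega⟩ : Fin (m + 1 + (m + 1))) = Fin.castAdd (m + 1) (Fin.last m) := rfl
  have e2 : (⟨m + 1, by omega⟩ : Fin (m + 1 + (m + 1))) = Fin.natAdd (m + 1) 0 := rfl
  simp only [Matrix.reindex_apply, Matrix.submatrix_apply, splitLast, splitFirst,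
    Equiv.coe_fn_symm_mk, cutMatrix, Matrix.of_apply, gateAcross, applyGate,
    dif_pos (show m + 1 < m + 1 + (m + 1) by omega), e1, e2, Fin.append_left, Fin.append_right,
    update_append_left, update_append_right, Fin.snoc_last, Fin.cons_zero,
    Fin.update_snoc_last, Fin.update_cons_zero]

theorem sum_reindex {m n m' n' : Type*} [Fintype m] [Fintype n] [Fintype m'] [Fintype n']
    (e : m ≃ m') (f : n ≃ n') (M : Matrix m n ℂ) :
    ∑ x, ∑ y, ‖Matrix.reindex e f M x y‖ ^ 2 = ∑ x, ∑ y, ‖M x y‖ ^ 2 := by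
  rw [← e.sum_comp]
  refine Finset.sum_congr rfl fun x _ => ?_
  rw [← f.sum_comp]
  simp

/-- A gate across the cut preserves the norm, and its entropy gain is bounded. -/
theorem applyGate_across (hq : 0 < q) {u : Gate q} (hu : IsUnitaryGate u) (p r : Fin q × Fin q)
    {Ψ : WindowState q n dL dR} (hΨ : normSq Ψ = 1) {i : ℕ} (hi : i + 1 = n) :
    normSq (applyGate u i Ψ) = 1 ∧
      entanglementEntropy (cutMatrix (applyGate u i Ψ)) ≤ entanglementEntropy (cutMatrix Ψ) +
        (2 * Real.log q - ‖(dualContraction u - 1) p r‖ ^ 2 / (36 * (q : ℝ) ^ 4)) := by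
  subst hi
  set M := Matrix.reindex (splitLast dL i q) (splitFirst dR i q) (cutMatrix Ψ) with hM
  have hM1 : ∑ x, ∑ y, ‖M x y‖ ^ 2 = 1 := by rw [hM, sum_reindex]; exact hΨ
  have h1 := sum_norm_sq_gateAcross hu M
  have h2 := norm_dualContraction_sub_one_sq_le hq hu hM1 p r
  rw [hM, ← reindex_cutMatrix_applyGate, entanglementEntropy_reindex,
    entanglementEntropy_reindex] at h2
  rw [← reindex_cutMatrix_applyGate, hM1, sum_reindex] at h1
  refine ⟨h1, ?_⟩
  have hq' : (0 : ℝ) < q := by exact_mod_cast hq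
  rw [mul_comm, ← div_le_iff₀ (by positivity)] at h2
  linarith

/-- The entropy gain of a layer: only even layers have a gate across the cut. -/
theorem applyLayer_entropy_le (hq : 0 < q) {u : Gate q} (hu : IsUnitaryGate u) {g : ℝ}
    (hn : 0 < n)
    (hg : ∀ Ψ : WindowState q n dL dR, normSq Ψ = 1 → ∀ i, i + 1 = n →
      normSq (applyGate u i Ψ) = 1 ∧
      entanglementEntropy (cutMatrix (applyGate u i Ψ)) ≤ entanglementEntropy (cutMatrix Ψ) + g)
    {Ψ : WindowState q n dL dR} (hΨ : normSq Ψ = 1) (s : ℕ) :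
    normSq (applyLayer u s Ψ) = 1 ∧
      entanglementEntropy (cutMatrix (applyLayer u s Ψ)) ≤
        entanglementEntropy (cutMatrix Ψ) + (if Even s then g else 0) := by
  have key : ∀ (l : List ℕ) (Φ : WindowState q n dL dR), normSq Φ = 1 →
      normSq (l.foldl (fun Φ i => if Odd (i + n + s) then applyGate u i Φ else Φ) Φ) = 1 ∧
      entanglementEntropy (cutMatrix
        (l.foldl (fun Φ i => if Odd (i + n + s) then applyGate u i Φ else Φ) Φ)) ≤
        entanglementEntropy (cutMatrix Φ) + l.count (n - 1) * (if Even s then g else 0) := by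
    intro l
    induction l with
    | nil => intro Φ hΦ; simpa using hΦ
    | cons i l ih =>
      intro Φ hΦ
      rw [List.foldl_cons]
      by_cases hi : i + 1 = n
      · have hc : ((i :: l).count (n - 1) : ℝ) = l.count (n - 1) + 1 := by
          rw [show n - 1 = i by omega, List.count_cons_self]; push_cast; ring
        rw [hc, add_mul, one_mul]
        by_cases hs : Even s
        · rw [if_pos (by rw [← hi]; rcases hs with ⟨a, rfl⟩; exact ⟨i + a, by ring⟩)]
          obtain ⟨h1, h2⟩ := hg Φ hΦ i hi
          obtain ⟨h3, h4⟩ := ih _ h1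
          refine ⟨h3, h4.trans ?_⟩
          rw [if_pos hs] at *
          linarith
        · rw [if_neg (by
            rw [← hi, Nat.not_odd_iff_even]
            rcases Nat.not_even_iff_odd.1 hs with ⟨a, rfl⟩; exact ⟨i + a + 1, by ring⟩)]
          obtain ⟨h3, h4⟩ := ih _ hΦ
          refine ⟨h3, h4.trans ?_⟩
          rw [if_neg hs] at *
          linarith
      · have hc : (i :: l).count (n - 1) = l.count (n - 1) :=
          List.count_cons_of_ne (by omega)
        rw [hc]
        by_cases ho : Odd (i + n + s)
        · obtain ⟨h1, h2⟩ := applyGate_of_ne hq hu Φ hi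
          rw [if_pos ho, ← h2]
          exact ih _ (h1.trans hΦ)
        · rw [if_neg ho]
          exact ih _ hΦ
  have := key (List.range (n + n)) Ψ hΨ
  rw [List.count_eq_one_of_mem List.nodup_range (List.mem_range.2 (by omega)), Nat.cast_one,
    one_mul] at this
  exact this

/-- Among `t` layers, the `t / 2` even ones have a gate across the cut. -/
theorem evolve_entropy_le (hq : 0 < q) {u : Gate q} (hu : IsUnitaryGate u) {g : ℝ} (hn : 0 < n)
    (hg : ∀ Ψ : WindowState q n dL dR, normSq Ψ = 1 → ∀ i, i + 1 = n →
      normSq (applyGate u i Ψ) = 1 ∧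
      entanglementEntropy (cutMatrix (applyGate u i Ψ)) ≤ entanglementEntropy (cutMatrix Ψ) + g)
    {Ψ : WindowState q n dL dR} (hΨ : normSq Ψ = 1) (t : ℕ) :
    normSq (evolve u Ψ t) = 1 ∧ entanglementEntropy (cutMatrix (evolve u Ψ t)) ≤
      entanglementEntropy (cutMatrix Ψ) + (t / 2 : ℕ) * g := by
  induction t with
  | zero => simpa [evolve] using hΨ
  | succ t ih =>
    obtain ⟨h1, h2⟩ := applyLayer_entropy_le hq hu hn hg ih.1 (t + 1)
    refine ⟨h1, h2.trans ?_⟩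
    have e : (((t + 1) / 2 : ℕ) : ℝ) * g = (t / 2 : ℕ) * g + (if Even (t + 1) then g else 0) := by
      by_cases h : Even (t + 1)
      · rw [if_pos h, show (t + 1) / 2 = t / 2 + 1 by rcases h with ⟨a, ha⟩; omega]
        push_cast
        ring
      · rw [if_neg h, show (t + 1) / 2 = t / 2 by
          rcases Nat.not_even_iff_odd.1 h with ⟨a, ha⟩; omega, add_zero]
    rw [e]
    linarith [ih.2]

end Circuit

section InitialState

variable {q : ℕ}

theorem HalfChain.sum_site_mul (H : HalfChain q) (k : ℕ) :
    ∑ i, (H.site k i)ᴴ * H.site k i = 1 := by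
  rw [← H.isometry k]
  ext a b
  simp [Matrix.sum_apply, Matrix.mul_apply, HalfChain.site, Fintype.sum_prod_type]

/-- The first `n` tensors form an isometry from the bond at the cut. -/
theorem HalfChain.sum_amplitude_mul (H : HalfChain q) (n : ℕ) :
    ∑ s, (H.amplitude n s)ᴴ * H.amplitude n s = 1 := by
  induction n with
  | zero => simp [HalfChain.amplitude]
  | succ n ih =>
    rw [← ih, ← (Fin.snocEquiv fun _ => Fin q).sum_comp, Fintype.sum_prod_type_right]
    refine Finset.sum_congr rfl fun s _ => ?_
    simp only [HalfChain.amplitude, Fin.snocEquiv_apply, Fin.snoc_last, Fin.snoc_castSucc]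
    calc _ = (H.amplitude n s)ᴴ * (∑ i, (H.site n i)ᴴ * H.site n i) * H.amplitude n s := by
          simp only [Matrix.mul_sum, Matrix.sum_mul, Matrix.conjTranspose_mul, Matrix.mul_assoc]
      _ = _ := by rw [H.sum_site_mul, Matrix.mul_one]

/-- The isometry formed by the first `n` tensors of a half chain.  The permutation `e` of
configurations allows the sites to be listed in either direction: away from the cut, or from left
to right. -/
def HalfChain.isom (H : HalfChain q) (n : ℕ) (e : (Fin n → Fin q) ≃ (Fin n → Fin q)) :
    Matrix (Fin (H.bond n) × (Fin n → Fin q)) (Fin (H.bond 0)) ℂ :=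
  Matrix.of fun x p => H.amplitude n (e x.2) x.1 p

theorem HalfChain.isom_conjTranspose_mul (H : HalfChain q) (n : ℕ)
    (e : (Fin n → Fin q) ≃ (Fin n → Fin q)) : (H.isom n e)ᴴ * H.isom n e = 1 := by
  rw [← H.sum_amplitude_mul n, ← e.sum_comp]
  ext a b
  simp only [Matrix.sum_apply, Matrix.mul_apply, HalfChain.isom, Fintype.sum_prod_type,
    Matrix.conjTranspose_apply, Matrix.of_apply]
  exact Finset.sum_comm

theorem cutMatrix_window (ψ : ChainState q) (n : ℕ) :
    cutMatrix (ψ.window n) = ψ.left.isom n (Equiv.arrowCongr Fin.revPerm (Equiv.refl _))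
      * (ψ.center * (ψ.right.isom n (Equiv.refl _))ᵀ) := by
  ext ⟨a, x⟩ ⟨b, y⟩
  simp only [cutMatrix, ChainState.window, Matrix.of_apply, Fin.append_left, Fin.append_right]
  rw [Matrix.mul_assoc]
  rfl

/-- The initial entropy is that of the bond at the cut, for every size of the window. -/
theorem window_normSq_entropy (ψ : ChainState q) (n : ℕ) :
    normSq (ψ.window n) = 1 ∧
      entanglementEntropy (cutMatrix (ψ.window n)) = entanglementEntropy ψ.center := by
  set A := ψ.left.isom n (Equiv.arrowCongr Fin.revPerm (Equiv.refl _)) with hA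
  set B := ψ.right.isom n (Equiv.refl _) with hB
  have hA1 : Aᴴ * A = 1 := ψ.left.isom_conjTranspose_mul n _
  have hB1 : Bᵀ * Bᵀᴴ = 1 := by
    have := congrArg Matrix.transpose (ψ.right.isom_conjTranspose_mul n (Equiv.refl _))
    rwa [Matrix.transpose_mul, Matrix.transpose_one] at this
  have h1 : (cutMatrix (ψ.window n))ᴴ * cutMatrix (ψ.window n)
      = (ψ.center * Bᵀ)ᴴ * (ψ.center * Bᵀ) := by
    rw [cutMatrix_window, Matrix.conjTranspose_mul, Matrix.mul_assoc, ← Matrix.mul_assoc Aᴴ, hA1,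
      Matrix.one_mul]
  have h2 : (ψ.center * Bᵀ) * (ψ.center * Bᵀ)ᴴ = ψ.center * ψ.centerᴴ := by
    rw [Matrix.conjTranspose_mul, Matrix.mul_assoc, ← Matrix.mul_assoc Bᵀ, hB1, Matrix.one_mul]
  refine ⟨?_, ?_⟩
  · rw [normSq, normSq_eq_of_conjTranspose_mul_self h1, normSq_eq_of_self_mul_conjTranspose h2,
      ψ.normalized]
  · rw [entanglementEntropy_congr_right h1, entanglementEntropy_congr_left h2]

end InitialState

/-- Every growth rate is below `1` by an amount quadratic in the violation of dual unitarity. -/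
theorem growthRate_le {q : ℕ} (hq : 2 ≤ q) {u : Gate q} (hu : IsUnitaryGate u)
    (p s : Fin q × Fin q) {ψ : ChainState q} {r : ℝ} (hr : IsGrowthRate u ψ r) :
    r ≤ 1 - ‖(dualContraction u - 1) p s‖ ^ 2 / (72 * (q : ℝ) ^ 4 * Real.log q) := by
  set d := ‖(dualContraction u - 1) p s‖ with hd
  set g := 2 * Real.log q - d ^ 2 / (36 * (q : ℝ) ^ 4) with hg
  set E := entanglementEntropy ψ.center with hE
  have hq0 : 0 < q := by omega
  have hlog : 0 < Real.log q := Real.log_pos (by exact_mod_cast hq)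
  have hbound : ∀ t : ℕ, 0 < t → entropyAt u ψ t ≤ E + (t / 2 : ℕ) * g := by
    intro t ht
    obtain ⟨h1, h2⟩ := window_normSq_entropy ψ t
    have := (evolve_entropy_le hq0 hu ht (g := g)
      (fun Ψ hΨ i hi => applyGate_across hq0 hu p s hΨ hi) h1 t).2
    rwa [h2] at this
  have hlim : Tendsto (fun t : ℕ => (E + |g|) / Real.log q * (t : ℝ)⁻¹ + g / (2 * Real.log q))
      atTop (𝓝 ((E + |g|) / Real.log q * 0 + g / (2 * Real.log q))) :=
    (tendsto_inv_atTop_nhds_zero_nat.const_mul _).add_const _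
  have hle : r ≤ (E + |g|) / Real.log q * 0 + g / (2 * Real.log q) := by
    refine le_of_tendsto_of_tendsto hr hlim ?_
    filter_upwards [eventually_gt_atTop 0] with t ht
    have ht' : (0 : ℝ) < t := by exact_mod_cast ht
    rw [div_le_iff₀ (by positivity)]
    refine (hbound t ht).trans ?_
    have e : ((E + |g|) / Real.log q * (t : ℝ)⁻¹ + g / (2 * Real.log q)) * (t * Real.log q)
        = E + |g| + t / 2 * g := by
      field_simp
    rw [e]
    -- rounding `t / 2` down costs at most `|g|`
    have h1 : ((t / 2 : ℕ) : ℝ) ≤ t / 2 := Nat.cast_div_le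
    have h2 : (t : ℝ) / 2 - 1 ≤ ((t / 2 : ℕ) : ℝ) := by
      have : t ≤ 2 * (t / 2) + 1 := by omega
      have : (t : ℝ) ≤ 2 * ((t / 2 : ℕ) : ℝ) + 1 := by exact_mod_cast this
      linarith
    have h3 : (((t / 2 : ℕ) : ℝ) - t / 2) * g ≤ |g| := by
      refine (le_abs_self _).trans ?_
      rw [abs_mul]
      refine mul_le_of_le_one_left (abs_nonneg g) ?_
      rw [abs_le]
      constructor <;> linarith
    linarith
  refine hle.trans (le_of_eq ?_)
  have hq' : (0 : ℝ) < q := by exact_mod_cast hq0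
  rw [hg]
  field_simp
  ring

/-- A gate of entanglement velocity `1 - η` satisfies the dual unitarity relation up to `O(√η)`. -/
theorem norm_dualContraction_sub_one_sq_le_of_velocity {q : ℕ} (hq : 2 ≤ q) {u : Gate q}
    (hu : IsUnitaryGate u) {η : ℝ} (hv : IsEntanglementVelocity u (1 - η))
    (p s : Fin q × Fin q) :
    ‖(dualContraction u - 1) p s‖ ^ 2 ≤ 72 * (q : ℝ) ^ 4 * Real.log q * η := by
  have hq' : (0 : ℝ) < q := by exact_mod_cast (show 0 < q by omega)
  have hlog : 0 < Real.log q := Real.log_pos (by exact_mod_cast hq)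
  have h : 1 - η ≤ 1 - ‖(dualContraction u - 1) p s‖ ^ 2 / (72 * (q : ℝ) ^ 4 * Real.log q) :=
    hv.2 fun r ⟨ψ, _, hr⟩ => growthRate_le hq hu p s hr
  have h' : ‖(dualContraction u - 1) p s‖ ^ 2 / (72 * (q : ℝ) ^ 4 * Real.log q) ≤ η := by linarith
  rwa [div_le_iff₀ (by positivity), mul_comm] at h'

/-! ### Compactness: nearly dual unitary gates are near dual unitary gates -/

section Compactness

variable {q : ℕ}

theorem isCompact_setOf_isUnitaryGate : IsCompact {u : Gate q | IsUnitaryGate u} := by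
  have hK : IsCompact (Set.pi Set.univ fun _ : Fin q × Fin q =>
      Set.pi Set.univ fun _ : Fin q × Fin q => Metric.closedBall (0 : ℂ) 1) :=
    isCompact_univ_pi fun _ => isCompact_univ_pi fun _ => isCompact_closedBall _ _
  refine IsCompact.of_isClosed_subset hK ?_ ?_
  · have : {u : Gate q | IsUnitaryGate u} = {u : Gate q | u * uᴴ = 1} := by
      ext u
      exact Matrix.mem_unitaryGroup_iff
    rw [this]
    exact isClosed_eq (by fun_prop) continuous_const
  · intro u hu i _ j _
    rw [mem_closedBall_zero_iff]
    exact entry_norm_bound_of_unitary hu i j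

theorem continuous_hsNorm {m n : Type*} [Fintype m] [Fintype n] :
    Continuous (hsNorm : Matrix m n ℂ → ℝ) := by
  unfold hsNorm
  refine Real.continuous_sqrt.comp ?_
  refine continuous_finsetSum _ fun i _ => continuous_finsetSum _ fun j _ => ?_
  exact ((continuous_id.matrix_elem i j).norm).pow 2

theorem eq_zero_of_hsNorm_le_zero {m n : Type*} [Fintype m] [Fintype n] {M : Matrix m n ℂ}
    (h : hsNorm M ≤ 0) : M = 0 := by
  ext i j
  exact norm_le_zero_iff.1 ((norm_entry_le_hsNorm M i j).trans h)

theorem continuous_dualContraction : Continuous (dualContraction : Gate q → _) := by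
  have h : Continuous (sideways : Gate q → _) := by
    refine continuous_matrix fun i j => ?_
    exact continuous_id.matrix_elem _ _
  unfold dualContraction
  fun_prop

/-- On the compact set of unitary gates away from the dual unitaries, the violation of the dual
unitarity relation has a positive minimum. -/
theorem exists_isDualUnitary_hsNorm_lt {ε : ℝ} (hε : 0 < ε) :
    ∃ δ : ℝ, 0 < δ ∧ ∀ u : Gate q, IsUnitaryGate u → hsNorm (dualContraction u - 1) < δ →
      ∃ u' : Gate q, IsDualUnitary u' ∧ hsNorm (u - u') < ε := by
  set K := {u : Gate q | IsUnitaryGate u} ∩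
    {u : Gate q | ∃ u' : Gate q, IsDualUnitary u' ∧ hsNorm (u - u') < ε}ᶜ with hK
  have hopen : IsOpen {u : Gate q | ∃ u' : Gate q, IsDualUnitary u' ∧ hsNorm (u - u') < ε} := by
    have : {u : Gate q | ∃ u' : Gate q, IsDualUnitary u' ∧ hsNorm (u - u') < ε}
        = ⋃ u' ∈ {u' : Gate q | IsDualUnitary u'}, {u : Gate q | hsNorm (u - u') < ε} := by
      ext u; simp
    rw [this]
    refine isOpen_biUnion fun u' _ => ?_
    exact isOpen_lt (continuous_hsNorm.comp (by fun_prop)) continuous_const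
  have hKc : IsCompact K := isCompact_setOf_isUnitaryGate.inter_right hopen.isClosed_compl
  rcases K.eq_empty_or_nonempty with h0 | h0
  · refine ⟨1, one_pos, fun u hu _ => ?_⟩
    by_contra h
    have hmem : u ∈ K := ⟨hu, h⟩
    rw [h0] at hmem
    exact hmem
  · have hcont : Continuous fun u : Gate q => hsNorm (dualContraction u - 1) := by
      have h1 : Continuous fun u : Gate q => dualContraction u - 1 :=
        continuous_dualContraction.sub continuous_const
      exact continuous_hsNorm.comp h1
    obtain ⟨u₀, hu₀, hmin⟩ := hKc.exists_isMinOn h0 hcont.continuousOn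
    refine ⟨hsNorm (dualContraction u₀ - 1), ?_, fun u hu hlt => ?_⟩
    · by_contra hle
      have := sub_eq_zero.1 (eq_zero_of_hsNorm_le_zero (not_lt.1 hle))
      refine hu₀.2 ⟨u₀, ⟨hu₀.1, this⟩, ?_⟩
      rw [sub_self]
      simpa [hsNorm] using hε
    · by_contra h
      exact absurd (hmin (⟨hu, h⟩ : u ∈ K)) (not_le.2 hlt)

/-- The swap gate is dual unitary. -/
theorem exists_isDualUnitary (q : ℕ) : ∃ u : Gate q, IsDualUnitary u := by
  refine ⟨Matrix.of fun x y => if x = y.swap then 1 else 0, ?_, ?_⟩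
  · refine Matrix.mem_unitaryGroup_iff.2 ?_
    ext ⟨i, j⟩ ⟨i', j'⟩
    simp [Matrix.mul_apply, Matrix.star_apply, Fintype.sum_prod_type, Matrix.one_apply, ite_and]
  · ext ⟨i, k⟩ ⟨i', k'⟩
    simp [dualContraction, sideways, Matrix.mul_apply, Fintype.sum_prod_type, Matrix.one_apply,
      ite_and, eq_comm]
    split_ifs <;> simp_all

/-- The modulus is the smallest distance that works for all gates of a given velocity, plus `η`
because the smallest distance need not be attained. -/
theorem exists_modulus (hq : 2 < q) :
    ∃ f : ℝ → ℝ, Tendsto f (𝓝[>] 0) (𝓝 0) ∧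
      ∀ η : ℝ, 0 < η → η < 1 →
        ∀ u : Gate q, IsUnitaryGate u → IsEntanglementVelocity u (1 - η) →
          ∃ u' : Gate q, IsDualUnitary u' ∧ traceNorm (u - u') ≤ f η := by
  set S : ℝ → Set ℝ := fun η => {ε : ℝ | 0 ≤ ε ∧ ∀ u : Gate q, IsUnitaryGate u →
    IsEntanglementVelocity u (1 - η) → ∃ u' : Gate q, IsDualUnitary u' ∧ traceNorm (u - u') ≤ ε}
    with hS
  have hbdd : ∀ η, BddBelow (S η) := fun η => ⟨0, fun ε hε => hε.1⟩
  have hne : ∀ η, (S η).Nonempty := by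
    intro η
    obtain ⟨u', hu'⟩ := exists_isDualUnitary q
    refine ⟨Real.sqrt (Fintype.card (Fin q × Fin q)) * (Real.sqrt (Fintype.card (Fin q × Fin q) *
      Fintype.card (Fin q × Fin q)) * 2), by positivity, fun u hu _ => ⟨u', hu', ?_⟩⟩
    refine (traceNorm_le _).trans (mul_le_mul_of_nonneg_left ?_ (by positivity))
    refine hsNorm_le_of_entry_le _ (by norm_num) fun i j => ?_
    refine (norm_sub_le _ _).trans ?_
    have h1 := entry_norm_bound_of_unitary hu i j
    have h2 := entry_norm_bound_of_unitary hu'.1 i j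
    linarith
  -- the velocity bounds the violation of dual unitarity, and compactness then bounds the distance
  have hsmall : ∀ ε : ℝ, 0 < ε → ∃ η₀ : ℝ, 0 < η₀ ∧ ∀ η, 0 < η → η < η₀ → ε ∈ S η := by
    intro ε hε
    have hq' : (0 : ℝ) < q := by exact_mod_cast (show 0 < q by omega)
    have hc : 0 < Real.sqrt (Fintype.card (Fin q × Fin q)) := by
      refine Real.sqrt_pos.2 ?_
      simp only [Fintype.card_prod, Fintype.card_fin, Nat.cast_mul]
      positivity
    obtain ⟨δ, hδ, h⟩ := exists_isDualUnitary_hsNorm_lt (q := q) (div_pos hε hc)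
    set C := Real.sqrt (Fintype.card (Fin q × Fin q) * Fintype.card (Fin q × Fin q)) with hC
    have hC0 : 0 ≤ C := Real.sqrt_nonneg _
    set B := 72 * (q : ℝ) ^ 4 * Real.log q with hB
    have hB0 : 0 < B := by
      have : 0 < Real.log q := Real.log_pos (by exact_mod_cast (show 1 < q by omega))
      positivity
    refine ⟨(δ / (C + 1)) ^ 2 / B, by positivity, fun η hη hlt => ⟨hε.le, fun u hu hv => ?_⟩⟩
    have hsq : Real.sqrt (B * η) < δ / (C + 1) := by
      rw [Real.sqrt_lt' (by positivity)]
      rwa [lt_div_iff₀ hB0, mul_comm] at hlt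
    obtain ⟨u', hu', hd⟩ := h u hu (by
      refine lt_of_le_of_lt (hsNorm_le_of_entry_le (c := Real.sqrt (B * η)) _
        (Real.sqrt_nonneg _) fun p s => Real.le_sqrt_of_sq_le
          (norm_dualContraction_sub_one_sq_le_of_velocity hq.le hu hv p s)) ?_
      calc C * Real.sqrt (B * η) ≤ (C + 1) * Real.sqrt (B * η) := by
            gcongr; linarith
        _ < (C + 1) * (δ / (C + 1)) := by gcongr
        _ = δ := by field_simp)
    refine ⟨u', hu', (traceNorm_le _).trans ?_⟩
    rw [lt_div_iff₀ hc, mul_comm] at hd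
    exact hd.le
  refine ⟨fun η => sInf (S η) + η, ?_, ?_⟩
  · rw [Metric.tendsto_nhdsWithin_nhds]
    intro ε hε
    obtain ⟨η₀, hη₀, h⟩ := hsmall (ε / 2) (by linarith)
    refine ⟨min η₀ (ε / 2), by positivity, fun {η} hη hd => ?_⟩
    have hη : 0 < η := hη
    rw [Real.dist_eq, sub_zero, abs_of_pos hη, lt_min_iff] at hd
    have h1 := csInf_le (hbdd η) (h η hη hd.1)
    have h2 : 0 ≤ sInf (S η) := Real.sInf_nonneg fun ε hε => hε.1
    rw [Real.dist_eq, sub_zero, abs_of_nonneg (by linarith)]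
    linarith
  · intro η hη _ u hu hv
    obtain ⟨ε, hε, hlt⟩ := exists_lt_of_csInf_lt (hne η)
      (show sInf (S η) < sInf (S η) + η by linarith)
    obtain ⟨u', hu', hd⟩ := hε.2 u hu hv
    exact ⟨u', hu', hd.trans hlt.le⟩

end Compactness

/-! ### Diagonalization of symmetric unitary matrices -/

section SymmetricUnitary

variable {n : Type*} [Fintype n] [DecidableEq n]

/-- Commuting real symmetric matrices have a common orthonormal eigenbasis, the columns of `O`. -/
theorem exists_orthogonal_diagonalizing {A B : Matrix n n ℝ} (hA : Aᵀ = A) (hB : Bᵀ = B)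
    (hAB : A * B = B * A) :
    ∃ (O : Matrix n n ℝ) (a b : n → ℝ), Oᵀ * O = 1 ∧ A * O = O * Matrix.diagonal a ∧
      B * O = O * Matrix.diagonal b := by
  have sA : (Matrix.toEuclideanLin A).IsSymmetric :=
    Matrix.isSymmetric_toEuclideanLin_iff.2 (by rw [Matrix.IsHermitian]; simpa using hA)
  have sB : (Matrix.toEuclideanLin B).IsSymmetric :=
    Matrix.isSymmetric_toEuclideanLin_iff.2 (by rw [Matrix.IsHermitian]; simpa using hB)
  have sAB : Commute (Matrix.toEuclideanLin A) (Matrix.toEuclideanLin B) := by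
    refine LinearMap.ext fun v => ?_
    simp only [Module.End.mul_apply, Matrix.toLpLin_apply, Matrix.mulVec_mulVec, hAB]
  have hint := LinearMap.IsSymmetric.directSum_isInternal_of_commute sA sB sAB
  have hort := LinearMap.IsSymmetric.orthogonalFamily_eigenspace_inf_eigenspace sA sB
  have hint' := DirectSum.isInternal_ne_bot_iff.mpr hint
  let _ := iSupIndep.fintypeNeBotOfFiniteDimensional hint.submodule_iSupIndep
  have hort' := hort.comp (γ := {i // Module.End.eigenspace (Matrix.toEuclideanLin A) i.2 ⊓
    Module.End.eigenspace (Matrix.toEuclideanLin B) i.1 ≠ ⊥}) Subtype.coe_injective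
  have hcard : Module.finrank ℝ (EuclideanSpace ℝ n) = Fintype.card n := by simp
  set bs := (hint'.subordinateOrthonormalBasis hcard hort').reindex (Fintype.equivFin n).symm
    with hbs
  have hmem : ∀ j, ∃ i : ℝ × ℝ, bs j ∈ Module.End.eigenspace (Matrix.toEuclideanLin A) i.2 ⊓
      Module.End.eigenspace (Matrix.toEuclideanLin B) i.1 := by
    intro j
    rw [hbs, OrthonormalBasis.reindex_apply]
    exact ⟨_, hint'.subordinateOrthonormalBasis_subordinate hcard _ hort'⟩
  choose i hi using hmem
  refine ⟨Matrix.of fun k j => bs j k, fun j => (i j).2, fun j => (i j).1, ?_, ?_, ?_⟩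
  · ext j k
    have := orthonormal_iff_ite.1 bs.orthonormal j k
    rw [PiLp.inner_apply] at this
    rw [Matrix.one_apply, ← this, Matrix.mul_apply]
    refine Finset.sum_congr rfl fun x _ => ?_
    simp [mul_comm]
  · ext k j
    have h := Module.End.mem_eigenspace_iff.1 (hi j).1
    have h' := congrArg (fun v : EuclideanSpace ℝ n => v k) h
    rw [Matrix.mul_diagonal, Matrix.mul_apply]
    simpa [Matrix.toLpLin_apply, Matrix.mulVec, dotProduct, mul_comm] using h'
  · ext k j
    have h := Module.End.mem_eigenspace_iff.1 (hi j).2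
    have h' := congrArg (fun v : EuclideanSpace ℝ n => v k) h
    rw [Matrix.mul_diagonal, Matrix.mul_apply]
    simpa [Matrix.toLpLin_apply, Matrix.mulVec, dotProduct, mul_comm] using h'

/-- The real and the imaginary part of a symmetric unitary matrix are commuting real symmetric
matrices, so it is diagonalized by a real orthogonal matrix, here regarded as a complex matrix that
is both unitary and orthogonal. -/
theorem exists_orthogonal_diagonalizing_of_symmetric_unitary {S : Matrix n n ℂ} (hS : Sᵀ = S)
    (hU : S * Sᴴ = 1) :
    ∃ (O : Matrix n n ℂ) (d : n → ℂ), Oᵀ * O = 1 ∧ Oᴴ * O = 1 ∧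
      S * O = O * Matrix.diagonal d := by
  have hsym : ∀ i j, S i j = S j i := fun i j => by conv_lhs => rw [← hS, Matrix.transpose_apply]
  have hcomm : S.map Complex.re * S.map Complex.im = S.map Complex.im * S.map Complex.re := by
    ext i j
    have h := congrArg Complex.im (congrFun (congrFun hU i) j)
    have h0 : ((1 : Matrix n n ℂ) i j).im = 0 := by
      rw [Matrix.one_apply]; split_ifs <;> simp
    rw [h0, Matrix.mul_apply, Complex.im_sum] at h
    have e : ∀ k, (S i k * Sᴴ k j).im = (S i k).im * (S k j).re - (S i k).re * (S k j).im := by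
      intro k
      rw [Matrix.conjTranspose_apply, hsym j k]
      simp [Complex.mul_im]
      ring
    simp only [e, Finset.sum_sub_distrib] at h
    simp only [Matrix.mul_apply, Matrix.map_apply]
    linarith
  obtain ⟨O, a, b, hO, ha, hb⟩ := exists_orthogonal_diagonalizing
    (A := S.map Complex.re) (B := S.map Complex.im)
    (by rw [← Matrix.transpose_map, hS]) (by rw [← Matrix.transpose_map, hS]) hcomm
  have hOt : (O.map Complex.ofReal)ᵀ * O.map Complex.ofReal = 1 := by
    have := congrArg (fun M : Matrix n n ℝ => M.map Complex.ofRealHom) hO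
    simp only [Matrix.map_mul, Matrix.map_one _ (map_zero Complex.ofRealHom)
      (map_one Complex.ofRealHom)] at this
    exact this
  refine ⟨O.map Complex.ofReal, fun j => a j + b j * Complex.I, hOt, ?_, ?_⟩
  · rw [← hOt]
    congr 1
    ext i j
    simp
  · ext i j
    have h1 := congrFun (congrFun ha i) j
    have h2 := congrFun (congrFun hb i) j
    rw [Matrix.mul_diagonal, Matrix.mul_apply] at h1 h2
    rw [Matrix.mul_diagonal, Matrix.mul_apply]
    have h3 : ∑ k, S i k * (O.map Complex.ofReal) k j
        = ((∑ k, (S.map Complex.re) i k * O k j : ℝ) : ℂ)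
          + ((∑ k, (S.map Complex.im) i k * O k j : ℝ) : ℂ) * Complex.I := by
      push_cast
      rw [Finset.sum_mul, ← Finset.sum_add_distrib]
      refine Finset.sum_congr rfl fun k _ => ?_
      conv_lhs => rw [← Complex.re_add_im (S i k)]
      simp only [Matrix.map_apply]
      ring
    rw [h3, h1, h2]
    simp only [Matrix.map_apply]
    push_cast
    ring

/-- A unitary matrix is a product of a real orthogonal, a diagonal and a real orthogonal matrix: the
last factor diagonalizes the symmetric unitary matrix `mᵀ * m`, and the first is then forced. -/
theorem exists_orthogonal_mul_diagonal_mul_orthogonal {m : Matrix n n ℂ}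
    (hm : m ∈ Matrix.unitaryGroup n ℂ) :
    ∃ (O₁ O₂ : Matrix n n ℂ) (θ : n → ℝ), O₁ᵀ * O₁ = 1 ∧ O₁ᴴ * O₁ = 1 ∧ O₂ᵀ * O₂ = 1 ∧
      O₂ᴴ * O₂ = 1 ∧ m = O₁ * Matrix.diagonal (fun j => Complex.exp (θ j * Complex.I)) * O₂ᴴ := by
  have hm1 : mᴴ * m = 1 := Matrix.mem_unitaryGroup_iff'.1 hm
  have hm2 : m * mᴴ = 1 := Matrix.mem_unitaryGroup_iff.1 hm
  have hm3 : mᵀ * mᵀᴴ = 1 := by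
    have := congrArg Matrix.transpose hm1
    rwa [Matrix.transpose_mul, Matrix.transpose_one] at this
  obtain ⟨O, d, hO1, hO2, hd⟩ := exists_orthogonal_diagonalizing_of_symmetric_unitary
    (S := mᵀ * m) (by rw [Matrix.transpose_mul, Matrix.transpose_transpose]) (by
      rw [Matrix.conjTranspose_mul, Matrix.mul_assoc, ← Matrix.mul_assoc m, hm2, Matrix.one_mul,
        hm3])
  have hO3 : O * Oᴴ = 1 := mul_eq_one_comm.1 hO2
  have hdiag : Oᵀ * (mᵀ * m) * O = Matrix.diagonal d := by
    rw [Matrix.mul_assoc, hd, ← Matrix.mul_assoc, hO1, Matrix.one_mul]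
  have hdn : ∀ j, ‖d j‖ = 1 := by
    intro j
    -- `d` is the diagonal of a unitary matrix
    have h : (Oᵀ * mᵀ * (m * O))ᴴ * (Oᵀ * mᵀ * (m * O)) = 1 := by
      have e : Oᵀᴴ * Oᵀ = 1 := by
        have := congrArg Matrix.transpose hO3
        rwa [Matrix.transpose_mul, Matrix.transpose_one] at this
      have e' : mᵀᴴ * mᵀ = 1 := mul_eq_one_comm.1 hm3
      have e2 : Oᵀ * Oᵀᴴ = 1 := mul_eq_one_comm.1 e
      simp only [Matrix.conjTranspose_mul]
      calc _ = Oᴴ * (mᴴ * (mᵀᴴ * (Oᵀᴴ * Oᵀ) * mᵀ) * m) * O := by simp only [Matrix.mul_assoc]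
        _ = 1 := by rw [e, Matrix.mul_one, e', Matrix.mul_one, hm1, Matrix.mul_one, hO2]
    rw [show Oᵀ * mᵀ * (m * O) = Matrix.diagonal d by rw [← hdiag]; simp only [Matrix.mul_assoc],
      Matrix.diagonal_conjTranspose, Matrix.diagonal_mul_diagonal] at h
    have h' := congrFun (congrFun h j) j
    rw [Matrix.diagonal_apply_eq, Matrix.one_apply_eq, Pi.star_apply, Complex.star_def,
      Complex.conj_mul'] at h'
    have h'' : ‖d j‖ ^ 2 = 1 := by exact_mod_cast h'
    exact (pow_eq_one_iff_of_nonneg (norm_nonneg _) two_ne_zero).1 h''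
  choose θ hθ using fun j => (Complex.norm_eq_one_iff (d j)).1 (hdn j)
  -- a square root `Δ` of the diagonal part, and its inverse `Δ'`; the first factor is `m * O * Δ'`
  set Δ : Matrix n n ℂ := Matrix.diagonal (fun j => Complex.exp ((θ j / 2 : ℝ) * Complex.I)) with hΔ
  set Δ' : Matrix n n ℂ := Matrix.diagonal (fun j => Complex.exp (-((θ j / 2 : ℝ) * Complex.I)))
    with hΔ'
  have h1 : Δ' * Δ = 1 := by
    rw [hΔ, hΔ', Matrix.diagonal_mul_diagonal, ← Matrix.diagonal_one]
    congr 1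
    ext j
    rw [← Complex.exp_add]
    simp
  have h2 : Δ' * Matrix.diagonal d * Δ' = 1 := by
    rw [hΔ', Matrix.diagonal_mul_diagonal, Matrix.diagonal_mul_diagonal, ← Matrix.diagonal_one]
    congr 1
    ext j
    rw [← hθ, ← Complex.exp_add, ← Complex.exp_add]
    rw [show -(((θ j / 2 : ℝ) : ℂ) * Complex.I) + θ j * Complex.I
      + -(((θ j / 2 : ℝ) : ℂ) * Complex.I) = 0 by push_cast; ring, Complex.exp_zero]
  have h3 : Δ'ᴴ * Δ' = 1 := by
    rw [hΔ', Matrix.diagonal_conjTranspose, Matrix.diagonal_mul_diagonal, ← Matrix.diagonal_one]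
    congr 1
    ext j
    rw [Pi.star_apply, Complex.star_def, Complex.conj_mul']
    rw [← neg_mul, ← Complex.ofReal_neg, Complex.norm_exp_ofReal_mul_I]
    simp
  have h4 : Δ'ᵀ = Δ' := Matrix.diagonal_transpose _
  refine ⟨m * O * Δ', O, fun j => θ j / 2, ?_, ?_, hO1, hO2, ?_⟩
  · rw [Matrix.transpose_mul, Matrix.transpose_mul, h4, ← h2, ← hdiag]
    simp only [Matrix.mul_assoc]
  · rw [Matrix.conjTranspose_mul, Matrix.conjTranspose_mul]
    calc _ = Δ'ᴴ * (Oᴴ * (mᴴ * m) * O) * Δ' := by simp only [Matrix.mul_assoc]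
      _ = 1 := by rw [hm1, Matrix.mul_one, hO2, Matrix.mul_one, h3]
  · calc m = m * (O * (Δ' * Δ) * Oᴴ) := by rw [h1, Matrix.mul_one, hO3, Matrix.mul_one]
      _ = _ := by simp only [Matrix.mul_assoc, hΔ]

end SymmetricUnitary

/-! ### Canonical form of two-qubit gates -/

section Canonical

open scoped Kronecker

/-- The gate `[[p, 0, 0, r], [0, s, t, 0], [0, t, s, 0], [r, 0, 0, p]]`, that is, an operator
diagonal in the Bell basis. -/
def bellGate (p r s t : ℂ) : Gate 2 :=
  Matrix.of fun x y =>
    if x = y then (if x.1 = x.2 then p else s)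
    else if x.1 ≠ y.1 ∧ x.2 ≠ y.2 then (if x.1 = x.2 then r else t) else 0

/-- The swap of two qubits. -/
def swapGate : Gate 2 := Matrix.of fun x y => if x = y.swap then 1 else 0

/-- The symmetric form on `ℂ² ⊗ ℂ²` whose quadratic form is twice the determinant; it is the
square of the antisymmetric form on `ℂ²`. -/
def detForm : Gate 2 :=
  (!![0, 1; -1, 0] : Matrix (Fin 2) (Fin 2) ℂ) ⊗ₖ (!![0, 1; -1, 0] : Matrix (Fin 2) (Fin 2) ℂ)

/-- The change to the magic basis, the Bell basis with phases for which `detForm` becomes the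
standard symmetric form. -/
noncomputable def magic : Gate 2 :=
  Matrix.of fun x y => ((Real.sqrt 2)⁻¹ : ℂ) *
    (if y = (0, 0) then (if x.1 = x.2 then 1 else 0)
    else if y = (1, 1) then (if x = (0, 0) then Complex.I else if x = (1, 1) then -Complex.I else 0)
    else if y = (0, 1) then (if x.1 = x.2 then 0 else Complex.I)
    else (if x = (0, 1) then 1 else if x = (1, 0) then -1 else 0))

theorem inv_sqrt_two_mul_self : ((Real.sqrt 2)⁻¹ : ℂ) * ((Real.sqrt 2)⁻¹ : ℂ) = 1 / 2 := by
  have := norm_inv_sqrt_mul_self (q := 2) (by norm_num)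
  push_cast at this
  rw [this]
  norm_num

theorem magic_conjTranspose_mul : magicᴴ * magic = 1 := by
  have h := inv_sqrt_two_mul_self
  have hs : star ((Real.sqrt 2 : ℂ)⁻¹) = (Real.sqrt 2 : ℂ)⁻¹ := by rw [star_inv₀]; simp
  unfold magic
  set c : ℂ := (Real.sqrt 2 : ℂ)⁻¹
  ext ⟨i, j⟩ ⟨k, l⟩
  simp only [Matrix.mul_apply, Matrix.conjTranspose_apply, Matrix.of_apply,
    Fintype.sum_prod_type, Fin.sum_univ_two, star_mul', hs]
  fin_cases i <;> fin_cases j <;> fin_cases k <;> fin_cases l <;>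
    simp <;> first | ring1 | linear_combination 2 * h |
      linear_combination (-2 * c * c) * Complex.I_mul_I + 2 * h

theorem magic_mul_transpose : magic * magicᵀ = detForm := by
  have h := inv_sqrt_two_mul_self
  unfold magic detForm
  set c : ℂ := (Real.sqrt 2 : ℂ)⁻¹
  have h2 : c ^ 2 = 1 / 2 := by rw [sq, h]
  ext ⟨i, j⟩ ⟨k, l⟩
  simp only [Matrix.mul_apply, Matrix.transpose_apply, Matrix.of_apply,
    Fintype.sum_prod_type, Fin.sum_univ_two]
  fin_cases i <;> fin_cases j <;> fin_cases k <;> fin_cases l <;>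
    simp <;> ring_nf <;> simp [Complex.I_sq, h2] <;> ring

theorem magic_mul_diagonal_mul (d : Fin 2 × Fin 2 → ℂ) :
    magic * Matrix.diagonal d * magicᴴ = bellGate ((d (0, 0) + d (1, 1)) / 2)
      ((d (0, 0) - d (1, 1)) / 2) ((d (0, 1) + d (1, 0)) / 2) ((d (0, 1) - d (1, 0)) / 2) := by
  have h := inv_sqrt_two_mul_self
  have hs : star ((Real.sqrt 2 : ℂ)⁻¹) = (Real.sqrt 2 : ℂ)⁻¹ := by rw [star_inv₀]; simp
  unfold magic bellGate
  set c : ℂ := (Real.sqrt 2 : ℂ)⁻¹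
  have h2 : c ^ 2 = 1 / 2 := by rw [sq, h]
  ext ⟨i, j⟩ ⟨k, l⟩
  simp only [Matrix.mul_apply, Matrix.conjTranspose_apply, Matrix.of_apply,
    Fintype.sum_prod_type, Fin.sum_univ_two, star_mul', hs]
  fin_cases i <;> fin_cases j <;> fin_cases k <;> fin_cases l <;>
    simp <;> ring_nf <;> simp [Complex.I_sq, h2] <;> ring

/-- A vector of `ℂ² ⊗ ℂ²` with vanishing determinant is a product of unit vectors. -/
theorem exists_product_of_det_eq_zero {X : Fin 2 × Fin 2 → ℂ}
    (hdet : X (0, 0) * X (1, 1) = X (0, 1) * X (1, 0)) (hX : ∑ x, ‖X x‖ ^ 2 = 1) :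
    ∃ α β : Fin 2 → ℂ, ∑ i, ‖α i‖ ^ 2 = 1 ∧ ∑ j, ‖β j‖ ^ 2 = 1 ∧
      ∀ i j, X (i, j) = α i * β j := by
  have hminor : ∀ i i' j j', X (i, j) * X (i', j') = X (i, j') * X (i', j) := by
    intro i i' j j'
    fin_cases i <;> fin_cases i' <;> fin_cases j <;> fin_cases j' <;> simp <;>
      first | ring1 | linear_combination hdet | linear_combination -hdet
  -- some row is nonzero; all rows are multiples of its normalization `β`
  obtain ⟨i₀, hi₀⟩ : ∃ i, 0 < ∑ j, ‖X (i, j)‖ ^ 2 := by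
    by_contra! h
    rw [Fintype.sum_prod_type] at hX
    have := Finset.sum_nonpos fun i (_ : i ∈ Finset.univ) => h i
    linarith
  set N := ∑ j, ‖X (i₀, j)‖ ^ 2 with hN
  set c : ℝ := (Real.sqrt N)⁻¹ with hc
  have hc2 : c ^ 2 * N = 1 := by
    rw [hc, inv_pow, Real.sq_sqrt hi₀.le, inv_mul_cancel₀ hi₀.ne']
  have hβ : ∑ j, ‖(c : ℂ) * X (i₀, j)‖ ^ 2 = 1 := by
    simp only [norm_mul, mul_pow, Complex.norm_real, Real.norm_eq_abs, sq_abs, ← Finset.mul_sum]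
    exact hc2
  have hprod : ∀ i j, X (i, j)
      = (∑ k, X (i, k) * star ((c : ℂ) * X (i₀, k))) * ((c : ℂ) * X (i₀, j)) := by
    intro i j
    rw [Finset.sum_mul]
    have e : ∀ k, X (i, k) * star ((c : ℂ) * X (i₀, k)) * ((c : ℂ) * X (i₀, j))
        = ((c ^ 2 * ‖X (i₀, k)‖ ^ 2 : ℝ) : ℂ) * X (i, j) := by
      intro k
      push_cast
      rw [← Complex.conj_mul', star_mul', Complex.star_def, Complex.conj_ofReal, ← Complex.star_def]
      linear_combination (c : ℂ) ^ 2 * star (X (i₀, k)) * hminor i i₀ k j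
    simp only [e, ← Finset.sum_mul, ← Complex.ofReal_sum, ← Finset.mul_sum]
    rw [← hN, hc2]
    simp
  refine ⟨fun i => ∑ k, X (i, k) * star ((c : ℂ) * X (i₀, k)), fun j => (c : ℂ) * X (i₀, j),
    ?_, hβ, hprod⟩
  have h1 : ∑ x, ‖X x‖ ^ 2 = ∑ i, ‖∑ k, X (i, k) * star ((c : ℂ) * X (i₀, k))‖ ^ 2 := by
    rw [Fintype.sum_prod_type]
    refine Finset.sum_congr rfl fun i _ => ?_
    calc ∑ j, ‖X (i, j)‖ ^ 2
        = ∑ j, ‖∑ k, X (i, k) * star ((c : ℂ) * X (i₀, k))‖ ^ 2 * ‖(c : ℂ) * X (i₀, j)‖ ^ 2 := by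
          refine Finset.sum_congr rfl fun j _ => ?_
          conv_lhs => rw [hprod i j, norm_mul, mul_pow]
      _ = _ := by rw [← Finset.mul_sum, hβ, mul_one]
  rw [← h1, hX]

/-- The matrix in `SU(2)` with first column the unit vector `α`. -/
def su2 (α : Fin 2 → ℂ) : Matrix (Fin 2) (Fin 2) ℂ := !![α 0, -star (α 1); α 1, star (α 0)]

theorem su2_conjTranspose_mul {α : Fin 2 → ℂ} (hα : ∑ i, ‖α i‖ ^ 2 = 1) :
    (su2 α)ᴴ * su2 α = 1 := by
  have h : (starRingEnd ℂ) (α 0) * α 0 + (starRingEnd ℂ) (α 1) * α 1 = 1 := by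
    rw [Fin.sum_univ_two] at hα
    rw [Complex.conj_mul', Complex.conj_mul']
    exact_mod_cast hα
  ext i j
  fin_cases i <;> fin_cases j <;> simp [su2, Matrix.mul_apply, Fin.sum_univ_two] <;>
    first | ring1 | linear_combination h

/-- Matrices of determinant one preserve the antisymmetric form. -/
theorem su2_transpose_mul {α : Fin 2 → ℂ} (hα : ∑ i, ‖α i‖ ^ 2 = 1) :
    (su2 α)ᵀ * (!![0, 1; -1, 0] : Matrix (Fin 2) (Fin 2) ℂ) * su2 α = !![0, 1; -1, 0] := by
  have h : (starRingEnd ℂ) (α 0) * α 0 + (starRingEnd ℂ) (α 1) * α 1 = 1 := by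
    rw [Fin.sum_univ_two] at hα
    rw [Complex.conj_mul', Complex.conj_mul']
    exact_mod_cast hα
  ext i j
  fin_cases i <;> fin_cases j <;> simp [su2, Matrix.mul_apply, Fin.sum_univ_two] <;>
    first | ring1 | linear_combination h | linear_combination -h

theorem kronecker_conjTranspose_mul_eq_one {a b : Matrix (Fin 2) (Fin 2) ℂ} (ha : aᴴ * a = 1)
    (hb : bᴴ * b = 1) : (a ⊗ₖ b)ᴴ * (a ⊗ₖ b) = 1 := by
  rw [Matrix.conjTranspose_kronecker, ← Matrix.mul_kronecker_mul, ha, hb, Matrix.one_kronecker_one]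

theorem diag_conjTranspose_mul_eq_one {x : ℂ} (hx : ‖x‖ = 1) :
    (Matrix.diagonal ![1, x])ᴴ * Matrix.diagonal ![1, x] = 1 := by
  have h : (starRingEnd ℂ) x * x = 1 := by rw [Complex.conj_mul', hx]; simp
  ext i j
  fin_cases i <;> fin_cases j <;> simp [h]

theorem eq_zero_of_sum_norm_sq_eq_one {ι : Type*} [Fintype ι] [DecidableEq ι] {v : ι → ℂ} {i₀ : ι}
    (hv : ∑ i, ‖v i‖ ^ 2 = 1) (h : v i₀ = 1) {i : ι} (hi : i ≠ i₀) : v i = 0 := by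
  rw [← Finset.add_sum_erase _ _ (Finset.mem_univ i₀), h, norm_one, one_pow] at hv
  have h0 : ∑ x ∈ Finset.univ.erase i₀, ‖v x‖ ^ 2 = 0 := by linarith
  rw [Finset.sum_eq_zero_iff_of_nonneg fun _ _ => by positivity] at h0
  simpa using h0 i (by simp [hi])

/-- A unitary that preserves the determinant form maps product vectors to product vectors, and
is therefore local up to a swap. -/
theorem exists_local_of_detForm {g : Gate 2} (hg : gᴴ * g = 1) (hJ : gᵀ * detForm * g = detForm) :
    ∃ a b : Matrix (Fin 2) (Fin 2) ℂ, aᴴ * a = 1 ∧ bᴴ * b = 1 ∧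
      (g = a ⊗ₖ b ∨ g = (a ⊗ₖ b) * swapGate) := by
  have hform : ∀ (h : Gate 2), hᵀ * detForm * h = detForm → ∀ x y,
      h (0, 0) x * h (1, 1) y + h (1, 1) x * h (0, 0) y - h (0, 1) x * h (1, 0) y
        - h (1, 0) x * h (0, 1) y = detForm x y := by
    intro h hh x y
    rw [← hh]
    simp [Matrix.mul_apply, Fintype.sum_prod_type, Fin.sum_univ_two, detForm]
    ring
  have hcol : ∀ (h : Gate 2), hᴴ * h = 1 → ∀ y, ∑ x, ‖h x y‖ ^ 2 = 1 := by
    intro h hh y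
    have := sum_norm_sq_row_of_mul_conjTranspose_eq_one
      (Z := hᴴ) (by rwa [Matrix.conjTranspose_conjTranspose]) y
    simpa using this
  obtain ⟨α, β, hα, hβ, hprod⟩ := exists_product_of_det_eq_zero
    (X := fun x => g x (0, 0)) (by
      have := hform g hJ (0, 0) (0, 0)
      simp [detForm] at this
      linear_combination this / 2) (hcol g hg (0, 0))
  -- rotate the image of `|00⟩` back to `|00⟩`
  set W := su2 α ⊗ₖ su2 β with hW
  have hW1 : Wᴴ * W = 1 :=
    kronecker_conjTranspose_mul_eq_one (su2_conjTranspose_mul hα) (su2_conjTranspose_mul hβ)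
  have hW2 : W * Wᴴ = 1 := mul_eq_one_comm.1 hW1
  have hWJ : Wᵀ * detForm * W = detForm := by
    rw [hW, detForm, ← Matrix.kroneckerMap_transpose, ← Matrix.mul_kronecker_mul,
      ← Matrix.mul_kronecker_mul, su2_transpose_mul hα, su2_transpose_mul hβ]
  set h := Wᴴ * g with hh
  have hg' : g = W * h := by rw [hh, ← Matrix.mul_assoc, hW2, Matrix.one_mul]
  have hh1 : hᴴ * h = 1 := by
    rw [hh, Matrix.conjTranspose_mul, Matrix.conjTranspose_conjTranspose, Matrix.mul_assoc,
      ← Matrix.mul_assoc W, hW2, Matrix.one_mul, hg]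
  have hh2 : h * hᴴ = 1 := mul_eq_one_comm.1 hh1
  have hhJ : hᵀ * detForm * h = detForm := by
    calc hᵀ * detForm * h = hᵀ * (Wᵀ * detForm * W) * h := by rw [hWJ]
      _ = (W * h)ᵀ * detForm * (W * h) := by
        rw [Matrix.transpose_mul W h]; simp only [Matrix.mul_assoc]
      _ = detForm := by rw [← hg', hJ]
  have hrow := sum_norm_sq_row_of_mul_conjTranspose_eq_one hh2
  have hc := hcol h hh1
  have hf := hform h hhJ
  have h00 : ∀ x, h x (0, 0) = (1 : Gate 2) x (0, 0) := by
    intro x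
    rw [← hW1, hh, Matrix.mul_apply, Matrix.mul_apply]
    refine Finset.sum_congr rfl fun y _ => ?_
    have e : g y (0, 0) = W y (0, 0) := by
      obtain ⟨i, j⟩ := y
      rw [hprod i j, hW]
      fin_cases i <;> fin_cases j <;> simp [su2]
    rw [e]
  have h0 : h (0, 0) (0, 0) = 1 := by simp [h00]
  have r1 : h (0, 0) (0, 1) = 0 := eq_zero_of_sum_norm_sq_eq_one (hrow (0, 0)) h0 (by simp)
  have r2 : h (0, 0) (1, 0) = 0 := eq_zero_of_sum_norm_sq_eq_one (hrow (0, 0)) h0 (by simp)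
  have r3 : h (0, 0) (1, 1) = 0 := eq_zero_of_sum_norm_sq_eq_one (hrow (0, 0)) h0 (by simp)
  have z1 : h (0, 1) (0, 0) = 0 := by simp [h00]
  have z2 : h (1, 0) (0, 0) = 0 := by simp [h00]
  have z3 : h (1, 1) (0, 0) = 0 := by simp [h00]
  have s1 : h (1, 1) (0, 1) = 0 := by
    simpa [detForm, h0, z1, z2, z3] using hf (0, 0) (0, 1)
  have s2 : h (1, 1) (1, 0) = 0 := by
    simpa [detForm, h0, z1, z2, z3] using hf (0, 0) (1, 0)
  have s3 : h (1, 1) (1, 1) = 1 := by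
    simpa [detForm, h0, z1, z2, z3] using hf (0, 0) (1, 1)
  have t1 : h (0, 1) (1, 1) = 0 :=
    eq_zero_of_sum_norm_sq_eq_one (v := fun x => h x (1, 1)) (hc (1, 1)) s3 (by simp)
  have t2 : h (1, 0) (1, 1) = 0 :=
    eq_zero_of_sum_norm_sq_eq_one (v := fun x => h x (1, 1)) (hc (1, 1)) s3 (by simp)
  have q1 : h (0, 1) (0, 1) * h (1, 0) (0, 1) = 0 := by
    have := hf (0, 1) (0, 1)
    simp [detForm, r1, s1] at this
    linear_combination -this / 2
  have q2 : h (0, 1) (1, 0) * h (1, 0) (1, 0) = 0 := by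
    have := hf (1, 0) (1, 0)
    simp [detForm, r2, s2] at this
    linear_combination -this / 2
  have q3 : h (0, 1) (0, 1) * h (1, 0) (1, 0) + h (1, 0) (0, 1) * h (0, 1) (1, 0) = 1 := by
    have := hf (0, 1) (1, 0)
    simp [detForm, r1, r2, s1, s2] at this
    linear_combination -this
  have n1 := hc (0, 1)
  have n2 := hc (1, 0)
  simp only [Fintype.sum_prod_type, Fin.sum_univ_two, r1, r2, s1, s2, norm_zero] at n1 n2
  have hsplit : ∀ x w : ℂ, ‖x‖ = 1 → ‖w‖ = 1 → ∃ a b : Matrix (Fin 2) (Fin 2) ℂ,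
      aᴴ * a = 1 ∧ bᴴ * b = 1 ∧
        W * (Matrix.diagonal ![1, w] ⊗ₖ Matrix.diagonal ![1, x]) = a ⊗ₖ b := by
    intro x w hx hw
    refine ⟨su2 α * Matrix.diagonal ![1, w], su2 β * Matrix.diagonal ![1, x], ?_, ?_, ?_⟩
    · rw [Matrix.conjTranspose_mul, Matrix.mul_assoc, ← Matrix.mul_assoc (su2 α)ᴴ,
        su2_conjTranspose_mul hα, Matrix.one_mul, diag_conjTranspose_mul_eq_one hw]
    · rw [Matrix.conjTranspose_mul, Matrix.mul_assoc, ← Matrix.mul_assoc (su2 β)ᴴ,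
        su2_conjTranspose_mul hβ, Matrix.one_mul, diag_conjTranspose_mul_eq_one hx]
    · rw [hW, ← Matrix.mul_kronecker_mul]
  have hone : ∀ x : ℂ, ‖x‖ ^ 2 = 1 → ‖x‖ = 1 := fun x hx =>
    (pow_eq_one_iff_of_nonneg (norm_nonneg _) two_ne_zero).1 hx
  rcases mul_eq_zero.1 q1 with hx | hy
  · -- `|01⟩` and `|10⟩` are exchanged
    rw [hx, zero_mul, zero_add] at q3
    have hw : h (1, 0) (1, 0) = 0 := by
      rcases mul_eq_zero.1 q2 with h' | h'
      · simp [h'] at q3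
      · exact h'
    rw [hx] at n1
    rw [hw] at n2
    obtain ⟨a, b, ha, hb, hab⟩ := hsplit (h (0, 1) (1, 0)) (h (1, 0) (0, 1))
      (hone _ (by simpa using n2)) (hone _ (by simpa using n1))
    refine ⟨a, b, ha, hb, Or.inr ?_⟩
    rw [← hab, hg', Matrix.mul_assoc]
    congr 1
    ext ⟨i, j⟩ ⟨k, l⟩
    fin_cases i <;> fin_cases j <;> fin_cases k <;> fin_cases l <;>
      simp [swapGate, Matrix.mul_apply, h0, r1, r2, r3, z1, z2, z3, s1, s2, s3, t1, t2, hx, hw, q3]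
  · rw [hy, zero_mul, add_zero] at q3
    have hz : h (0, 1) (1, 0) = 0 := by
      rcases mul_eq_zero.1 q2 with h' | h'
      · exact h'
      · simp [h'] at q3
    rw [hy] at n1
    rw [hz] at n2
    obtain ⟨a, b, ha, hb, hab⟩ := hsplit (h (0, 1) (0, 1)) (h (1, 0) (1, 0))
      (hone _ (by simpa using n1)) (hone _ (by simpa using n2))
    refine ⟨a, b, ha, hb, Or.inl ?_⟩
    rw [← hab, hg']
    congr 1
    have q3' := (mul_comm _ _).trans q3
    ext ⟨i, j⟩ ⟨k, l⟩
    fin_cases i <;> fin_cases j <;> fin_cases k <;> fin_cases l <;>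
      simp [h0, r1, r2, r3, z1, z2, z3, s1, s2, s3, t1, t2, hy, hz, q3']

theorem swapGate_mul_bellGate (p r s t : ℂ) :
    swapGate * bellGate p r s t = bellGate p r t s := by
  ext ⟨i, j⟩ ⟨k, l⟩
  fin_cases i <;> fin_cases j <;> fin_cases k <;> fin_cases l <;>
    simp [swapGate, bellGate, Matrix.mul_apply, Fintype.sum_prod_type]

theorem bellGate_mul_swapGate (p r s t : ℂ) :
    bellGate p r s t * swapGate = bellGate p r t s := by
  ext ⟨i, j⟩ ⟨k, l⟩
  fin_cases i <;> fin_cases j <;> fin_cases k <;> fin_cases l <;>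
    simp [swapGate, bellGate, Matrix.mul_apply]

theorem swapGate_conjTranspose : swapGateᴴ = swapGate := by
  ext ⟨i, j⟩ ⟨k, l⟩
  fin_cases i <;> fin_cases j <;> fin_cases k <;> fin_cases l <;> simp [swapGate]

/-- A real orthogonal matrix in the magic basis is a gate that preserves `detForm`, hence local up to
a swap. -/
theorem exists_local_of_orthogonal {O : Gate 2} (hO : Oᵀ * O = 1) (hO' : Oᴴ * O = 1) :
    ∃ a b : Matrix (Fin 2) (Fin 2) ℂ, aᴴ * a = 1 ∧ bᴴ * b = 1 ∧
      (magic * O * magicᴴ = a ⊗ₖ b ∨ magic * O * magicᴴ = (a ⊗ₖ b) * swapGate) := by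
  have h1 := magic_conjTranspose_mul
  have h2 : magic * magicᴴ = 1 := mul_eq_one_comm.1 h1
  have h3 : magicᵀ * magicᴴᵀ = 1 := by
    have := congrArg Matrix.transpose h1
    rwa [Matrix.transpose_mul, Matrix.transpose_one] at this
  have h4 : magicᴴᵀ * magicᴴ = detForm := by
    have := congrArg Matrix.conjTranspose magic_mul_transpose
    rw [Matrix.conjTranspose_mul] at this
    rw [show magicᴴᵀ = magicᵀᴴ from rfl, this]
    ext ⟨i, j⟩ ⟨k, l⟩
    fin_cases i <;> fin_cases j <;> fin_cases k <;> fin_cases l <;> simp [detForm]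
  refine exists_local_of_detForm ?_ ?_
  · simp only [Matrix.conjTranspose_mul, Matrix.conjTranspose_conjTranspose]
    calc magic * (Oᴴ * magicᴴ) * (magic * O * magicᴴ)
        = magic * (Oᴴ * (magicᴴ * magic) * O) * magicᴴ := by simp only [Matrix.mul_assoc]
      _ = 1 := by rw [h1, Matrix.mul_one, hO', Matrix.mul_one, h2]
  · rw [← h4]
    simp only [Matrix.transpose_mul]
    calc magicᴴᵀ * (Oᵀ * magicᵀ) * (magicᴴᵀ * magicᴴ) * (magic * O * magicᴴ)
        = magicᴴᵀ * (Oᵀ * (magicᵀ * magicᴴᵀ) * (magicᴴ * magic) * O) * magicᴴ := by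
          simp only [Matrix.mul_assoc]
      _ = _ := by rw [h1, h3, Matrix.mul_one, Matrix.mul_one, hO, Matrix.mul_one]

/-- The canonical two-qubit gate.  On the even subspace it has eigenvalues `z (C ± i S)` and on the
odd subspace `w (C' ± i S')`; it is used with phases `z`, `w` and with `(C, S)` and `(C', S')` on the
unit circle, that is, as cosines and sines. -/
noncomputable def canonicalGate (z w : ℂ) (C S C' S' : ℝ) : Gate 2 :=
  bellGate (z * C) (Complex.I * z * S) (w * C') (Complex.I * w * S')

theorem half_sum_exp (A B : ℝ) :
    (Complex.exp (A * Complex.I) + Complex.exp (B * Complex.I)) / 2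
      = Complex.exp (((A + B) / 2 : ℝ) * Complex.I) * (Real.cos ((A - B) / 2) : ℝ) := by
  rw [Complex.ofReal_cos, Complex.cos, mul_div_assoc', mul_add, ← Complex.exp_add,
    ← Complex.exp_add]
  congr 3 <;> push_cast <;> ring_nf

theorem half_sub_exp (A B : ℝ) :
    (Complex.exp (A * Complex.I) - Complex.exp (B * Complex.I)) / 2
      = Complex.I * Complex.exp (((A + B) / 2 : ℝ) * Complex.I) * (Real.sin ((A - B) / 2) : ℝ) := by
  rw [Complex.ofReal_sin, Complex.sin]
  have h : Complex.I * Complex.exp (((A + B) / 2 : ℝ) * Complex.I) *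
      ((Complex.exp (-(((A - B) / 2 : ℝ) : ℂ) * Complex.I)
        - Complex.exp ((((A - B) / 2 : ℝ) : ℂ) * Complex.I)) * Complex.I / 2)
      = (Complex.exp (((A + B) / 2 : ℝ) * Complex.I) *
        Complex.exp ((((A - B) / 2 : ℝ) : ℂ) * Complex.I)
        - Complex.exp (((A + B) / 2 : ℝ) * Complex.I) *
          Complex.exp (-(((A - B) / 2 : ℝ) : ℂ) * Complex.I)) / 2 := by
    linear_combination (Complex.exp (((A + B) / 2 : ℝ) * Complex.I) *
      (Complex.exp (-(((A - B) / 2 : ℝ) : ℂ) * Complex.I)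
        - Complex.exp ((((A - B) / 2 : ℝ) : ℂ) * Complex.I)) / 2) * Complex.I_mul_I
  rw [h, ← Complex.exp_add, ← Complex.exp_add]
  congr 3 <;> push_cast <;> ring_nf

/-- The swap exchanges the cosine and the sine on the odd subspace, up to phases. -/
theorem swap_canonicalGate (z w : ℂ) (C S C' S' : ℝ) :
    bellGate (z * C) (Complex.I * z * S) (Complex.I * w * S') (w * C')
      = canonicalGate z (Complex.I * w) C S S' (-C') := by
  rw [canonicalGate]
  congr 1
  push_cast
  linear_combination (w * C') * Complex.I_mul_I

/-- The Cartan decomposition of two-qubit gates: up to local unitaries on both sides, a gate is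
diagonal in the Bell basis. -/
theorem exists_canonical_form {u : Gate 2} (hu : IsUnitaryGate u) :
    ∃ (a b c d : Matrix (Fin 2) (Fin 2) ℂ) (z w : ℂ) (C S C' S' : ℝ),
      aᴴ * a = 1 ∧ bᴴ * b = 1 ∧ cᴴ * c = 1 ∧ dᴴ * d = 1 ∧ ‖z‖ = 1 ∧ ‖w‖ = 1 ∧
      C ^ 2 + S ^ 2 = 1 ∧ C' ^ 2 + S' ^ 2 = 1 ∧
      u = (a ⊗ₖ b) * canonicalGate z w C S C' S' * (c ⊗ₖ d) := by
  have h1 := magic_conjTranspose_mul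
  have h2 : magic * magicᴴ = 1 := mul_eq_one_comm.1 h1
  have hu1 : uᴴ * u = 1 := Matrix.mem_unitaryGroup_iff'.1 hu
  obtain ⟨O₁, O₂, θ, hO1, hO1', hO2, hO2', hm⟩ := exists_orthogonal_mul_diagonal_mul_orthogonal
    (m := magicᴴ * u * magic) (by
      refine Matrix.mem_unitaryGroup_iff'.2 ?_
      rw [Matrix.star_eq_conjTranspose]
      simp only [Matrix.conjTranspose_mul, Matrix.conjTranspose_conjTranspose]
      calc magicᴴ * (uᴴ * magic) * (magicᴴ * u * magic)
          = magicᴴ * (uᴴ * (magic * magicᴴ) * u) * magic := by simp only [Matrix.mul_assoc]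
        _ = 1 := by rw [h2, Matrix.mul_one, hu1, Matrix.mul_one, h1])
  obtain ⟨a, b, ha, hb, hab⟩ := exists_local_of_orthogonal hO1 hO1'
  obtain ⟨c, d, hc, hd, hcd⟩ := exists_local_of_orthogonal hO2 hO2'
  have hc2 : cᴴᴴ * cᴴ = 1 := by rw [Matrix.conjTranspose_conjTranspose]; exact mul_eq_one_comm.1 hc
  have hd2 : dᴴᴴ * dᴴ = 1 := by rw [Matrix.conjTranspose_conjTranspose]; exact mul_eq_one_comm.1 hd
  set Δ : Gate 2 := Matrix.diagonal (fun j => Complex.exp (θ j * Complex.I)) with hΔ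
  have hsplit : u = (magic * O₁ * magicᴴ) * (magic * Δ * magicᴴ) * (magic * O₂ * magicᴴ)ᴴ := by
    calc u = (magic * magicᴴ) * u * (magic * magicᴴ) := by
          rw [h2, Matrix.one_mul, Matrix.mul_one]
      _ = magic * (magicᴴ * u * magic) * magicᴴ := by simp only [Matrix.mul_assoc]
      _ = magic * O₁ * (magicᴴ * magic) * Δ * (magicᴴ * magic) * O₂ᴴ * magicᴴ := by
          rw [hm, h1]; simp only [Matrix.mul_assoc, Matrix.one_mul]
      _ = _ := by
          simp only [Matrix.conjTranspose_mul, Matrix.conjTranspose_conjTranspose,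
            Matrix.mul_assoc]
  set z := Complex.exp (((θ (0, 0) + θ (1, 1)) / 2 : ℝ) * Complex.I) with hz
  set w := Complex.exp (((θ (0, 1) + θ (1, 0)) / 2 : ℝ) * Complex.I) with hw
  have hz1 : ‖z‖ = 1 := Complex.norm_exp_ofReal_mul_I _
  have hw1 : ‖w‖ = 1 := Complex.norm_exp_ofReal_mul_I _
  have hIw : ‖Complex.I * w‖ = 1 := by rw [norm_mul, hw1, Complex.norm_I, one_mul]
  set C := Real.cos ((θ (0, 0) - θ (1, 1)) / 2)
  set S := Real.sin ((θ (0, 0) - θ (1, 1)) / 2)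
  set C' := Real.cos ((θ (0, 1) - θ (1, 0)) / 2)
  set S' := Real.sin ((θ (0, 1) - θ (1, 0)) / 2)
  have hCS : C ^ 2 + S ^ 2 = 1 := Real.cos_sq_add_sin_sq _
  have hCS' : C' ^ 2 + S' ^ 2 = 1 := Real.cos_sq_add_sin_sq _
  have hCS'' : S' ^ 2 + (-C') ^ 2 = 1 := by linarith
  have hbell : magic * Δ * magicᴴ = bellGate (z * C) (Complex.I * z * S) (w * C')
      (Complex.I * w * S') := by
    rw [hΔ, magic_mul_diagonal_mul, half_sum_exp, half_sub_exp, half_sum_exp, half_sub_exp]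
  rw [hbell] at hsplit
  -- swaps on either side are absorbed by the gate in the middle
  rcases hab with hab | hab <;> rcases hcd with hcd | hcd
  · refine ⟨a, b, cᴴ, dᴴ, z, w, C, S, C', S', ha, hb, hc2, hd2, hz1, hw1, hCS, hCS', ?_⟩
    rw [hsplit, hab, hcd, Matrix.conjTranspose_kronecker]
    rfl
  · refine ⟨a, b, cᴴ, dᴴ, z, Complex.I * w, C, S, S', -C', ha, hb, hc2, hd2, hz1, hIw, hCS,
      hCS'', ?_⟩
    rw [hsplit, hab, hcd, Matrix.conjTranspose_mul, swapGate_conjTranspose,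
      Matrix.conjTranspose_kronecker, ← Matrix.mul_assoc, Matrix.mul_assoc (a ⊗ₖ b),
      bellGate_mul_swapGate, swap_canonicalGate]
  · refine ⟨a, b, cᴴ, dᴴ, z, Complex.I * w, C, S, S', -C', ha, hb, hc2, hd2, hz1, hIw, hCS,
      hCS'', ?_⟩
    rw [hsplit, hab, hcd, Matrix.conjTranspose_kronecker, Matrix.mul_assoc (a ⊗ₖ b),
      swapGate_mul_bellGate, swap_canonicalGate]
  · refine ⟨a, b, cᴴ, dᴴ, z, w, C, S, C', S', ha, hb, hc2, hd2, hz1, hw1, hCS, hCS', ?_⟩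
    rw [hsplit, hab, hcd, Matrix.conjTranspose_mul, swapGate_conjTranspose,
      Matrix.conjTranspose_kronecker, ← Matrix.mul_assoc, Matrix.mul_assoc (a ⊗ₖ b),
      swapGate_mul_bellGate, Matrix.mul_assoc (a ⊗ₖ b), bellGate_mul_swapGate]
    rfl

end Canonical

/-! ### Two-qubit gates near dual unitaries -/

section Qubits

open scoped Kronecker

theorem bellGate_mul (p r s t p' r' s' t' : ℂ) :
    bellGate p r s t * bellGate p' r' s' t'
      = bellGate (p * p' + r * r') (p * r' + r * p') (s * s' + t * t') (s * t' + t * s') := by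
  ext ⟨i, j⟩ ⟨k, l⟩
  fin_cases i <;> fin_cases j <;> fin_cases k <;> fin_cases l <;>
    simp [bellGate, Matrix.mul_apply, Fintype.sum_prod_type] <;> ring

theorem bellGate_conjTranspose (p r s t : ℂ) :
    (bellGate p r s t)ᴴ = bellGate (star p) (star r) (star s) (star t) := by
  ext ⟨i, j⟩ ⟨k, l⟩
  fin_cases i <;> fin_cases j <;> fin_cases k <;> fin_cases l <;> simp [bellGate]

theorem bellGate_one : bellGate 1 0 1 0 = 1 := by
  ext ⟨i, j⟩ ⟨k, l⟩
  fin_cases i <;> fin_cases j <;> fin_cases k <;> fin_cases l <;> simp [bellGate]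

/-- Turned sideways, a gate diagonal in the Bell basis is again of that form. -/
theorem sideways_bellGate (p r s t : ℂ) : sideways (bellGate p r s t) = bellGate p s r t := by
  ext ⟨i, j⟩ ⟨k, l⟩
  fin_cases i <;> fin_cases j <;> fin_cases k <;> fin_cases l <;> simp [bellGate, sideways]

theorem mul_star_add_mul_star (z w : ℂ) :
    z * star w + w * star z = ((2 * (z * star w).re : ℝ) : ℂ) := by
  have h : w * star z = (starRingEnd ℂ) (z * star w) := by simp [mul_comm]
  rw [h, Complex.add_conj]

theorem isUnitaryGate_canonicalGate {z w : ℂ} {C S C' S' : ℝ} (hz : ‖z‖ = 1) (hw : ‖w‖ = 1)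
    (h : C ^ 2 + S ^ 2 = 1) (h' : C' ^ 2 + S' ^ 2 = 1) :
    IsUnitaryGate (canonicalGate z w C S C' S') := by
  have hz' : star z * z = 1 := by rw [Complex.star_def, Complex.conj_mul', hz]; simp
  have hw' : star w * w = 1 := by rw [Complex.star_def, Complex.conj_mul', hw]; simp
  have hc : (C : ℂ) ^ 2 + (S : ℂ) ^ 2 = 1 := by exact_mod_cast h
  have hc' : (C' : ℂ) ^ 2 + (S' : ℂ) ^ 2 = 1 := by exact_mod_cast h'
  refine Matrix.mem_unitaryGroup_iff'.2 ?_
  rw [Matrix.star_eq_conjTranspose, canonicalGate, bellGate_conjTranspose, bellGate_mul,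
    ← bellGate_one]
  have hC : ∀ x : ℝ, star (x : ℂ) = x := fun x => Complex.conj_ofReal x
  have hI : star Complex.I = -Complex.I := Complex.conj_I
  simp only [star_mul', hC, hI]
  congr 1
  · linear_combination ((C : ℂ) ^ 2 + (S : ℂ) ^ 2) * hz' + hc
      - (star z * z * (S : ℂ) ^ 2) * Complex.I_mul_I
  · ring
  · linear_combination ((C' : ℂ) ^ 2 + (S' : ℂ) ^ 2) * hw' + hc'
      - (star w * w * (S' : ℂ) ^ 2) * Complex.I_mul_I
  · ring

/-- The canonical gate is dual unitary exactly if `C ^ 2 + C' ^ 2 = 1` and the products `C * C'` and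
`S * S'` vanish unless the phases `z` and `w` are in quadrature. -/
theorem dualContraction_canonicalGate {z w : ℂ} (C S C' S' : ℝ) (hz : ‖z‖ = 1) (hw : ‖w‖ = 1) :
    dualContraction (canonicalGate z w C S C' S')
      = bellGate (C ^ 2 + C' ^ 2 : ℝ) (2 * (C * C' * (z * star w).re) : ℝ)
        (S ^ 2 + S' ^ 2 : ℝ) (2 * (S * S' * (z * star w).re) : ℝ) := by
  have hz' : star z * z = 1 := by rw [Complex.star_def, Complex.conj_mul', hz]; simp
  have hw' : star w * w = 1 := by rw [Complex.star_def, Complex.conj_mul', hw]; simp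
  have hre := mul_star_add_mul_star z w
  rw [dualContraction, canonicalGate, sideways_bellGate, bellGate_conjTranspose, bellGate_mul]
  have hC : ∀ x : ℝ, star (x : ℂ) = x := fun x => Complex.conj_ofReal x
  have hI : star Complex.I = -Complex.I := Complex.conj_I
  simp only [star_mul', hC, hI]
  push_cast at hre ⊢
  congr 1
  · linear_combination (C : ℂ) ^ 2 * hz' + (C' : ℂ) ^ 2 * hw'
  · linear_combination (C * C' : ℂ) * hre
  · linear_combination (S : ℂ) ^ 2 * hz' + (S' : ℂ) ^ 2 * hw'
      - (star z * z * (S : ℂ) ^ 2 + star w * w * (S' : ℂ) ^ 2) * Complex.I_mul_I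
  · linear_combination (S * S' : ℂ) * hre
      - (S * S' * (z * star w + w * star z) : ℂ) * Complex.I_mul_I

theorem exists_sign (x : ℝ) : ∃ σ : ℝ, σ ^ 2 = 1 ∧ x = σ * |x| := by
  rcases le_total 0 x with h | h
  · exact ⟨1, by norm_num, by rw [abs_of_nonneg h, one_mul]⟩
  · exact ⟨-1, by norm_num, by rw [abs_of_nonpos h]; ring⟩

theorem abs_sign_mul {σ : ℝ} (hσ : σ ^ 2 = 1) (x : ℝ) : |σ * x| = |x| := by
  rw [abs_mul, (pow_eq_one_iff_of_nonneg (abs_nonneg σ) two_ne_zero).1 (by rw [sq_abs, hσ]),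
    one_mul]

/-- A point of the unit circle with a small second coordinate is close to the first axis. -/
theorem exists_sign_abs_sub_le {x y ε : ℝ} (h : x ^ 2 + y ^ 2 = 1) (hy : |y| ≤ ε) :
    ∃ σ : ℝ, σ ^ 2 = 1 ∧ |x - σ| ≤ ε := by
  obtain ⟨σ, hσ, hx⟩ := exists_sign x
  refine ⟨σ, hσ, ?_⟩
  have e : x - σ = σ * (|x| - 1) := by linear_combination hx
  have hx0 := abs_nonneg x
  have hy0 := abs_nonneg y
  have h1 : |x| ^ 2 + |y| ^ 2 = 1 := by rw [sq_abs, sq_abs, h]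
  rw [e, abs_sign_mul hσ, abs_le]
  constructor <;> nlinarith

theorem abs_abs_sub_abs_le {x y ε : ℝ} (hε : 0 ≤ ε) (h : |x ^ 2 - y ^ 2| ≤ ε ^ 2) :
    |(|x| - |y|)| ≤ ε := by
  refine abs_le_of_sq_le_sq ?_ hε
  have hx := abs_nonneg x
  have hy := abs_nonneg y
  rw [← sq_abs x, ← sq_abs y, abs_le] at h
  rcases le_total |x| |y| with hle | hle <;> nlinarith

/-- Scalar core of the two-qubit bound: canonical parameters that satisfy the conditions of dual
unitarity up to `ε²` are within `O(ε)` of parameters that satisfy them exactly. -/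
theorem exists_exact_parameters {z w : ℂ} {C S C' S' ε : ℝ} (hε : 0 ≤ ε) (hz : ‖z‖ = 1)
    (hw : ‖w‖ = 1) (h : C ^ 2 + S ^ 2 = 1) (h' : C' ^ 2 + S' ^ 2 = 1)
    (h1 : |C ^ 2 + C' ^ 2 - 1| ≤ ε ^ 2) (h2 : |2 * (C * C' * (z * star w).re)| ≤ ε ^ 2) :
    ∃ (v : ℂ) (C₁ S₁ C₂ S₂ : ℝ), ‖v‖ = 1 ∧ C₁ ^ 2 + S₁ ^ 2 = 1 ∧ C₂ ^ 2 + S₂ ^ 2 = 1 ∧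
      C₁ ^ 2 + C₂ ^ 2 = 1 ∧ C₁ * C₂ * (z * star v).re = 0 ∧ S₁ * S₂ * (z * star v).re = 0 ∧
      ‖w - v‖ ≤ 2 * ε ∧ |C - C₁| ≤ 2 * ε ∧ |S - S₁| ≤ 2 * ε ∧ |C' - C₂| ≤ 2 * ε ∧
      |S' - S₂| ≤ 2 * ε := by
  have hz' : star z * z = 1 := by rw [Complex.star_def, Complex.conj_mul', hz]; simp
  have hε2 : |(0 : ℝ)| ≤ 2 * ε := by simpa using hε
  rcases le_or_gt |(z * star w).re| ε with hc | hc
  · -- the phases are almost in quadrature: make this exact, and match the moduli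
    set x := (z * star w).re
    set y := (z * star w).im
    have hxy : y ^ 2 + x ^ 2 = 1 := by
      have : ‖z * star w‖ ^ 2 = 1 := by rw [norm_mul, norm_star, hz, hw]; norm_num
      rw [Complex.sq_norm, Complex.normSq_apply] at this
      linarith
    have hw' : w = (x - y * Complex.I) * z := by
      have e : star (z * star w) = x - y * Complex.I := by
        apply Complex.ext <;> simp [x, y]; ring
      rw [← e, star_mul', star_star]
      linear_combination (-w) * hz'
    obtain ⟨τ, hτ, hyτ⟩ := exists_sign_abs_sub_le hxy hc
    obtain ⟨σ, hσ, hC'⟩ := exists_sign C'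
    obtain ⟨σ', hσ', hS'⟩ := exists_sign S'
    have hτ1 : |τ| = 1 := by simpa using abs_sign_mul hτ 1
    refine ⟨-(τ * Complex.I) * z, C, S, σ * |S|, σ' * |C|, ?_, h, ?_, ?_, ?_, ?_, ?_, ?_, ?_,
      ?_, ?_⟩
    · rw [norm_mul, norm_neg, norm_mul, Complex.norm_real, Complex.norm_I, Real.norm_eq_abs, hτ1,
        hz]; norm_num
    · rw [mul_pow, mul_pow, sq_abs, sq_abs, hσ, hσ']; linarith
    · rw [mul_pow, sq_abs, hσ]; linarith
    all_goals try
      rw [show z * star (-(τ * Complex.I) * z) = (τ * Complex.I) by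
        rw [star_mul', star_neg, star_mul', Complex.star_def, Complex.conj_ofReal, Complex.conj_I,
          ← Complex.star_def]
        linear_combination (τ * Complex.I) * hz']
      simp
    · have e : w - -(τ * Complex.I) * z = (x - ((y - τ : ℝ) : ℂ) * Complex.I) * z := by
        conv_lhs => rw [hw']
        push_cast
        ring
      rw [e, norm_mul, hz, mul_one]
      refine (norm_sub_le _ _).trans ?_
      rw [norm_mul, Complex.norm_real, Complex.norm_real, Complex.norm_I, Real.norm_eq_abs,
        Real.norm_eq_abs]
      linarith
    · rwa [sub_self]
    · rwa [sub_self]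
    · rw [show C' - σ * |S| = σ * (|C'| - |S|) by linear_combination hC', abs_sign_mul hσ]
      refine (abs_abs_sub_abs_le hε ?_).trans (by linarith)
      rwa [show C' ^ 2 - S ^ 2 = C ^ 2 + C' ^ 2 - 1 by linarith]
    · rw [show S' - σ' * |C| = σ' * (|S'| - |C|) by linear_combination hS', abs_sign_mul hσ']
      refine (abs_abs_sub_abs_le hε ?_).trans (by linarith)
      rwa [show S' ^ 2 - C ^ 2 = -(C ^ 2 + C' ^ 2 - 1) by linarith, abs_neg]
  · -- the products of the moduli are small: move to a gate locally equivalent to the swap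
    have hprod : ∀ a b : ℝ, |2 * (a * b * (z * star w).re)| ≤ ε ^ 2 → a ^ 2 * b ^ 2 ≤ ε ^ 2 / 4 := by
      intro a b hab
      rw [abs_mul, abs_mul, abs_two] at hab
      have h0 : |a * b| ≤ ε / 2 := by
        by_contra! hlt
        nlinarith [abs_nonneg (a * b)]
      have := sq_le_sq' (by have := abs_nonneg (a * b); linarith) h0
      rw [sq_abs] at this
      nlinarith
    have hCC := hprod C C' h2
    obtain ⟨h1a, h1b⟩ := abs_le.1 h1
    have hCS : C ^ 2 * S ^ 2 ≤ 5 / 4 * ε ^ 2 := by nlinarith [sq_nonneg C, sq_nonneg S]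
    have habs : ∀ a : ℝ, a ^ 2 ≤ 4 * ε ^ 2 → |a| ≤ 2 * ε := fun a ha =>
      abs_le_of_sq_le_sq (by linarith) (by linarith)
    rcases le_total (1 / 2) (C ^ 2) with hC | hC
    · have hS : |S| ≤ 2 * ε := habs _ (by nlinarith [sq_nonneg S])
      have hC' : |C'| ≤ 2 * ε := habs _ (by nlinarith [sq_nonneg S])
      obtain ⟨σ, hσ, hCσ⟩ := exists_sign_abs_sub_le h hS
      obtain ⟨τ, hτ, hSτ⟩ := exists_sign_abs_sub_le (x := S') (y := C') (by linarith) hC'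
      exact ⟨w, σ, 0, 0, τ, hw, by rw [hσ]; ring, by rw [hτ]; ring, by rw [hσ]; ring, by ring,
        by ring, by simpa using hε, hCσ, by rwa [sub_zero], by rwa [sub_zero], hSτ⟩
    · have hC2 : C ^ 2 ≤ 5 / 2 * ε ^ 2 := by nlinarith [sq_nonneg C]
      have hC0 : |C| ≤ 2 * ε := habs _ (by nlinarith)
      have hS' : |S'| ≤ 2 * ε := habs _ (by nlinarith)
      obtain ⟨σ, hσ, hSσ⟩ := exists_sign_abs_sub_le (x := S) (y := C) (by linarith) hC0
      obtain ⟨τ, hτ, hCτ⟩ := exists_sign_abs_sub_le h' hS'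
      exact ⟨w, 0, σ, τ, 0, hw, by rw [hσ]; ring, by rw [hτ]; ring, by rw [hτ]; ring, by ring,
        by ring, by simpa using hε, by rwa [sub_zero], hSσ, hCτ, by rwa [sub_zero]⟩

theorem norm_smul_sub_smul_le {z w : ℂ} {a b : ℝ} (hz : ‖z‖ = 1) (hb : |b| ≤ 1) :
    ‖z * a - w * b‖ ≤ |a - b| + ‖z - w‖ := by
  calc ‖z * a - w * b‖ = ‖z * ((a - b : ℝ) : ℂ) + (z - w) * b‖ := by
        congr 1; push_cast; ring
    _ ≤ |a - b| + ‖z - w‖ := by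
        refine (norm_add_le _ _).trans ?_
        rw [norm_mul, norm_mul, hz, Complex.norm_real, Complex.norm_real, Real.norm_eq_abs,
          Real.norm_eq_abs]
        nlinarith [norm_nonneg (z - w)]

theorem abs_le_one_of_sq_add_sq {a b : ℝ} (h : a ^ 2 + b ^ 2 = 1) : |a| ≤ 1 ∧ |b| ≤ 1 :=
  ⟨abs_le_one_iff_mul_self_le_one.2 (by nlinarith [sq_nonneg b]),
    abs_le_one_iff_mul_self_le_one.2 (by nlinarith [sq_nonneg a])⟩

theorem norm_bellGate_sub_apply_le {p r s t p' r' s' t' : ℂ} {c : ℝ} (hc : 0 ≤ c)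
    (hp : ‖p - p'‖ ≤ c) (hr : ‖r - r'‖ ≤ c) (hs : ‖s - s'‖ ≤ c) (ht : ‖t - t'‖ ≤ c)
    (x y : Fin 2 × Fin 2) : ‖(bellGate p r s t - bellGate p' r' s' t') x y‖ ≤ c := by
  simp only [bellGate, Matrix.sub_apply, Matrix.of_apply]
  split_ifs <;> simp [*]

theorem hsNorm_le_of_entry_le_two_qubits {M : Gate 2} {c : ℝ} (hc : 0 ≤ c)
    (h : ∀ x y, ‖M x y‖ ≤ c) : hsNorm M ≤ 4 * c := by
  have := hsNorm_le_of_entry_le M hc h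
  rwa [Real.sqrt_mul_self (by positivity), Fintype.card_prod, Fintype.card_fin,
    show ((2 * 2 : ℕ) : ℝ) = 4 by norm_num] at this

theorem exists_isDualUnitary_near_canonicalGate {z w : ℂ} {C S C' S' ε : ℝ} (hε : 0 ≤ ε)
    (hz : ‖z‖ = 1) (hw : ‖w‖ = 1) (h : C ^ 2 + S ^ 2 = 1) (h' : C' ^ 2 + S' ^ 2 = 1)
    (hD : hsNorm (dualContraction (canonicalGate z w C S C' S') - 1) ≤ ε ^ 2) :
    ∃ V : Gate 2, IsDualUnitary V ∧ hsNorm (canonicalGate z w C S C' S' - V) ≤ 16 * ε := by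
  rw [dualContraction_canonicalGate _ _ _ _ hz hw] at hD
  have hent := fun x y => (norm_entry_le_hsNorm _ x y).trans hD
  have e1 : |C ^ 2 + C' ^ 2 - 1| ≤ ε ^ 2 := by
    have := hent (0, 0) (0, 0)
    rw [← Real.norm_eq_abs, ← Complex.norm_real]
    simpa [bellGate] using this
  have e2 : |2 * (C * C' * (z * star w).re)| ≤ ε ^ 2 := by
    have := hent (0, 0) (1, 1)
    rw [← Real.norm_eq_abs, ← Complex.norm_real]
    simpa [bellGate] using this
  obtain ⟨v, C₁, S₁, C₂, S₂, hv, hCS₁, hCS₂, hCC, hre, hre', hwv, hC, hS, hC', hS'⟩ :=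
    exists_exact_parameters hε hz hw h h' e1 e2
  refine ⟨canonicalGate z v C₁ S₁ C₂ S₂, ⟨isUnitaryGate_canonicalGate hz hv hCS₁ hCS₂, ?_⟩, ?_⟩
  · rw [dualContraction_canonicalGate _ _ _ _ hz hv, hCC, hre, hre',
      show S₁ ^ 2 + S₂ ^ 2 = 1 by linarith, ← bellGate_one]
    simp
  · have hI : ∀ x : ℂ, ‖x‖ = 1 → ‖Complex.I * x‖ = 1 := by
      intro x hx; rw [norm_mul, Complex.norm_I, hx, one_mul]
    obtain ⟨b1, b2⟩ := abs_le_one_of_sq_add_sq hCS₁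
    obtain ⟨b3, b4⟩ := abs_le_one_of_sq_add_sq hCS₂
    have hIwv : ‖Complex.I * w - Complex.I * v‖ ≤ 2 * ε := by
      rw [← mul_sub, norm_mul, Complex.norm_I, one_mul]; exact hwv
    refine (hsNorm_le_of_entry_le_two_qubits (c := 4 * ε) (by linarith) (norm_bellGate_sub_apply_le (by linarith)
        ((norm_smul_sub_smul_le hz b1).trans (by rw [sub_self, norm_zero]; linarith))
        ((norm_smul_sub_smul_le (hI z hz) b2).trans (by rw [sub_self, norm_zero]; linarith))
        ((norm_smul_sub_smul_le hw b3).trans (by linarith))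
        ((norm_smul_sub_smul_le (hI w hw) b4).trans (by linarith)))).trans (by linarith)

/-- Local unitaries act on the sideways gate from the left and from the right. -/
theorem sideways_local (a b c d : Matrix (Fin 2) (Fin 2) ℂ) (V : Gate 2) :
    sideways ((a ⊗ₖ b) * V * (c ⊗ₖ d)) = (a ⊗ₖ cᵀ) * sideways V * (bᵀ ⊗ₖ d) := by
  ext ⟨i, k⟩ ⟨j, l⟩
  simp only [sideways, Matrix.of_apply, Matrix.mul_apply, Matrix.kroneckerMap_apply,
    Matrix.transpose_apply, Fintype.sum_prod_type, Fin.sum_univ_two]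
  ring

theorem transpose_conjTranspose_mul {a : Matrix (Fin 2) (Fin 2) ℂ} (ha : aᴴ * a = 1) :
    aᵀᴴ * aᵀ = 1 := by
  have := congrArg Matrix.transpose (mul_eq_one_comm.1 ha)
  rwa [Matrix.transpose_mul, Matrix.transpose_one] at this

theorem dualContraction_local (a : Matrix (Fin 2) (Fin 2) ℂ) {b : Matrix (Fin 2) (Fin 2) ℂ}
    (c : Matrix (Fin 2) (Fin 2) ℂ) {d : Matrix (Fin 2) (Fin 2) ℂ} (hb : bᴴ * b = 1)
    (hd : dᴴ * d = 1) (V : Gate 2) :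
    dualContraction ((a ⊗ₖ b) * V * (c ⊗ₖ d))
      = (a ⊗ₖ cᵀ) * dualContraction V * (a ⊗ₖ cᵀ)ᴴ := by
  have h : (bᵀ ⊗ₖ d) * (bᵀ ⊗ₖ d)ᴴ = 1 := mul_eq_one_comm.1
    (kronecker_conjTranspose_mul_eq_one (transpose_conjTranspose_mul hb) hd)
  rw [dualContraction, sideways_local, Matrix.conjTranspose_mul, Matrix.conjTranspose_mul,
    dualContraction]
  calc _ = (a ⊗ₖ cᵀ) * sideways V * ((bᵀ ⊗ₖ d) * (bᵀ ⊗ₖ d)ᴴ) * (sideways V)ᴴ * (a ⊗ₖ cᵀ)ᴴ := by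
        simp only [Matrix.mul_assoc]
    _ = _ := by rw [h, Matrix.mul_one]; simp only [Matrix.mul_assoc]

theorem hsNorm_mul_mul_le {A M B : Gate 2} (hA : Aᴴ * A = 1) (hB : Bᴴ * B = 1) :
    hsNorm (A * M * B) ≤ hsNorm M := by
  rw [Matrix.mul_assoc]
  refine ((isContraction_of_conjTranspose_mul_self_eq_one hA).hsNorm_mul_le _).trans ?_
  rw [← hsNorm_conjTranspose, Matrix.conjTranspose_mul, ← hsNorm_conjTranspose M]
  exact (isContraction_of_conjTranspose_mul_self_eq_one hB).conjTranspose.hsNorm_mul_le _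

/-- A two-qubit gate that is dual unitary up to `ε²` is within `O(ε)` of a dual unitary. -/
theorem exists_isDualUnitary_near {u : Gate 2} (hu : IsUnitaryGate u) {ε : ℝ} (hε : 0 ≤ ε)
    (hD : hsNorm (dualContraction u - 1) ≤ ε ^ 2) :
    ∃ u' : Gate 2, IsDualUnitary u' ∧ hsNorm (u - u') ≤ 16 * ε := by
  obtain ⟨a, b, c, d, z, w, C, S, C', S', ha, hb, hc, hd, hz, hw, h, h', hV⟩ :=
    exists_canonical_form hu
  set V₀ := canonicalGate z w C S C' S'
  have hab := kronecker_conjTranspose_mul_eq_one ha hb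
  have hcd := kronecker_conjTranspose_mul_eq_one hc hd
  set W := a ⊗ₖ cᵀ with hW
  have hW1 : Wᴴ * W = 1 := kronecker_conjTranspose_mul_eq_one ha (transpose_conjTranspose_mul hc)
  have hW2 : W * Wᴴ = 1 := mul_eq_one_comm.1 hW1
  have hD₀ : dualContraction V₀ - 1 = Wᴴ * (dualContraction u - 1) * W := by
    rw [hV, dualContraction_local a c hb hd, ← hW, Matrix.mul_sub, Matrix.sub_mul, Matrix.mul_one,
      hW1]
    congr 1
    calc dualContraction V₀ = (Wᴴ * W) * dualContraction V₀ * (Wᴴ * W) := by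
          rw [hW1, Matrix.one_mul, Matrix.mul_one]
      _ = _ := by simp only [Matrix.mul_assoc]
  obtain ⟨V, ⟨hV1, hV2⟩, hVV⟩ := exists_isDualUnitary_near_canonicalGate hε hz hw h h' (by
    rw [hD₀]
    exact (hsNorm_mul_mul_le (by rwa [Matrix.conjTranspose_conjTranspose]) hW1).trans hD)
  refine ⟨(a ⊗ₖ b) * V * (c ⊗ₖ d), ⟨?_, ?_⟩, ?_⟩
  · exact mul_mem (mul_mem (Matrix.mem_unitaryGroup_iff'.2 hab) hV1)
      (Matrix.mem_unitaryGroup_iff'.2 hcd)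
  · rw [dualContraction_local a c hb hd, hV2, Matrix.mul_one, ← hW, hW2]
  · rw [hV, ← Matrix.sub_mul, ← Matrix.mul_sub]
    exact (hsNorm_mul_mul_le hab hcd).trans hVV

theorem exists_isDualUnitary_traceNorm_le {u : Gate 2} (hu : IsUnitaryGate u) {δ : ℝ} (hδ : 0 ≤ δ)
    (hD : hsNorm (dualContraction u - 1) ≤ δ) :
    ∃ u' : Gate 2, IsDualUnitary u' ∧ traceNorm (u - u') ≤ 32 * Real.sqrt δ := by
  obtain ⟨u', hu', hd⟩ := exists_isDualUnitary_near hu (Real.sqrt_nonneg δ)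
    (by rwa [Real.sq_sqrt hδ])
  refine ⟨u', hu', (traceNorm_le _).trans ?_⟩
  rw [Fintype.card_prod, Fintype.card_fin, Nat.cast_mul, Real.sqrt_mul_self (by positivity)]
  push_cast
  linarith

/-- The bound on the velocity controls `dualContraction u - 1` by `√η`, and the two-qubit estimate
takes a further square root. -/
theorem exists_isDualUnitary_of_velocity {u : Gate 2} (hu : IsUnitaryGate u) {η : ℝ} (hη : 0 < η)
    (hv : IsEntanglementVelocity u (1 - η)) :
    ∃ u' : Gate 2, IsDualUnitary u' ∧
      traceNorm (u - u') ≤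
        32 * Real.sqrt (4 * Real.sqrt (72 * 2 ^ 4 * Real.log 2)) * η ^ (1 / 4 : ℝ) := by
  have hlog : 0 ≤ 72 * 2 ^ 4 * Real.log 2 := by
    have := Real.log_pos (one_lt_two (α := ℝ))
    positivity
  have hent : ∀ p s, ‖(dualContraction u - 1) p s‖ ≤ Real.sqrt (72 * 2 ^ 4 * Real.log 2 * η) := by
    intro p s
    refine Real.le_sqrt_of_sq_le ?_
    exact_mod_cast norm_dualContraction_sub_one_sq_le_of_velocity le_rfl hu hv p s
  have hδ : 4 * Real.sqrt (72 * 2 ^ 4 * Real.log 2 * η)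
      = 4 * Real.sqrt (72 * 2 ^ 4 * Real.log 2) * Real.sqrt η := by
    rw [Real.sqrt_mul hlog, ← mul_assoc]
  obtain ⟨u', hu', h⟩ := exists_isDualUnitary_traceNorm_le hu
    (δ := 4 * Real.sqrt (72 * 2 ^ 4 * Real.log 2 * η)) (by positivity)
    (hsNorm_le_of_entry_le_two_qubits (Real.sqrt_nonneg _) hent)
  refine ⟨u', hu', h.trans (le_of_eq ?_)⟩
  rw [hδ, Real.sqrt_mul (by positivity) (Real.sqrt η), Real.sqrt_eq_rpow (Real.sqrt η),
    Real.sqrt_eq_rpow η, ← Real.rpow_mul hη.le, ← mul_assoc,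
    show (1 / 2 * (1 / 2) : ℝ) = 1 / 4 by norm_num]

end Qubits

end DualUnitarity

theorem theorem2 :
    -- `q = 2`: a dual unitary at distance `O(η ^ (1/4))`
    (∃ K : ℝ, ∀ η : ℝ, 0 < η → η < 1 →
      ∀ u : Gate 2, IsUnitaryGate u → IsEntanglementVelocity u (1 - η) →
        ∃ u' : Gate 2, IsDualUnitary u' ∧ traceNorm (u - u') ≤ K * η ^ (1 / 4 : ℝ)) ∧
    -- `q > 2`: a dual unitary at distance `f_q(η)`, which tends to `0`
    (∀ q : ℕ, 2 < q →
      ∃ f : ℝ → ℝ, Tendsto f (𝓝[>] 0) (𝓝 0) ∧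
        ∀ η : ℝ, 0 < η → η < 1 →
          ∀ u : Gate q, IsUnitaryGate u → IsEntanglementVelocity u (1 - η) →
            ∃ u' : Gate q, IsDualUnitary u' ∧ traceNorm (u - u') ≤ f η) ∧
    -- `q = 2`: approximate dual unitarity up to `δ` gives a dual unitary at distance `O(√δ)`
    (∃ K : ℝ, ∀ δ : ℝ, 0 ≤ δ →
      ∀ u : Gate 2, IsUnitaryGate u → traceNorm (1 - dualContraction u) ≤ δ →
        ∃ u' : Gate 2, IsDualUnitary u' ∧ traceNorm (u - u') ≤ K * Real.sqrt δ) := by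
  refine ⟨⟨_, fun η hη _ u hu hv => exists_isDualUnitary_of_velocity hu hη hv⟩,
    fun q hq => exists_modulus hq, 32, fun δ hδ u hu hD => ?_⟩
  refine exists_isDualUnitary_traceNorm_le hu hδ ((hsNorm_sub_comm _ _).trans_le ?_)
  exact (hsNorm_le_traceNorm _).trans hD
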